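/- **Data.** Let $d\in\mathbb N$, $m,L,\varepsilon,\gamma>0$, and let $\chi$ be smooth on $[0,\infty)$ with values in $[0,1]$, $\chi=1$ on $[0,1]$ and $\chi=0$ on $(2,\infty)$. For $\eta\in\{0,1\}$ put $\bar\eta=1-\eta$, and let $Q^\eta:\mathbb R^d\times\mathbb R^d\to\mathbb C$ satisfy $Q^\eta(\xi_1,\xi_2)=Q^\eta(\xi_2,\xi_1)$, $Q^\eta(-\xi_1,-\xi_2)=\overline{Q^\eta(\xi_1,\xi_2)}$, $Q^\eta(\xi,-\xi)=0$. Let $M^{\eta,\eta'}:\mathbb R^d\to\mathbb C$ vanish outside a ball and satisfy $M^{\eta,\eta'}=\overline{M^{\eta',\eta}}$. Put $\mathbb Z_L^d=L^{-1}\mathbb Z^d$, $\langle k\rangle=\sqrt{m+|k|^2}$, and $$q^\eta(k_1,k_2)=\frac{Q^\eta(k_1,k_2)}{4(2\pi)^{d/2}\langle k_1\rangle\langle k_2\rangle},\qquad q^\eta_\iota(k_1,k_2,k_3)=\frac{4\langle k_1+k_3\rangle\,q^{\bar\eta}(k_1,k_3)\,q^\eta(k_1+k_3,k_2)}{m+2\big((k_1+k_2+k_3)\cdot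 k_2-\iota\langle k_1+k_2+k_3\rangle\langle k_2\rangle\big)}\quad(\iota=\pm),$$ $$N^\eta(\xi,\zeta)=q^\eta_+(\xi,\zeta,-\zeta)-\overline{q^\eta_-(\xi,-\zeta,\zeta)},\qquad P_\pm(\xi,\zeta)=\overline{q^1_\pm(\xi,\pm\zeta,\mp\zeta)}-q^0_\pm(\xi,\pm\zeta,\mp\zeta).$$ With $\chi_\varepsilon(k)=\chi(\varepsilon^{-\gamma}|k|)$ let $\chi_{\mathrm{low}\text{-}r}(k_1,k_2,k_3)=\chi_\varepsilon(k_1+k_2)(1-\chi_\varepsilon(k_1+k_3))(1-\chi_\varepsilon(k_2+k_3))$; $\chi_{\mathrm{low}\text{-}\ell}$ and $\chi_{\mathrm{low}\text{-}m}$ are defined likewise with $k_2+k_3$, respectively $k_1+k_3$, as the small sum, and $\chi_{\mathrm{high}}=1-\chi_{\mathrm{low}\text{-}\ell}-\chi_{\mathrm{low}\text{-}m}-\chi_{\mathrm{low}\text{-}r}$. **Trees.** Consider finite rooted plane trees in which every node (that is, every non-leaf vertex) is either binary, of type $B_{\mathrm{st}}$ or $B_{\mathrm{in}}$, or ternary,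 of type low-$\ell$, low-$m$, low-$r$ or high; both children of a $B_{\mathrm{in}}$ node are leaves. Every vertex $x$ has a sign $\varphi(x)\in\{\pm\}$ and a colour $c(x)\in\{0,1\}$. Signs are arbitrary; colours are such that both children of a binary node have the colour opposite to that of the node, while the left and right children of a ternary node have its colour and the middle child has the opposite colour. A low-$\ell$, low-$m$, low-$r$ node has as marked children its (middle, right), (left, right), (left, middle) children, respectively; other nodes have no marked child. The prebush of a leaf is the set consisting of this leaf; the prebush of a node is the union of the prebushes of its unmarked children; the bush of a low node is the union of the prebushes of its two marked children. A coupling $C=(A,A',\sigma)$ consists of two such trees and an involution $\sigma$ of the union of their sets of leaves that exchanges positive and negative leaves. Write $n_B$ and $n_T$ for its numbers of binary and ternary nodes, and $n(C)=n_B+2n_T$. A set of leaves is self-coupled if $\sigma$ maps its positive leaves bijectively onto its negative ones. A node is resonant if it is low, its bush is self-coupled, its marked children have opposite signs and its unmarked child has the sign of the node. Let $\mathrm{Res}_n(\iota,\iota',\eta,\eta')$ be the finite set of couplings with exactly $n$ nodes, all of them resonant, such that the roots of $A$ and $A'$ have signs $\iota,\iota'$ and colours $\eta,\eta'$. **Contribution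 of a coupling.** For $k\in\mathbb Z_L^d$, let $\mathcal D_k(C)$ be the set of maps $\kappa$ from the vertices of $C$ to $\mathbb Z_L^d$ such that the value at a node is the sum of the values at its children, $\kappa(\ell)+\kappa(\sigma(\ell))=0$ for every leaf $\ell$, and the value at the root of $A$ is $k$. For a node $j$ with children $x_1,x_2,\dots$ let $\Delta_j=\varphi(j)\langle\kappa(j)\rangle-\sum_i\varphi(x_i)\langle\kappa(x_i)\rangle$. For a ternary node $j$, $\Omega_j$ is $\Delta_j$ plus the sum of $\Delta_{j'}$ over the $B_{\mathrm{st}}$ nodes $j'$ for which $j$ is the closest ternary node above $j'$, and $\Omega_{-1}$ is the sum of $\Delta_{j'}$ over the $B_{\mathrm{st}}$ nodes $j'$ with no ternary node above them. Let $q_j=\pm\varphi(j)\,q^{c(j)}(\kappa(x_1),\kappa(x_2))/\Delta_j$ for a binary node ($+$ for $B_{\mathrm{st}}$, $-$ for $B_{\mathrm{in}}$) and $q_j=\varphi(j)\,\chi_*(\kappa(x_1),\kappa(x_2),\kappa(x_3))\,q^{c(j)}_{\varphi(j)\varphi(x_2)}(\kappa(x_1),\kappa(x_2),\kappa(x_3))$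 for a ternary node of type $*$. Let $I_C(t)$ be the set of $(s_j)\in[0,t]^{n_T}$, indexed by the ternary nodes, such that $s_j\le s_{j'}$ whenever $j$ lies below $j'$. With $z^{+}=z$ and $z^-=\bar z$, put $$\widehat F_C(\varepsilon^{-2}t,k)=\frac{\varepsilon^{n_B}}{L^{n(C)d/2}}(-i)^{n_T}\sum_{\kappa\in\mathcal D_k(C)}e^{i\varepsilon^{-2}\Omega_{-1}t}\prod_{j}q_j\int_{I_C(t)}\prod_{j\ \text{ternary}}e^{i\Omega_j\varepsilon^{-2}s_j}\,ds\prod_{\ell:\ \varphi(\ell)=-}M^{c(\ell),c(\sigma(\ell))}\big(\varphi(\ell)\kappa(\ell)\big)^{\varphi(\ell)},$$ $$\rho^\eta_{L,n}(t,k)=\sum_{C\in\mathrm{Res}_n(+,-,\eta,\eta)}\widehat F_C(\varepsilon^{-2}t,k),\qquad \rho^\times_{L,n}(t,k)=\sum_{C\in\mathrm{Res}_n(+,-,0,1)}\widehat F_C(\varepsilon^{-2}t,k).$$ **Proposition.** The sums over $\kappa$ above have finitely many nonzero terms for every coupling, every $t\in\mathbb R$ and every $k\in\mathbb Z_L^d$.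 For all $t\ge0$, $k\in\mathbb Z_L^d$, $n\in\mathbb N$ and $\eta\in\{0,1\}$, the function $\rho^\times_{L,n}(t,\cdot)$ has finite support, $\rho^\eta_{L,n}(\cdot,k)$ and $\rho^\times_{L,n}(\cdot,k)$ are continuous on $[0,\infty)$, and $\rho^\eta_{L,n}(t,k)$ is real. Moreover $\rho^\eta_{L,0}(t,k)=M^{\eta,\eta}(k)$, $\rho^\times_{L,0}(t,k)=M^{0,1}(k)$, and $$\rho^0_{L,n+1}(t,k)=4\sum_{n_1+n_2=n}\int_0^t\rho^0_{L,n_1}(\tau,k)\,L^{-d}\sum_{k_2\in\mathbb Z_L^d}\chi_{\mathrm{low}\text{-}r}(k_2,-k_2,k)\,\mathrm{Im}\big(N^0(k,k_2)\overline{\rho^\times_{L,n_2}(\tau,k_2)}\big)\,d\tau,$$ $$\rho^1_{L,n+1}(t,k)=4\sum_{n_1+n_2=n}\int_0^t\rho^1_{L,n_1}(\tau,k)\,L^{-d}\sum_{k_2\in\mathbb Z_L^d}\chi_{\mathrm{low}\text{-}r}(k_2,-k_2,k)\,\mathrm{Im}\big(N^1(k,k_2)\rho^\times_{L,n_2}(\tau,k_2)\big)\,d\tau,$$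 $$\rho^\times_{L,n+1}(t,k)=2i\sum_{n_1+n_2=n}\int_0^t\rho^\times_{L,n_1}(\tau,k)\,L^{-d}\sum_{k_2\in\mathbb Z_L^d}\chi_{\mathrm{low}\text{-}r}(k_2,-k_2,k)\Big(P_-(k,k_2)\rho^\times_{L,n_2}(\tau,k_2)+P_+(k,k_2)\overline{\rho^\times_{L,n_2}(\tau,k_2)}\Big)\,d\tau.$$ -/

import Mathlib

noncomputable section

namespace ResonantKG

/-! ### Data of the problem

Colours `0`, `1` are the Booleans `false`, `true`, and `!η` is the opposite colour.
Signs `±` are the elements of `ℤˣ`. -/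

/-- Frequency space `ℝ^d`. -/
abbrev Freq (d : ℕ) : Type := EuclideanSpace ℝ (Fin d)

/-- The lattice `ℤ_L^d = L⁻¹ ℤ^d`. -/
def lattice (L : ℝ) (d : ℕ) : AddSubgroup (Freq d) where
  carrier := {k | ∀ i, ∃ z : ℤ, k i = (z : ℝ) / L}
  zero_mem' := fun i => ⟨0, by simp⟩
  add_mem' := by
    intro a b ha hb i
    obtain ⟨x, hx⟩ := ha i
    obtain ⟨y, hy⟩ := hb i
    exact ⟨x + y, by simp [hx, hy, add_div]⟩
  neg_mem' := by
    intro a ha i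
    obtain ⟨x, hx⟩ := ha i
    exact ⟨-x, by simp [hx, neg_div]⟩

/-- The objects on which everything depends: the mass `m`, the size `L` of the torus, the small
parameter `ε`, the exponent `γ` and the profile `χ` of the frequency cutoffs, the symbols `Q^η` of
the nonlinearities and the covariances `M^{η,η'}` of the Gaussian initial data. -/
structure KGData (d : ℕ) where
  m : ℝ
  L : ℝ
  ε : ℝ
  γ : ℝ
  χ : ℝ → ℝ
  Q : Bool → Freq d → Freq d → ℂ
  M : Bool → Bool → Freq d → ℂ

/-- The standing assumptions on the data. -/
structure KGData.Standing {d : ℕ} (D : KGData d) : Prop where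
  m_pos : 0 < D.m
  L_pos : 0 < D.L
  ε_pos : 0 < D.ε
  γ_pos : 0 < D.γ
  χ_smooth : ContDiffOn ℝ (⊤ : ℕ∞) D.χ (Set.Ici 0)
  χ_mem : ∀ x, 0 ≤ x → D.χ x ∈ Set.Icc (0 : ℝ) 1
  χ_one : ∀ x ∈ Set.Icc (0 : ℝ) 1, D.χ x = 1
  χ_zero : ∀ x, 2 < x → D.χ x = 0
  Q_symm : ∀ η ξ₁ ξ₂, D.Q η ξ₁ ξ₂ = D.Q η ξ₂ ξ₁
  Q_conj : ∀ η ξ₁ ξ₂, D.Q η (-ξ₁) (-ξ₂) = starRingEnd ℂ (D.Q η ξ₁ ξ₂)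
  Q_zero : ∀ η ξ, D.Q η ξ (-ξ) = 0
  M_conj : ∀ η η' ξ, D.M η η' ξ = starRingEnd ℂ (D.M η' η ξ)
  M_supp : ∃ R : ℝ, 0 < R ∧ ∀ η η' ξ, R < ‖ξ‖ → D.M η η' ξ = 0

/-- The four types of ternary nodes. In a low node, the two marked children are the middle and
right ones (`lowL`), the left and right ones (`lowM`), the left and middle ones (`lowR`). -/
inductive TernKind : Type
  | lowL
  | lowM
  | lowR
  | high

namespace KGData

variable {d : ℕ} (D : KGData d)

/-- The momenta `ℤ_L^d`. -/
abbrev Mom : Type := lattice D.L d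

/-- Japanese bracket `⟨k⟩ = √(m + |k|²)`. -/
def bracket (k : Freq d) : ℝ := Real.sqrt (D.m + ‖k‖ ^ 2)

/-- The quadratic symbol `q^η(k₁,k₂)`. -/
def q₂ (η : Bool) (k₁ k₂ : Freq d) : ℂ :=
  D.Q η k₁ k₂ / ((4 * (2 * Real.pi) ^ ((d : ℝ) / 2) * D.bracket k₁ * D.bracket k₂ : ℝ) : ℂ)

/-- The cubic symbol `q^η_ι(k₁,k₂,k₃)`. -/
def q₃ (η : Bool) (ι : ℤˣ) (k₁ k₂ k₃ : Freq d) : ℂ :=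
  ((4 * D.bracket (k₁ + k₃) /
      (D.m + 2 * (inner ℝ (k₁ + k₂ + k₃) k₂
        - ((ι : ℤ) : ℝ) * D.bracket (k₁ + k₂ + k₃) * D.bracket k₂)) : ℝ) : ℂ)
    * D.q₂ (!η) k₁ k₃ * D.q₂ η (k₁ + k₃) k₂

/-- The kernel `N^η(ξ,ζ)`. -/
def kerN (η : Bool) (ξ ζ : Freq d) : ℂ :=
  D.q₃ η 1 ξ ζ (-ζ) - starRingEnd ℂ (D.q₃ η (-1) ξ (-ζ) ζ)

/-- The kernel `P_+(ξ,ζ)`. -/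
def kerPplus (ξ ζ : Freq d) : ℂ :=
  starRingEnd ℂ (D.q₃ true 1 ξ ζ (-ζ)) - D.q₃ false 1 ξ ζ (-ζ)

/-- The kernel `P_-(ξ,ζ)`. -/
def kerPminus (ξ ζ : Freq d) : ℂ :=
  starRingEnd ℂ (D.q₃ true (-1) ξ (-ζ) ζ) - D.q₃ false (-1) ξ (-ζ) ζ

/-- The rescaled cutoff `χ(ε^{-γ}|k|)`. -/
def cut (k : Freq d) : ℝ := D.χ (D.ε ^ (-D.γ) * ‖k‖)

def χLowL (k₁ k₂ k₃ : Freq d) : ℝ :=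
  D.cut (k₂ + k₃) * (1 - D.cut (k₂ + k₁)) * (1 - D.cut (k₃ + k₁))

def χLowM (k₁ k₂ k₃ : Freq d) : ℝ :=
  D.cut (k₃ + k₁) * (1 - D.cut (k₃ + k₂)) * (1 - D.cut (k₁ + k₂))

def χLowR (k₁ k₂ k₃ : Freq d) : ℝ :=
  D.cut (k₁ + k₂) * (1 - D.cut (k₁ + k₃)) * (1 - D.cut (k₂ + k₃))

/-- The cutoff `χ_*` attached to a ternary node of type `*`. -/
def χTern : TernKind → Freq d → Freq d → Freq d → ℝ
  | .lowL, k₁, k₂, k₃ => D.χLowL k₁ k₂ k₃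
  | .lowM, k₁, k₂, k₃ => D.χLowM k₁ k₂ k₃
  | .lowR, k₁, k₂, k₃ => D.χLowR k₁ k₂ k₃
  | .high, k₁, k₂, k₃ => 1 - D.χLowL k₁ k₂ k₃ - D.χLowM k₁ k₂ k₃ - D.χLowR k₁ k₂ k₃

end KGData

/-! ### Signed and coloured trees -/

/-- Signed and coloured trees whose root has colour `η`. Every leaf and every node carries a sign;
the indices implement the colour rules (the children of a binary node have the opposite colour; the
left and right children of a ternary node have its colour and the middle one has the opposite
colour). An initial binary node occurs only as `B_in(⊥,⊥)`: `binIn ι ι₁ ι₂` is this tree, with the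
signs of the root and of its two leaves; `binSt` is `B_st(A₁,A₂)` and `tern *` is
`T_*(A₁,A₂,A₃)`. -/
inductive SCTree : Bool → Type
  | leaf {η : Bool} (ι : ℤˣ) : SCTree η
  | binIn {η : Bool} (ι ι₁ ι₂ : ℤˣ) : SCTree η
  | binSt {η : Bool} (ι : ℤˣ) (A₁ A₂ : SCTree (!η)) : SCTree η
  | tern {η : Bool} (s : TernKind) (ι : ℤˣ)
      (A₁ : SCTree η) (A₂ : SCTree (!η)) (A₃ : SCTree η) : SCTree η

namespace SCTree

/-- Leaves of a tree. -/
def Leaf : {η : Bool} → SCTree η → Type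
  | _, .leaf _ => Unit
  | _, .binIn _ _ _ => Unit ⊕ Unit
  | _, .binSt _ A₁ A₂ => Leaf A₁ ⊕ Leaf A₂
  | _, .tern _ _ A₁ A₂ A₃ => Leaf A₁ ⊕ (Leaf A₂ ⊕ Leaf A₃)

/-- Nodes of a tree (the leaves are not nodes); the first summand is the root. -/
def Node : {η : Bool} → SCTree η → Type
  | _, .leaf _ => Empty
  | _, .binIn _ _ _ => Unit
  | _, .binSt _ A₁ A₂ => Unit ⊕ (Node A₁ ⊕ Node A₂)
  | _, .tern _ _ A₁ A₂ A₃ => Unit ⊕ (Node A₁ ⊕ (Node A₂ ⊕ Node A₃))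

/-- Ternary nodes of a tree. -/
def TNode : {η : Bool} → SCTree η → Type
  | _, .leaf _ => Empty
  | _, .binIn _ _ _ => Empty
  | _, .binSt _ A₁ A₂ => TNode A₁ ⊕ TNode A₂
  | _, .tern _ _ A₁ A₂ A₃ => Unit ⊕ (TNode A₁ ⊕ (TNode A₂ ⊕ TNode A₃))

@[reducible] def fintypeLeaf : {η : Bool} → (A : SCTree η) → Fintype A.Leaf
  | _, .leaf _ => inferInstanceAs (Fintype Unit)
  | _, .binIn _ _ _ => inferInstanceAs (Fintype (Unit ⊕ Unit))
  | _, .binSt _ A₁ A₂ =>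
    @instFintypeSum _ _ (fintypeLeaf A₁) (fintypeLeaf A₂)
  | _, .tern _ _ A₁ A₂ A₃ =>
    @instFintypeSum _ _ (fintypeLeaf A₁) (@instFintypeSum _ _ (fintypeLeaf A₂) (fintypeLeaf A₃))

@[reducible] def fintypeNode : {η : Bool} → (A : SCTree η) → Fintype A.Node
  | _, .leaf _ => inferInstanceAs (Fintype Empty)
  | _, .binIn _ _ _ => inferInstanceAs (Fintype Unit)
  | _, .binSt _ A₁ A₂ =>
    @instFintypeSum _ _ (inferInstanceAs (Fintype Unit))
      (@instFintypeSum _ _ (fintypeNode A₁) (fintypeNode A₂))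
  | _, .tern _ _ A₁ A₂ A₃ =>
    @instFintypeSum _ _ (inferInstanceAs (Fintype Unit))
      (@instFintypeSum _ _ (fintypeNode A₁)
        (@instFintypeSum _ _ (fintypeNode A₂) (fintypeNode A₃)))

@[reducible] def fintypeTNode : {η : Bool} → (A : SCTree η) → Fintype A.TNode
  | _, .leaf _ => inferInstanceAs (Fintype Empty)
  | _, .binIn _ _ _ => inferInstanceAs (Fintype Empty)
  | _, .binSt _ A₁ A₂ =>
    @instFintypeSum _ _ (fintypeTNode A₁) (fintypeTNode A₂)
  | _, .tern _ _ A₁ A₂ A₃ =>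
    @instFintypeSum _ _ (inferInstanceAs (Fintype Unit))
      (@instFintypeSum _ _ (fintypeTNode A₁)
        (@instFintypeSum _ _ (fintypeTNode A₂) (fintypeTNode A₃)))

instance {η : Bool} (A : SCTree η) : Fintype A.Leaf := fintypeLeaf A
instance {η : Bool} (A : SCTree η) : Fintype A.Node := fintypeNode A
instance {η : Bool} (A : SCTree η) : Fintype A.TNode := fintypeTNode A

/-- The sign of the root. -/
def rootSign : {η : Bool} → SCTree η → ℤˣ
  | _, .leaf ι => ι
  | _, .binIn ι _ _ => ι
  | _, .binSt ι _ _ => ι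
  | _, .tern _ ι _ _ _ => ι

/-- The signs of the leaves. -/
def leafSign : {η : Bool} → (A : SCTree η) → A.Leaf → ℤˣ
  | _, .leaf ι => fun _ => ι
  | _, .binIn _ ι₁ ι₂ => Sum.elim (fun _ => ι₁) (fun _ => ι₂)
  | _, .binSt _ A₁ A₂ => Sum.elim (leafSign A₁) (leafSign A₂)
  | _, .tern _ _ A₁ A₂ A₃ =>
    Sum.elim (leafSign A₁) (Sum.elim (leafSign A₂) (leafSign A₃))

/-- The colours of the leaves. -/
def leafColour : {η : Bool} → (A : SCTree η) → A.Leaf → Bool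
  | η, .leaf _ => fun _ => η
  | η, .binIn _ _ _ => fun _ => !η
  | _, .binSt _ A₁ A₂ => Sum.elim (leafColour A₁) (leafColour A₂)
  | _, .tern _ _ A₁ A₂ A₃ =>
    Sum.elim (leafColour A₁) (Sum.elim (leafColour A₂) (leafColour A₃))

/-- The size of a tree: `n` for a tree in `𝒜_n`. -/
def size : {η : Bool} → SCTree η → ℕ
  | _, .leaf _ => 0
  | _, .binIn _ _ _ => 1
  | _, .binSt _ A₁ A₂ => size A₁ + size A₂ + 1
  | _, .tern _ _ A₁ A₂ A₃ => size A₁ + size A₂ + size A₃ + 2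

/-- The number of binary nodes. -/
def numBin : {η : Bool} → SCTree η → ℕ
  | _, .leaf _ => 0
  | _, .binIn _ _ _ => 1
  | _, .binSt _ A₁ A₂ => numBin A₁ + numBin A₂ + 1
  | _, .tern _ _ A₁ A₂ A₃ => numBin A₁ + numBin A₂ + numBin A₃

/-- The parentality order (`x ≤ y`: `x` is `y` or below `y`) on ternary nodes. -/
def nodeLE : {η : Bool} → (A : SCTree η) → A.TNode → A.TNode → Prop
  | _, .leaf _ => fun _ _ => False
  | _, .binIn _ _ _ => fun _ _ => False
  | _, .binSt _ A₁ A₂ => fun (x y : A₁.TNode ⊕ A₂.TNode) =>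
    match x, y with
    | .inl x, .inl y => nodeLE A₁ x y
    | .inr x, .inr y => nodeLE A₂ x y
    | _, _ => False
  | _, .tern _ _ A₁ A₂ A₃ => fun (x y : Unit ⊕ (A₁.TNode ⊕ (A₂.TNode ⊕ A₃.TNode))) =>
    match x, y with
    | _, .inl _ => True
    | .inr (.inl x), .inr (.inl y) => nodeLE A₁ x y
    | .inr (.inr (.inl x)), .inr (.inr (.inl y)) => nodeLE A₂ x y
    | .inr (.inr (.inr x)), .inr (.inr (.inr y)) => nodeLE A₃ x y
    | _, _ => False

/-- The time domain `I_A(t)`. -/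
def timeDomain {η : Bool} (A : SCTree η) (t : ℝ) : Set (A.TNode → ℝ) :=
  {s | (∀ j, s j ∈ Set.Icc 0 t) ∧ ∀ j j', A.nodeLE j j' → s j ≤ s j'}

/-- The prebush of the root of a tree (or of its leaf, for the trivial tree): the prebush of a leaf
is the leaf, the one of a node is the union of the prebushes of its unmarked children. -/
def prebush : {η : Bool} → (A : SCTree η) → Set A.Leaf
  | _, .leaf _ => Set.univ
  | _, .binIn _ _ _ => Set.univ
  | _, .binSt _ A₁ A₂ => {ℓ | Sum.elim (· ∈ prebush A₁) (· ∈ prebush A₂) ℓ}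
  | _, .tern s _ A₁ A₂ A₃ =>
    {ℓ | Sum.elim (fun x => (s = .lowL ∨ s = .high) ∧ x ∈ prebush A₁)
      (Sum.elim (fun x => (s = .lowM ∨ s = .high) ∧ x ∈ prebush A₂)
        (fun x => (s = .lowR ∨ s = .high) ∧ x ∈ prebush A₃)) ℓ}

/-- The low nodes. -/
def isLow : {η : Bool} → (A : SCTree η) → A.Node → Prop
  | _, .leaf _ => fun _ => False
  | _, .binIn _ _ _ => fun _ => False
  | _, .binSt _ A₁ A₂ => Sum.elim (fun _ => False) (Sum.elim (isLow A₁) (isLow A₂))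
  | _, .tern s _ A₁ A₂ A₃ =>
    Sum.elim (fun _ => s ≠ .high) (Sum.elim (isLow A₁) (Sum.elim (isLow A₂) (isLow A₃)))

/-- The bush of a low node: the union of the prebushes of its two marked children (the empty set,
as a convention that plays no role, for the other nodes). -/
def bush : {η : Bool} → (A : SCTree η) → A.Node → Set A.Leaf
  | _, .leaf _ => fun _ => ∅
  | _, .binIn _ _ _ => fun _ => ∅
  | _, .binSt _ A₁ A₂ =>
    Sum.elim (fun _ => ∅)
      (Sum.elim (fun j => Sum.inl '' bush A₁ j) (fun j => Sum.inr '' bush A₂ j))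
  | _, .tern s _ A₁ A₂ A₃ =>
    Sum.elim
      (fun _ =>
        {ℓ | Sum.elim (fun x => (s = .lowM ∨ s = .lowR) ∧ x ∈ prebush A₁)
          (Sum.elim (fun x => (s = .lowL ∨ s = .lowR) ∧ x ∈ prebush A₂)
            (fun x => (s = .lowL ∨ s = .lowM) ∧ x ∈ prebush A₃)) ℓ})
      (Sum.elim (fun j => Sum.inl '' bush A₁ j)
        (Sum.elim (fun j => (Sum.inr ∘ Sum.inl) '' bush A₂ j)
          (fun j => (Sum.inr ∘ Sum.inr) '' bush A₃ j)))

/-- The sign condition at the root of a low ternary node with sign `ι` and whose left, middle and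
right children have signs `ι₁`, `ι₂`, `ι₃`: the marked children have opposite signs, and the
unmarked child has the sign of the node. -/
def rootSignRule (s : TernKind) (ι ι₁ ι₂ ι₃ : ℤˣ) : Prop :=
  match s with
  | .lowL => ι₂ = -ι₃ ∧ ι₁ = ι
  | .lowM => ι₁ = -ι₃ ∧ ι₂ = ι
  | .lowR => ι₁ = -ι₂ ∧ ι₃ = ι
  | .high => False

/-- The sign condition `rootSignRule` at the various nodes. -/
def signRule : {η : Bool} → (A : SCTree η) → A.Node → Prop
  | _, .leaf _ => fun _ => False
  | _, .binIn _ _ _ => fun _ => False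
  | _, .binSt _ A₁ A₂ => Sum.elim (fun _ => False) (Sum.elim (signRule A₁) (signRule A₂))
  | _, .tern s ι A₁ A₂ A₃ =>
    Sum.elim (fun _ => rootSignRule s ι A₁.rootSign A₂.rootSign A₃.rootSign)
      (Sum.elim (signRule A₁) (Sum.elim (signRule A₂) (signRule A₃)))

/-- Given the values of a decoration on the leaves, its value at the root; a decoration is
determined by its values on the leaves, the value at a node being the sum of the values at its
children. -/
def rootMom {G : Type} [AddCommGroup G] : {η : Bool} → (A : SCTree η) → (A.Leaf → G) → G
  | _, .leaf _ => fun κ => κ ()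
  | _, .binIn _ _ _ => fun κ => κ (Sum.inl ()) + κ (Sum.inr ())
  | _, .binSt _ A₁ A₂ => fun κ =>
    rootMom A₁ (fun ℓ => κ (Sum.inl ℓ)) + rootMom A₂ (fun ℓ => κ (Sum.inr ℓ))
  | _, .tern _ _ A₁ A₂ A₃ => fun κ =>
    rootMom A₁ (fun ℓ => κ (Sum.inl ℓ)) + rootMom A₂ (fun ℓ => κ (Sum.inr (Sum.inl ℓ)))
      + rootMom A₃ (fun ℓ => κ (Sum.inr (Sum.inr ℓ)))

end SCTree

namespace KGData

variable {d : ℕ} (D : KGData d)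

/-- `ι₀⟨k₁ + k₂⟩ - ι₁⟨k₁⟩ - ι₂⟨k₂⟩`. -/
def Δ₂ (ι₀ ι₁ ι₂ : ℤˣ) (k₁ k₂ : Freq d) : ℝ :=
  ((ι₀ : ℤ) : ℝ) * D.bracket (k₁ + k₂) - ((ι₁ : ℤ) : ℝ) * D.bracket k₁
    - ((ι₂ : ℤ) : ℝ) * D.bracket k₂

/-- `ι₀⟨k₁ + k₂ + k₃⟩ - ι₁⟨k₁⟩ - ι₂⟨k₂⟩ - ι₃⟨k₃⟩`. -/
def Δ₃ (ι₀ ι₁ ι₂ ι₃ : ℤˣ) (k₁ k₂ k₃ : Freq d) : ℝ :=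
  ((ι₀ : ℤ) : ℝ) * D.bracket (k₁ + k₂ + k₃) - ((ι₁ : ℤ) : ℝ) * D.bracket k₁
    - ((ι₂ : ℤ) : ℝ) * D.bracket k₂ - ((ι₃ : ℤ) : ℝ) * D.bracket k₃

/-- `Ω_{-1}`: the sum of `Δ_j` over the binary nodes `j` with no ternary node above them
(`Δ_j = 0` for an initial binary node). -/
def ΩMinusOne : {η : Bool} → (A : SCTree η) → (A.Leaf → D.Mom) → ℝ
  | _, .leaf _ => fun _ => 0
  | _, .binIn _ _ _ => fun _ => 0
  | _, .binSt ι A₁ A₂ => fun κ =>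
    D.Δ₂ ι A₁.rootSign A₂.rootSign
        (A₁.rootMom (fun ℓ => κ (Sum.inl ℓ))) (A₂.rootMom (fun ℓ => κ (Sum.inr ℓ)))
      + ΩMinusOne A₁ (fun ℓ => κ (Sum.inl ℓ)) + ΩMinusOne A₂ (fun ℓ => κ (Sum.inr ℓ))
  | _, .tern _ _ _ _ _ => fun _ => 0

/-- `Ω_j` at a ternary node `j`: the sum of `Δ_j` and of the `Δ_{j'}` over the binary nodes `j'`
below `j` for which `j` is the closest ternary node above. -/
def Ω : {η : Bool} → (A : SCTree η) → (A.Leaf → D.Mom) → A.TNode → ℝ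
  | _, .leaf _ => fun _ _ => 0
  | _, .binIn _ _ _ => fun _ _ => 0
  | _, .binSt _ A₁ A₂ => fun κ =>
    Sum.elim (Ω A₁ (fun ℓ => κ (Sum.inl ℓ))) (Ω A₂ (fun ℓ => κ (Sum.inr ℓ)))
  | _, .tern _ ι A₁ A₂ A₃ => fun κ =>
    Sum.elim
      (fun _ =>
        D.Δ₃ ι A₁.rootSign A₂.rootSign A₃.rootSign
            (A₁.rootMom (fun ℓ => κ (Sum.inl ℓ)))
            (A₂.rootMom (fun ℓ => κ (Sum.inr (Sum.inl ℓ))))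
            (A₃.rootMom (fun ℓ => κ (Sum.inr (Sum.inr ℓ))))
          + D.ΩMinusOne A₁ (fun ℓ => κ (Sum.inl ℓ))
          + D.ΩMinusOne A₂ (fun ℓ => κ (Sum.inr (Sum.inl ℓ)))
          + D.ΩMinusOne A₃ (fun ℓ => κ (Sum.inr (Sum.inr ℓ))))
      (Sum.elim (Ω A₁ (fun ℓ => κ (Sum.inl ℓ)))
        (Sum.elim (Ω A₂ (fun ℓ => κ (Sum.inr (Sum.inl ℓ))))
          (Ω A₃ (fun ℓ => κ (Sum.inr (Sum.inr ℓ))))))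

/-- The interaction coefficient `q_j` at a node `j`. -/
def qNode : {η : Bool} → (A : SCTree η) → (A.Leaf → D.Mom) → A.Node → ℂ
  | _, .leaf _ => fun _ _ => 1
  | η, .binIn ι ι₁ ι₂ => fun κ _ =>
    -((ι : ℤ) : ℂ) * D.q₂ η (κ (Sum.inl ())) (κ (Sum.inr ()))
      / (D.Δ₂ ι ι₁ ι₂ (κ (Sum.inl ())) (κ (Sum.inr ())) : ℂ)
  | η, .binSt ι A₁ A₂ => fun κ =>
    Sum.elim
      (fun _ =>
        let k₁ : Freq d := (A₁.rootMom (fun ℓ => κ (Sum.inl ℓ)) : D.Mom)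
        let k₂ : Freq d := (A₂.rootMom (fun ℓ => κ (Sum.inr ℓ)) : D.Mom)
        ((ι : ℤ) : ℂ) * D.q₂ η k₁ k₂ / (D.Δ₂ ι A₁.rootSign A₂.rootSign k₁ k₂ : ℂ))
      (Sum.elim (qNode A₁ (fun ℓ => κ (Sum.inl ℓ))) (qNode A₂ (fun ℓ => κ (Sum.inr ℓ))))
  | η, .tern s ι A₁ A₂ A₃ => fun κ =>
    Sum.elim
      (fun _ =>
        let k₁ : Freq d := (A₁.rootMom (fun ℓ => κ (Sum.inl ℓ)) : D.Mom)
        let k₂ : Freq d := (A₂.rootMom (fun ℓ => κ (Sum.inr (Sum.inl ℓ))) : D.Mom)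
        let k₃ : Freq d := (A₃.rootMom (fun ℓ => κ (Sum.inr (Sum.inr ℓ))) : D.Mom)
        ((ι : ℤ) : ℂ) * (D.χTern s k₁ k₂ k₃ : ℂ) * D.q₃ η (ι * A₂.rootSign) k₁ k₂ k₃)
      (Sum.elim (qNode A₁ (fun ℓ => κ (Sum.inl ℓ)))
        (Sum.elim (qNode A₂ (fun ℓ => κ (Sum.inr (Sum.inl ℓ))))
          (qNode A₃ (fun ℓ => κ (Sum.inr (Sum.inr ℓ))))))

end KGData

/-! ### Couplings -/

/-- Couplings of two signed and coloured trees with root colours `η₁`, `η₂`. As `σ` is an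
involution, the condition `sign_σ` says that it is a bijection from the negative leaves to the
positive leaves (whose numbers are then equal). -/
structure Coupling (η₁ η₂ : Bool) where
  left : SCTree η₁
  right : SCTree η₂
  σ : left.Leaf ⊕ right.Leaf → left.Leaf ⊕ right.Leaf
  invol : Function.Involutive σ
  sign_σ : ∀ ℓ, Sum.elim left.leafSign right.leafSign (σ ℓ)
    = -Sum.elim left.leafSign right.leafSign ℓ

namespace Coupling

variable {η₁ η₂ : Bool} (C : Coupling η₁ η₂)

abbrev Leaf : Type := C.left.Leaf ⊕ C.right.Leaf

abbrev Node : Type := C.left.Node ⊕ C.right.Node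

abbrev TNode : Type := C.left.TNode ⊕ C.right.TNode

/-- Sign of a leaf. -/
def sign : C.Leaf → ℤˣ := Sum.elim C.left.leafSign C.right.leafSign

/-- Colour of a leaf. -/
def colour : C.Leaf → Bool := Sum.elim C.left.leafColour C.right.leafColour

/-- `n(C)`. -/
def size : ℕ := C.left.size + C.right.size

/-- `n_B(C)`. -/
def numBin : ℕ := C.left.numBin + C.right.numBin

/-- The bush of a low node. -/
def bush : C.Node → Set C.Leaf :=
  Sum.elim (fun j => Sum.inl '' C.left.bush j) (fun j => Sum.inr '' C.right.bush j)

/-- A set of leaves is self-coupled if `σ` sends its positive leaves bijectively to its negative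
leaves (`σ` is injective, so the two sets then have the same cardinality). -/
def SelfCoupled (B : Set C.Leaf) : Prop :=
  C.σ '' {ℓ ∈ B | C.sign ℓ = 1} = {ℓ ∈ B | C.sign ℓ = -1}

/-- Resonant nodes: low nodes with a self-coupled bush, whose marked children have opposite signs
and whose unmarked child has the sign of the node. -/
def IsResonant (j : C.Node) : Prop :=
  Sum.elim C.left.isLow C.right.isLow j ∧ C.SelfCoupled (C.bush j) ∧
    Sum.elim C.left.signRule C.right.signRule j

/-- The time domain `I_C(t) = I_{A₁}(t) × I_{A₂}(t)`. -/
def timeDomain (t : ℝ) : Set (C.TNode → ℝ) :=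
  {s | (fun j => s (Sum.inl j)) ∈ C.left.timeDomain t ∧
    (fun j => s (Sum.inr j)) ∈ C.right.timeDomain t}

end Coupling

/-- `Res_n(ι,ι',η,η')`: the couplings with `n` nodes, all resonant, whose left and right trees have
root signs `ι`, `ι'` and root colours `η`, `η'`. -/
def Res (n : ℕ) (ι ι' : ℤˣ) (η η' : Bool) : Set (Coupling η η') :=
  {C | Fintype.card C.Node = n ∧ (∀ j, C.IsResonant j) ∧
    C.left.rootSign = ι ∧ C.right.rootSign = ι'}

theorem finite_trees (n : ℕ) :
    ∀ η : Bool, {A : SCTree η | Fintype.card A.Node ≤ n}.Finite := by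
  have kinds : (Set.univ : Set TernKind).Finite := by
    refine Set.Finite.subset
      (Set.toFinite ({.lowL, .lowM, .lowR, .high} : Set TernKind)) ?_
    intro s _
    cases s <;> simp
  have signs : (Set.univ : Set ℤˣ).Finite := Set.toFinite _
  induction n with
  | zero =>
    intro η
    refine Set.Finite.subset (Set.finite_range (fun ι : ℤˣ => (SCTree.leaf ι : SCTree η))) ?_
    intro A hA
    cases A with
    | leaf ι => exact ⟨ι, rfl⟩
    | binIn ι ι₁ ι₂ =>
      exact absurd hA (by
        show ¬ (Fintype.card Unit ≤ 0)
        simp)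
    | binSt ι A₁ A₂ =>
      exact absurd hA (by
        show ¬ (Fintype.card (Unit ⊕ (A₁.Node ⊕ A₂.Node)) ≤ 0)
        simp [Fintype.card_sum])
    | tern s ι A₁ A₂ A₃ =>
      exact absurd hA (by
        show ¬ (Fintype.card (Unit ⊕ (A₁.Node ⊕ (A₂.Node ⊕ A₃.Node))) ≤ 0)
        simp [Fintype.card_sum])
  | succ n ih =>
    intro η
    have h1 := Set.finite_range (fun ι : ℤˣ => (SCTree.leaf ι : SCTree η))
    have h2 := Set.finite_range
      (fun p : ℤˣ × ℤˣ × ℤˣ => (SCTree.binIn p.1 p.2.1 p.2.2 : SCTree η))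
    have h3 := (signs.prod ((ih (!η)).prod (ih (!η)))).image
      (fun p => (SCTree.binSt p.1 p.2.1 p.2.2 : SCTree η))
    have h4 := (kinds.prod (signs.prod ((ih η).prod ((ih (!η)).prod (ih η))))).image
      (fun p => (SCTree.tern p.1 p.2.1 p.2.2.1 p.2.2.2.1 p.2.2.2.2 : SCTree η))
    refine (((h1.union h2).union h3).union h4).subset ?_
    intro A hA
    cases A with
    | leaf ι => exact Or.inl (Or.inl (Or.inl ⟨ι, rfl⟩))
    | binIn ι ι₁ ι₂ => exact Or.inl (Or.inl (Or.inr ⟨(ι, ι₁, ι₂), rfl⟩))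
    | binSt ι A₁ A₂ =>
      have hA' : Fintype.card (Unit ⊕ (A₁.Node ⊕ A₂.Node)) ≤ n + 1 := hA
      simp only [Fintype.card_sum, Fintype.card_unit] at hA'
      refine Or.inl (Or.inr ⟨(ι, A₁, A₂), ⟨trivial, ?_, ?_⟩, rfl⟩)
      · show Fintype.card A₁.Node ≤ n
        omega
      · show Fintype.card A₂.Node ≤ n
        omega
    | tern s ι A₁ A₂ A₃ =>
      have hA' : Fintype.card (Unit ⊕ (A₁.Node ⊕ (A₂.Node ⊕ A₃.Node))) ≤ n + 1 := hA
      simp only [Fintype.card_sum, Fintype.card_unit] at hA'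
      refine Or.inr ⟨(s, ι, A₁, A₂, A₃), ⟨trivial, trivial, ?_, ?_, ?_⟩, rfl⟩
      · show Fintype.card A₁.Node ≤ n
        omega
      · show Fintype.card A₂.Node ≤ n
        omega
      · show Fintype.card A₃.Node ≤ n
        omega

theorem finite_Res (n : ℕ) (ι ι' : ℤˣ) (η η' : Bool) : (Res n ι ι' η η').Finite := by
  classical
  have hl : Finite {A : SCTree η | Fintype.card A.Node ≤ n} := finite_trees n η
  have hr : Finite {A : SCTree η' | Fintype.card A.Node ≤ n} := finite_trees n η'
  let T := Σ p : {A : SCTree η | Fintype.card A.Node ≤ n} ×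
    {A : SCTree η' | Fintype.card A.Node ≤ n},
      (p.1.1.Leaf ⊕ p.2.1.Leaf → p.1.1.Leaf ⊕ p.2.1.Leaf)
  have hT : Finite T := inferInstance
  let f : Res n ι ι' η η' → T := fun C =>
    have hC : Fintype.card C.1.left.Node + Fintype.card C.1.right.Node = n := by
      have := C.2.1
      rwa [Fintype.card_sum] at this
    ⟨(⟨C.1.left, by show _ ≤ n; omega⟩, ⟨C.1.right, by show _ ≤ n; omega⟩), C.1.σ⟩
  have hf : Function.Injective f := by
    rintro ⟨⟨A, A', σ, _, _⟩, _⟩ ⟨⟨B, B', τ, _, _⟩, _⟩ h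
    obtain ⟨h₁, h₂⟩ := Sigma.mk.inj_iff.mp h
    have h₅ : A = B := congrArg (fun p => p.1.1) h₁
    have h₆ : A' = B' := congrArg (fun p => p.2.1) h₁
    subst h₅ h₆
    have h₇ : σ = τ := eq_of_heq h₂
    subst h₇
    rfl
  exact Finite.of_injective f hf

namespace KGData

variable {d : ℕ} (D : KGData d) {η₁ η₂ : Bool}

/-- The `k`-decorations `𝒟_k(C)` of a coupling, given by their values on the leaves. -/
def Decoration (C : Coupling η₁ η₂) (k : D.Mom) : Type :=
  {κ : C.Leaf → D.Mom //
    (∀ ℓ, κ ℓ + κ (C.σ ℓ) = 0) ∧ C.left.rootMom (fun ℓ => κ (Sum.inl ℓ)) = k}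

/-- `z^ι`, that is `z` if `ι = +` and `z̄` if `ι = -`. -/
def conjSign (ι : ℤˣ) (z : ℂ) : ℂ := if ι = 1 then z else starRingEnd ℂ z

/-- `Ω_{-1}(C)`. -/
def ΩMinusOneC (C : Coupling η₁ η₂) (κ : C.Leaf → D.Mom) : ℝ :=
  D.ΩMinusOne C.left (fun ℓ => κ (Sum.inl ℓ)) + D.ΩMinusOne C.right (fun ℓ => κ (Sum.inr ℓ))

/-- `Ω_j` at a ternary node of a coupling. -/
def ΩC (C : Coupling η₁ η₂) (κ : C.Leaf → D.Mom) : C.TNode → ℝ :=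
  Sum.elim (D.Ω C.left (fun ℓ => κ (Sum.inl ℓ))) (D.Ω C.right (fun ℓ => κ (Sum.inr ℓ)))

/-- `q_j` at a node of a coupling. -/
def qC (C : Coupling η₁ η₂) (κ : C.Leaf → D.Mom) : C.Node → ℂ :=
  Sum.elim (D.qNode C.left (fun ℓ => κ (Sum.inl ℓ))) (D.qNode C.right (fun ℓ => κ (Sum.inr ℓ)))

/-- The contribution of one decoration `κ` to `F̂_C(ε⁻²t,k)`. -/
def summand (C : Coupling η₁ η₂) (t : ℝ) (κ : C.Leaf → D.Mom) : ℂ :=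
  Complex.exp (Complex.I * ((D.ε ^ (-2 : ℤ) * D.ΩMinusOneC C κ * t : ℝ) : ℂ))
    * (∏ j, D.qC C κ j)
    * (∫ s in C.timeDomain t,
        ∏ j, Complex.exp (Complex.I * ((D.ΩC C κ j * D.ε ^ (-2 : ℤ) * s j : ℝ) : ℂ)))
    * ∏ ℓ with C.sign ℓ = -1,
        conjSign (C.sign ℓ)
          (D.M (C.colour ℓ) (C.colour (C.σ ℓ)) ((((C.sign ℓ : ℤˣ) : ℤ) • κ ℓ : D.Mom) : Freq d))

/-- `F̂_C(ε⁻²t,k)`, the contribution of the coupling `C` to the correlations. -/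
def F (C : Coupling η₁ η₂) (t : ℝ) (k : D.Mom) : ℂ :=
  ((D.ε ^ C.numBin / D.L ^ (((C.size * d : ℕ) : ℝ) / 2) : ℝ) : ℂ)
    * (-Complex.I) ^ Fintype.card C.TNode
    * ∑' κ : D.Decoration C k, D.summand C t κ.1

/-- `X_n^{ι,(η,η')}(t,k)`: the sum of the contributions of the resonant couplings in
`Res_n(ι,-ι,η,η')`. -/
def Xres (n : ℕ) (ι : ℤˣ) (η η' : Bool) (t : ℝ) (k : D.Mom) : ℂ :=
  ∑ C ∈ (finite_Res n ι (-ι) η η').toFinset, D.F C t k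

/-- `ρ^η_{L,n}(t,k)`. -/
def ρ (η : Bool) (n : ℕ) (t : ℝ) (k : D.Mom) : ℂ := D.Xres n 1 η η t k

/-- `ρ^×_{L,n}(t,k)`. -/
def ρcross (n : ℕ) (t : ℝ) (k : D.Mom) : ℂ := D.Xres n 1 false true t k

end KGData

end ResonantKG

end

/-! A resonant coupling is as rigid as its two trees. If all nodes of a tree are low, each of them
has exactly one unmarked child; following unmarked children from any vertex leads to a single leaf,
the end of its spine. So every prebush is one leaf and every bush a pair of leaves, which
self-coupledness forces `σ` to exchange. Only the ends of the two root spines are left over, and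
they must be partners. Resonant couplings with opposite root signs therefore correspond to pairs of
low trees (`LowTree.exists_toCoupling_eq`, `LowTree.sum_Res`).

Momenta of partners add up to zero. Hence the marked children of a node carry momenta k₁ and -k₁
with opposite signs, and the unmarked child inherits the momentum and the sign of the node. All
phases `Ω_j` vanish (`Ω_kap`), the time integral is a volume, and volumes and sums over decorations
factorise over subtrees (`volume_timeDomain_tern`, `amp_node`). A low-m node contributes zero
because Q(ξ,-ξ) = 0, so the spines that matter keep the colour of their root. The correlation of
order n is thus the covariance at k times the degree-n part of a Cauchy product of two tree sums
(`Standing.Xres_eq_corr`).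

Cut a tree at its root: the unmarked subtree gives a tree sum again, while the two marked subtrees
and the covariance joining their spine ends give a correlation. Graded by the number of nodes, tree
sums A are formal power series with A' = A·r, where the rate r is linear in the correlations
(`Standing.hasDerivAt_treeSum_succ`). Conjugation amounts to reversing sign and momentum
(`Standing.conj_treeSum`), so the product of the two tree sums, and with it the correlation ρ of
colours c, c', satisfies ρ' = ρ·(r_c + conj r_{c'}). Low-l and low-r nodes contribute equally to r,
whence a factor 2; equal colours leave twice the real part of r, which is the term 4 Im(N…), and the
colours 0, 1 give P₊ and P₋. Integrating from time 0, where all positive orders vanish, yields the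
recursion. -/

noncomputable section

namespace ResonantKG

/-! ### Low trees, their spines and the pairing of their leaves -/

/-- The low types of ternary nodes. -/
inductive LowKind : Type
  | l
  | m
  | r

namespace LowKind

/-- The type of ternary node. -/
def tern : LowKind → TernKind
  | .l => .lowL
  | .m => .lowM
  | .r => .lowR

variable {α : Type}

/-- The label of the left child, if the unmarked child is labelled `u` and the marked ones are
labelled `a`, `b` from left to right. -/
def fst : LowKind → α → α → α → α
  | .l, u, _, _ => u
  | .m, _, a, _ => a
  | .r, _, a, _ => a

/-- The label of the middle child. -/
def snd : LowKind → α → α → α → α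
  | .l, _, a, _ => a
  | .m, u, _, _ => u
  | .r, _, _, b => b

/-- The label of the right child. -/
def thd : LowKind → α → α → α → α
  | .l, _, _, b => b
  | .m, _, _, b => b
  | .r, u, _, _ => u

/-- The partner of the left child, if the marked children are partners of each other, the unmarked
child has partner `x` and the children are labelled `p₁`, `p₂`, `p₃`. -/
def mateFst : LowKind → α → α → α → α → α
  | .l, x, _, _, _ => x
  | .m, _, _, _, p₃ => p₃
  | .r, _, _, p₂, _ => p₂

/-- The partner of the middle child. -/
def mateSnd : LowKind → α → α → α → α → α
  | .l, _, _, _, p₃ => p₃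
  | .m, x, _, _, _ => x
  | .r, _, p₁, _, _ => p₁

/-- The partner of the right child. -/
def mateThd : LowKind → α → α → α → α → α
  | .l, _, _, p₂, _ => p₂
  | .m, _, p₁, _, _ => p₁
  | .r, x, _, _, _ => x

end LowKind

/-- The trees all of whose nodes are low and satisfy the sign rule, stripped of the sign and of the
colour of the root: `node s ι A₁ A₂ A₃` has type `s`, and its marked children have the signs `ι`
and `-ι` from left to right. -/
inductive LowTree : Type
  | leaf
  | node (s : LowKind) (ι : ℤˣ) (A₁ A₂ A₃ : LowTree)

namespace LowTree

/-- The number of nodes. -/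
def card : LowTree → ℕ
  | .leaf => 0
  | .node _ _ A₁ A₂ A₃ => A₁.card + A₂.card + A₃.card + 1

/-- The signed and coloured tree with given colour and sign of the root. -/
def toSC : LowTree → (η : Bool) → ℤˣ → SCTree η
  | .leaf, _, ι => .leaf ι
  | .node s ι' A₁ A₂ A₃, η, ι =>
    .tern s.tern ι (A₁.toSC η (s.fst ι ι' (-ι'))) (A₂.toSC (!η) (s.snd ι ι' (-ι')))
      (A₃.toSC η (s.thd ι ι' (-ι')))

/-- The leaves. -/
abbrev Lf (T : LowTree) (η : Bool) (ι : ℤˣ) : Type := (T.toSC η ι).Leaf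

/-- The leaf at the end of the path of unmarked nodes starting from the root. -/
def spine : (T : LowTree) → (η : Bool) → (ι : ℤˣ) → T.Lf η ι
  | .leaf, _, _ => ()
  | .node .l _ A₁ _ _, η, ι => Sum.inl (A₁.spine η ι)
  | .node .m _ _ A₂ _, η, ι => Sum.inr (Sum.inl (A₂.spine (!η) ι))
  | .node .r _ _ _ A₃, η, ι => Sum.inr (Sum.inr (A₃.spine η ι))

/-- The label of the partner of a leaf, when the leaves are labelled by `e`, the ends of the spines
of the two marked children of every node are partners, and the partner of the end of the spine of
the root is labelled `x`. -/
def mate {α : Type} : (T : LowTree) → (η : Bool) → (ι : ℤˣ) → (T.Lf η ι → α) → α → T.Lf η ι → α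
  | .leaf, _, _ => fun _ x _ => x
  | .node s ι' A₁ A₂ A₃, η, ι => fun e x =>
    let p₁ := e (Sum.inl (A₁.spine η (s.fst ι ι' (-ι'))))
    let p₂ := e (Sum.inr (Sum.inl (A₂.spine (!η) (s.snd ι ι' (-ι')))))
    let p₃ := e (Sum.inr (Sum.inr (A₃.spine η (s.thd ι ι' (-ι')))))
    Sum.elim (A₁.mate η (s.fst ι ι' (-ι')) (fun ℓ => e (Sum.inl ℓ)) (s.mateFst x p₁ p₂ p₃))
      (Sum.elim
        (A₂.mate (!η) (s.snd ι ι' (-ι')) (fun ℓ => e (Sum.inr (Sum.inl ℓ)))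
          (s.mateSnd x p₁ p₂ p₃))
        (A₃.mate η (s.thd ι ι' (-ι')) (fun ℓ => e (Sum.inr (Sum.inr ℓ)))
          (s.mateThd x p₁ p₂ p₃)))

theorem mate_spine {α : Type} (T : LowTree) : ∀ (η : Bool) (ι : ℤˣ) (e : T.Lf η ι → α) (x : α),
    T.mate η ι e x (T.spine η ι) = x := by
  induction T with
  | leaf => intros; rfl
  | node s ι' A₁ A₂ A₃ h₁ h₂ h₃ =>
    intro η ι e x
    cases s
    · exact h₁ _ _ _ _
    · exact h₂ _ _ _ _
    · exact h₃ _ _ _ _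

/-- Which label is picked depends on the tree only, so the choice is natural in the labels. With
leaves as labels `mate` describes the involution of a coupling; naturality transports it to signs,
colours and momenta. -/
theorem map_mate {α β : Type} (f : α → β) (T : LowTree) :
    ∀ (η : Bool) (ι : ℤˣ) (e : T.Lf η ι → α) (x : α) (ℓ : T.Lf η ι),
      f (T.mate η ι e x ℓ) = T.mate η ι (fun ℓ => f (e ℓ)) (f x) ℓ := by
  induction T with
  | leaf => intros; rfl
  | node s ι' A₁ A₂ A₃ h₁ h₂ h₃ =>
    intro η ι e x ℓ
    rcases ℓ with ℓ | ℓ | ℓ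
    · cases s <;> exact h₁ _ _ _ _ _
    · cases s <;> exact h₂ _ _ _ _ _
    · cases s <;> exact h₃ _ _ _ _ _

theorem rootSign_toSC (T : LowTree) (η : Bool) (ι : ℤˣ) : (T.toSC η ι).rootSign = ι := by
  cases T <;> rfl

theorem leafSign_spine (T : LowTree) : ∀ (η : Bool) (ι : ℤˣ),
    (T.toSC η ι).leafSign (T.spine η ι) = ι := by
  induction T with
  | leaf => intros; rfl
  | node s ι' A₁ A₂ A₃ h₁ h₂ h₃ =>
    intro η ι
    cases s
    · exact h₁ _ _
    · exact h₂ _ _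
    · exact h₃ _ _

/-- A labelling in a type with a negation such that the ends of the spines of the two marked
children of every node have opposite labels. -/
def Balanced {α : Type} [Neg α] (T : LowTree) (η : Bool) (ι : ℤˣ) (e : T.Lf η ι → α) : Prop :=
  ∀ ℓ, T.mate η ι e (-e (T.spine η ι)) ℓ = -e ℓ

/-- Local form of balancedness: balanced subtrees, with opposite labels at the two marked spine
ends. It serves both for leaf signs and for leaf momenta, which obey the same rule. -/
theorem balanced_node {α : Type} [InvolutiveNeg α] (s : LowKind) (ι' : ℤˣ) (A₁ A₂ A₃ : LowTree)
    (η : Bool) (ι : ℤˣ) (e : (node s ι' A₁ A₂ A₃).Lf η ι → α)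
    (h₁ : A₁.Balanced η (s.fst ι ι' (-ι')) fun ℓ => e (Sum.inl ℓ))
    (h₂ : A₂.Balanced (!η) (s.snd ι ι' (-ι')) fun ℓ => e (Sum.inr (Sum.inl ℓ)))
    (h₃ : A₃.Balanced η (s.thd ι ι' (-ι')) fun ℓ => e (Sum.inr (Sum.inr ℓ)))
    (u a : α)
    (e₁ : e (Sum.inl (A₁.spine η (s.fst ι ι' (-ι')))) = s.fst u a (-a))
    (e₂ : e (Sum.inr (Sum.inl (A₂.spine (!η) (s.snd ι ι' (-ι'))))) = s.snd u a (-a))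
    (e₃ : e (Sum.inr (Sum.inr (A₃.spine η (s.thd ι ι' (-ι'))))) = s.thd u a (-a)) :
    (node s ι' A₁ A₂ A₃).Balanced η ι e := by
  have k {A : LowTree} {η : Bool} {ι : ℤˣ} {f : A.Lf η ι → α} (h : A.Balanced η ι f) {x : α}
      (hx : x = -f (A.spine η ι)) (ℓ) : A.mate η ι f x ℓ = -f ℓ := hx ▸ h ℓ
  cases s
  -- In each case the first marked label is rewritten as `-(-a)`, the negative of the second one.
  · have e₂' := e₂.trans (neg_neg a).symm
    rintro (ℓ | ℓ | ℓ)
    · exact h₁ ℓ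
    · exact k h₂ (e₃.trans (congrArg Neg.neg e₂.symm)) ℓ
    · exact k h₃ (e₂'.trans (congrArg Neg.neg e₃.symm)) ℓ
  · have e₁' := e₁.trans (neg_neg a).symm
    rintro (ℓ | ℓ | ℓ)
    · exact k h₁ (e₃.trans (congrArg Neg.neg e₁.symm)) ℓ
    · exact h₂ ℓ
    · exact k h₃ (e₁'.trans (congrArg Neg.neg e₃.symm)) ℓ
  · have e₁' := e₁.trans (neg_neg a).symm
    rintro (ℓ | ℓ | ℓ)
    · exact k h₁ (e₂.trans (congrArg Neg.neg e₁.symm)) ℓ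
    · exact k h₂ (e₁'.trans (congrArg Neg.neg e₂.symm)) ℓ
    · exact h₃ ℓ

/-- Evaluating the hypothesis at the end of the spine determines `x`. -/
theorem Balanced.of_mate {α : Type} [Neg α] {T : LowTree} {η : Bool} {ι : ℤˣ} {e : T.Lf η ι → α}
    {x : α} (h : ∀ ℓ, T.mate η ι e x ℓ = -e ℓ) : T.Balanced η ι e := by
  have hx : x = -e (T.spine η ι) := by rw [← h, mate_spine]
  subst hx
  exact h

/-- Converse of `balanced_node`; the witness `a` is the label at the spine end of the left marked
child. -/
theorem Balanced.exists_labels {α : Type} [Neg α] {s : LowKind} {ι' : ℤˣ}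
    {A₁ A₂ A₃ : LowTree} {η : Bool} {ι : ℤˣ} {e : (node s ι' A₁ A₂ A₃).Lf η ι → α}
    (h : (node s ι' A₁ A₂ A₃).Balanced η ι e) :
    (A₁.Balanced η (s.fst ι ι' (-ι')) fun ℓ => e (Sum.inl ℓ)) ∧
    (A₂.Balanced (!η) (s.snd ι ι' (-ι')) fun ℓ => e (Sum.inr (Sum.inl ℓ))) ∧
    (A₃.Balanced η (s.thd ι ι' (-ι')) fun ℓ => e (Sum.inr (Sum.inr ℓ))) ∧
    ∃ a : α,
      e (Sum.inl (A₁.spine η (s.fst ι ι' (-ι')))) = s.fst (e (spine _ _ _)) a (-a) ∧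
      e (Sum.inr (Sum.inl (A₂.spine (!η) (s.snd ι ι' (-ι'))))) = s.snd (e (spine _ _ _)) a (-a) ∧
      e (Sum.inr (Sum.inr (A₃.spine η (s.thd ι ι' (-ι'))))) = s.thd (e (spine _ _ _)) a (-a) := by
  have h₁ := fun ℓ => h (Sum.inl ℓ)
  have h₂ := fun ℓ => h (Sum.inr (Sum.inl ℓ))
  have h₃ := fun ℓ => h (Sum.inr (Sum.inr ℓ))
  refine ⟨.of_mate h₁, .of_mate h₂, .of_mate h₃, ?_⟩
  cases s
  · exact ⟨_, rfl, rfl, (mate_spine A₂ _ _ _ _).symm.trans (h₂ _)⟩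
  · exact ⟨_, rfl, rfl, (mate_spine A₁ _ _ _ _).symm.trans (h₁ _)⟩
  · exact ⟨_, rfl, (mate_spine A₁ _ _ _ _).symm.trans (h₁ _), rfl⟩

theorem balanced_leafSign (T : LowTree) : ∀ (η : Bool) (ι : ℤˣ),
    T.Balanced η ι (T.toSC η ι).leafSign := by
  induction T with
  | leaf => intro η ι ℓ; rfl
  | node s ι' A₁ A₂ A₃ h₁ h₂ h₃ =>
    intro η ι
    exact balanced_node s ι' A₁ A₂ A₃ η ι _ (h₁ _ _) (h₂ _ _) (h₃ _ _) ι ι'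
      (A₁.leafSign_spine _ _) (A₂.leafSign_spine _ _) (A₃.leafSign_spine _ _)

end LowTree
end ResonantKG

/-! ### Low trees as signed and coloured trees, and their bushes -/

namespace ResonantKG
namespace LowTree

theorem card_node_toSC (T : LowTree) : ∀ (η : Bool) (ι : ℤˣ),
    Fintype.card (T.toSC η ι).Node = T.card := by
  induction T with
  | leaf => intros; rfl
  | node s ι' A₁ A₂ A₃ h₁ h₂ h₃ =>
    intro η ι
    have : Fintype.card (Unit ⊕ ((A₁.toSC η (s.fst ι ι' (-ι'))).Node ⊕
        ((A₂.toSC (!η) (s.snd ι ι' (-ι'))).Node ⊕ (A₃.toSC η (s.thd ι ι' (-ι'))).Node)))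
        = (node s ι' A₁ A₂ A₃).card := by
      simp only [Fintype.card_sum, Fintype.card_unit, h₁, h₂, h₃, card]
      omega
    exact this

theorem card_tNode_toSC (T : LowTree) : ∀ (η : Bool) (ι : ℤˣ),
    Fintype.card (T.toSC η ι).TNode = T.card := by
  induction T with
  | leaf => intros; rfl
  | node s ι' A₁ A₂ A₃ h₁ h₂ h₃ =>
    intro η ι
    have : Fintype.card (Unit ⊕ ((A₁.toSC η (s.fst ι ι' (-ι'))).TNode ⊕
        ((A₂.toSC (!η) (s.snd ι ι' (-ι'))).TNode ⊕ (A₃.toSC η (s.thd ι ι' (-ι'))).TNode)))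
        = (node s ι' A₁ A₂ A₃).card := by
      simp only [Fintype.card_sum, Fintype.card_unit, h₁, h₂, h₃, card]
      omega
    exact this

theorem numBin_toSC (T : LowTree) : ∀ (η : Bool) (ι : ℤˣ), (T.toSC η ι).numBin = 0 := by
  induction T with
  | leaf => intros; rfl
  | node s ι' A₁ A₂ A₃ h₁ h₂ h₃ =>
    intro η ι
    simp only [toSC, SCTree.numBin, h₁, h₂, h₃]

theorem size_toSC (T : LowTree) : ∀ (η : Bool) (ι : ℤˣ), (T.toSC η ι).size = 2 * T.card := by
  induction T with
  | leaf => intros; rfl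
  | node s ι' A₁ A₂ A₃ h₁ h₂ h₃ =>
    intro η ι
    simp only [toSC, SCTree.size, h₁, h₂, h₃, card]
    omega

/-- The only sign stored at a node is that of its left marked child, and it can be read off from the
root of that subtree. -/
theorem toSC_injective (η : Bool) (ι : ℤˣ) : Function.Injective fun T : LowTree => T.toSC η ι := by
  intro T
  induction T generalizing η ι with
  | leaf =>
    intro T' h
    cases T' with
    | leaf => rfl
    | node => simp [toSC] at h
  | node s ι' A₁ A₂ A₃ h₁ h₂ h₃ =>
    intro T' h
    cases T' with
    | leaf => simp [toSC] at h
    | node s' ι'' B₁ B₂ B₃ =>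
      simp only [toSC, SCTree.tern.injEq, true_and] at h
      obtain ⟨hs, e₁, e₂, e₃⟩ := h
      have hs' : s = s' := by cases s <;> cases s' <;> simp_all [LowKind.tern]
      subst hs'
      have hι : ι' = ι'' := by
        have r₁ := congrArg SCTree.rootSign e₁
        have r₂ := congrArg SCTree.rootSign e₂
        rw [rootSign_toSC, rootSign_toSC] at r₁ r₂
        cases s
        · exact r₂
        · exact r₁
        · exact r₁
      subst hι
      rw [h₁ _ _ e₁, h₂ _ _ e₂, h₃ _ _ e₃]

/-- Lowness excludes binary nodes, and the sign rule leaves one free sign per node, that of the left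
marked child. -/
theorem exists_toSC_eq {η : Bool} (A : SCTree η) :
    (∀ j, A.isLow j) → (∀ j, A.signRule j) → ∃ T : LowTree, A = T.toSC η A.rootSign := by
  induction A with
  | leaf ι => exact fun _ _ => ⟨.leaf, rfl⟩
  | binIn => exact fun h _ => (h ()).elim
  | binSt => exact fun h _ => (h (Sum.inl ())).elim
  | tern s ι A₁ A₂ A₃ h₁ h₂ h₃ =>
    intro hl hs
    obtain ⟨T₁, e₁⟩ := h₁ (fun j => hl (Sum.inr (Sum.inl j))) (fun j => hs (Sum.inr (Sum.inl j)))
    obtain ⟨T₂, e₂⟩ := h₂ (fun j => hl (Sum.inr (Sum.inr (Sum.inl j))))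
      (fun j => hs (Sum.inr (Sum.inr (Sum.inl j))))
    obtain ⟨T₃, e₃⟩ := h₃ (fun j => hl (Sum.inr (Sum.inr (Sum.inr j))))
      (fun j => hs (Sum.inr (Sum.inr (Sum.inr j))))
    have hr : SCTree.rootSignRule s ι A₁.rootSign A₂.rootSign A₃.rootSign := hs (Sum.inl ())
    generalize A₁.rootSign = ι₁ at e₁ hr
    generalize A₂.rootSign = ι₂ at e₂ hr
    generalize A₃.rootSign = ι₃ at e₃ hr
    subst e₁ e₂ e₃
    cases s with
    | lowL =>
      obtain ⟨rfl, rfl⟩ := hr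
      exact ⟨.node .l (-ι₃) T₁ T₂ T₃, by
        simp [toSC, SCTree.rootSign, LowKind.tern, LowKind.fst, LowKind.snd, LowKind.thd]⟩
    | lowM =>
      obtain ⟨rfl, rfl⟩ := hr
      exact ⟨.node .m (-ι₃) T₁ T₂ T₃, by
        simp [toSC, SCTree.rootSign, LowKind.tern, LowKind.fst, LowKind.snd, LowKind.thd]⟩
    | lowR =>
      obtain ⟨rfl, rfl⟩ := hr
      exact ⟨.node .r (-ι₂) T₁ T₂ T₃, by
        simp [toSC, SCTree.rootSign, LowKind.tern, LowKind.fst, LowKind.snd, LowKind.thd]⟩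
    | high => exact hr.elim

theorem isLow_toSC (T : LowTree) : ∀ (η : Bool) (ι : ℤˣ) (j), (T.toSC η ι).isLow j := by
  induction T with
  | leaf => intro η ι j; exact j.elim
  | node s ι' A₁ A₂ A₃ h₁ h₂ h₃ =>
    rintro η ι (j | j | j | j)
    · show s.tern ≠ .high
      cases s <;> simp [LowKind.tern]
    · exact h₁ _ _ j
    · exact h₂ _ _ j
    · exact h₃ _ _ j

theorem signRule_toSC (T : LowTree) : ∀ (η : Bool) (ι : ℤˣ) (j), (T.toSC η ι).signRule j := by
  induction T with
  | leaf => intro η ι j; exact j.elim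
  | node s ι' A₁ A₂ A₃ h₁ h₂ h₃ =>
    rintro η ι (j | j | j | j)
    · show SCTree.rootSignRule _ _ _ _ _
      rw [rootSign_toSC, rootSign_toSC, rootSign_toSC]
      cases s <;> simp [LowKind.tern, SCTree.rootSignRule, LowKind.fst, LowKind.snd, LowKind.thd]
    · exact h₁ _ _ j
    · exact h₂ _ _ j
    · exact h₃ _ _ j

/-- Exactly one child of a low node is unmarked, so the union defining the prebush has a single term
and the recursion runs down the spine. -/
theorem prebush_toSC (T : LowTree) : ∀ (η : Bool) (ι : ℤˣ),
    (T.toSC η ι).prebush = {T.spine η ι} := by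
  induction T with
  | leaf => intro η ι; ext ℓ; exact ⟨fun _ => rfl, fun _ => trivial⟩
  | node s ι' A₁ A₂ A₃ h₁ h₂ h₃ =>
    intro η ι
    ext ℓ
    rcases ℓ with ℓ | ℓ | ℓ
    · show (_ ∧ ℓ ∈ (A₁.toSC _ _).prebush) ↔ _
      rw [h₁]
      cases s
      · exact ⟨fun h => congrArg Sum.inl h.2, fun h => ⟨Or.inl rfl, Sum.inl.inj h⟩⟩
      · exact ⟨fun h => by simp [LowKind.tern] at h, fun h => by cases h⟩
      · exact ⟨fun h => by simp [LowKind.tern] at h, fun h => by cases h⟩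
    · show (_ ∧ ℓ ∈ (A₂.toSC _ _).prebush) ↔ _
      rw [h₂]
      cases s
      · exact ⟨fun h => by simp [LowKind.tern] at h, fun h => by cases h⟩
      · exact ⟨fun h => congrArg (Sum.inr ∘ Sum.inl) h.2,
          fun h => ⟨Or.inl rfl, Sum.inl.inj (Sum.inr.inj h)⟩⟩
      · exact ⟨fun h => by simp [LowKind.tern] at h, fun h => by cases h⟩
    · show (_ ∧ ℓ ∈ (A₃.toSC _ _).prebush) ↔ _
      rw [h₃]
      cases s
      · exact ⟨fun h => by simp [LowKind.tern] at h, fun h => by cases h⟩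
      · exact ⟨fun h => by simp [LowKind.tern] at h, fun h => by cases h⟩
      · exact ⟨fun h => congrArg (Sum.inr ∘ Sum.inr) h.2,
          fun h => ⟨Or.inl rfl, Sum.inr.inj (Sum.inr.inj h)⟩⟩

/-- The bush of the root consists of the ends of the spines of the marked children. -/
theorem bush_root (s : LowKind) (ι' : ℤˣ) (A₁ A₂ A₃ : LowTree) (η : Bool) (ι : ℤˣ) :
    ((node s ι' A₁ A₂ A₃).toSC η ι).bush (Sum.inl ()) =
      match s with
      | .l => {Sum.inr (Sum.inl (A₂.spine (!η) ι')), Sum.inr (Sum.inr (A₃.spine η (-ι')))}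
      | .m => {Sum.inl (A₁.spine η ι'), Sum.inr (Sum.inr (A₃.spine η (-ι')))}
      | .r => {Sum.inl (A₁.spine η ι'), Sum.inr (Sum.inl (A₂.spine (!η) (-ι')))} := by
  ext ℓ
  rcases ℓ with ℓ | ℓ | ℓ
  · show (_ ∧ ℓ ∈ (A₁.toSC _ _).prebush) ↔ _
    rw [prebush_toSC]
    cases s
    · exact ⟨fun h => by simp [LowKind.tern] at h, fun h => by rcases h with h | h <;> cases h⟩
    · exact ⟨fun h => Or.inl (congrArg Sum.inl h.2),
        fun h => ⟨Or.inl rfl, by rcases h with h | h; exacts [Sum.inl.inj h, by cases h]⟩⟩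
    · exact ⟨fun h => Or.inl (congrArg Sum.inl h.2),
        fun h => ⟨Or.inr rfl, by rcases h with h | h; exacts [Sum.inl.inj h, by cases h]⟩⟩
  · show (_ ∧ ℓ ∈ (A₂.toSC _ _).prebush) ↔ _
    rw [prebush_toSC]
    cases s
    · exact ⟨fun h => Or.inl (congrArg (Sum.inr ∘ Sum.inl) h.2), fun h => ⟨Or.inl rfl, by
        rcases h with h | h; exacts [Sum.inl.inj (Sum.inr.inj h), by cases h]⟩⟩
    · exact ⟨fun h => by simp [LowKind.tern] at h, fun h => by rcases h with h | h <;> cases h⟩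
    · exact ⟨fun h => Or.inr (congrArg (Sum.inr ∘ Sum.inl) h.2), fun h => ⟨Or.inr rfl, by
        rcases h with h | h; exacts [(by cases h), Sum.inl.inj (Sum.inr.inj h)]⟩⟩
  · show (_ ∧ ℓ ∈ (A₃.toSC _ _).prebush) ↔ _
    rw [prebush_toSC]
    cases s
    · exact ⟨fun h => Or.inr (congrArg (Sum.inr ∘ Sum.inr) h.2), fun h => ⟨Or.inl rfl, by
        rcases h with h | h; exacts [(by cases h), Sum.inr.inj (Sum.inr.inj h)]⟩⟩
    · exact ⟨fun h => Or.inr (congrArg (Sum.inr ∘ Sum.inr) h.2), fun h => ⟨Or.inr rfl, by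
        rcases h with h | h; exacts [(by cases h), Sum.inr.inj (Sum.inr.inj h)]⟩⟩
    · exact ⟨fun h => by simp [LowKind.tern] at h, fun h => by rcases h with h | h <;> cases h⟩

/-- Every bush consists of two leaves of opposite signs that are partners of each other. -/
theorem exists_bush_eq_pair (T : LowTree) : ∀ (η : Bool) (ι : ℤˣ) (j : (T.toSC η ι).Node),
    ∃ a b : T.Lf η ι, (T.toSC η ι).bush j = {a, b} ∧
      (T.toSC η ι).leafSign a = -(T.toSC η ι).leafSign b ∧
      ∀ {α : Type} (e : T.Lf η ι → α) (x : α), T.mate η ι e x a = e b ∧ T.mate η ι e x b = e a := by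
  induction T with
  | leaf => intro η ι j; exact j.elim
  | node s ι' A₁ A₂ A₃ h₁ h₂ h₃ =>
    rintro η ι (j | j | j | j)
    · have hb := bush_root s ι' A₁ A₂ A₃ η ι
      cases s
      · refine ⟨_, _, hb, ?_, fun e x => ⟨A₂.mate_spine _ _ _ _, A₃.mate_spine _ _ _ _⟩⟩
        exact (A₂.leafSign_spine _ _).trans
          ((neg_neg _).symm.trans (congrArg Neg.neg (A₃.leafSign_spine _ _).symm))
      · refine ⟨_, _, hb, ?_, fun e x => ⟨A₁.mate_spine _ _ _ _, A₃.mate_spine _ _ _ _⟩⟩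
        exact (A₁.leafSign_spine _ _).trans
          ((neg_neg _).symm.trans (congrArg Neg.neg (A₃.leafSign_spine _ _).symm))
      · refine ⟨_, _, hb, ?_, fun e x => ⟨A₁.mate_spine _ _ _ _, A₂.mate_spine _ _ _ _⟩⟩
        exact (A₁.leafSign_spine _ _).trans
          ((neg_neg _).symm.trans (congrArg Neg.neg (A₂.leafSign_spine _ _).symm))
    · obtain ⟨a, b, hab, hs, hm⟩ := h₁ _ _ j
      exact ⟨Sum.inl a, Sum.inl b, (congrArg (Set.image Sum.inl) hab).trans (Set.image_pair _ _ _),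
        hs, fun e x => hm _ _⟩
    · obtain ⟨a, b, hab, hs, hm⟩ := h₂ _ _ j
      exact ⟨Sum.inr (Sum.inl a), Sum.inr (Sum.inl b),
        (congrArg (Set.image (Sum.inr ∘ Sum.inl)) hab).trans (Set.image_pair _ _ _),
        hs, fun e x => hm _ _⟩
    · obtain ⟨a, b, hab, hs, hm⟩ := h₃ _ _ j
      exact ⟨Sum.inr (Sum.inr a), Sum.inr (Sum.inr b),
        (congrArg (Set.image (Sum.inr ∘ Sum.inr)) hab).trans (Set.image_pair _ _ _),
        hs, fun e x => hm _ _⟩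

/-- The partner of a partner is the original leaf. The outside label in the second pass has to be
that of the spine end, since the latter is the partner of the outside label; this makes `σ` in
`toCoupling` an involution. -/
theorem mate_mate {α : Type} (T : LowTree) : ∀ (η : Bool) (ι : ℤˣ) (e : T.Lf η ι → α) (x : α),
    T.mate η ι (T.mate η ι e x) (e (T.spine η ι)) = e := by
  induction T with
  | leaf => intros; rfl
  | node s ι' A₁ A₂ A₃ h₁ h₂ h₃ =>
    intro η ι e x
    have k {A : LowTree} {η : Bool} {ι : ℤˣ} {f : A.Lf η ι → α}
        (h : ∀ x, A.mate η ι (A.mate η ι f x) (f (A.spine η ι)) = f) {x y : α}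
        (hy : y = f (A.spine η ι)) (ℓ) : A.mate η ι (A.mate η ι f x) y ℓ = f ℓ :=
      hy ▸ congrFun (h x) ℓ
    funext ℓ
    rcases ℓ with ℓ | ℓ | ℓ
    · refine k (h₁ _ _ _) ?_ ℓ
      cases s
      · rfl
      · exact A₃.mate_spine _ _ _ _
      · exact A₂.mate_spine _ _ _ _
    · refine k (h₂ _ _ _) ?_ ℓ
      cases s
      · exact A₃.mate_spine _ _ _ _
      · rfl
      · exact A₁.mate_spine _ _ _ _
    · refine k (h₃ _ _ _) ?_ ℓ
      cases s
      · exact A₂.mate_spine _ _ _ _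
      · exact A₁.mate_spine _ _ _ _
      · rfl

/-- A leaf which is not the end of the spine of the root has a partner in the tree. -/
theorem exists_mate_eq (T : LowTree) : ∀ (η : Bool) (ι : ℤˣ) (ℓ : T.Lf η ι), ℓ ≠ T.spine η ι →
    ∃ ℓ' : T.Lf η ι, ℓ' ≠ T.spine η ι ∧
      ∀ {α : Type} (e : T.Lf η ι → α) (x : α), T.mate η ι e x ℓ = e ℓ' := by
  induction T with
  | leaf => intro η ι ℓ h; exact absurd rfl h
  | node s ι' A₁ A₂ A₃ h₁ h₂ h₃ =>
    rintro η ι (ℓ | ℓ | ℓ) h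
    · by_cases hℓ : ℓ = A₁.spine _ _
      · subst hℓ
        cases s
        · exact absurd rfl h
        · exact ⟨Sum.inr (Sum.inr (A₃.spine _ _)), by rintro ⟨⟩, fun _ _ => A₁.mate_spine _ _ _ _⟩
        · exact ⟨Sum.inr (Sum.inl (A₂.spine _ _)), by rintro ⟨⟩, fun _ _ => A₁.mate_spine _ _ _ _⟩
      · obtain ⟨ℓ', hn, hm⟩ := h₁ _ _ ℓ hℓ
        refine ⟨Sum.inl ℓ', ?_, fun _ _ => hm _ _⟩
        cases s
        · exact fun h => hn (Sum.inl.inj h)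
        · rintro ⟨⟩
        · rintro ⟨⟩
    · by_cases hℓ : ℓ = A₂.spine _ _
      · subst hℓ
        cases s
        · exact ⟨Sum.inr (Sum.inr (A₃.spine _ _)), by rintro ⟨⟩, fun _ _ => A₂.mate_spine _ _ _ _⟩
        · exact absurd rfl h
        · exact ⟨Sum.inl (A₁.spine _ _), by rintro ⟨⟩, fun _ _ => A₂.mate_spine _ _ _ _⟩
      · obtain ⟨ℓ', hn, hm⟩ := h₂ _ _ ℓ hℓ
        refine ⟨Sum.inr (Sum.inl ℓ'), ?_, fun _ _ => hm _ _⟩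
        cases s
        · rintro ⟨⟩
        · exact fun h => hn (Sum.inl.inj (Sum.inr.inj h))
        · rintro ⟨⟩
    · by_cases hℓ : ℓ = A₃.spine _ _
      · subst hℓ
        cases s
        · exact ⟨Sum.inr (Sum.inl (A₂.spine _ _)), by rintro ⟨⟩, fun _ _ => A₃.mate_spine _ _ _ _⟩
        · exact ⟨Sum.inl (A₁.spine _ _), by rintro ⟨⟩, fun _ _ => A₃.mate_spine _ _ _ _⟩
        · exact absurd rfl h
      · obtain ⟨ℓ', hn, hm⟩ := h₃ _ _ ℓ hℓ
        refine ⟨Sum.inr (Sum.inr ℓ'), ?_, fun _ _ => hm _ _⟩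
        cases s
        · rintro ⟨⟩
        · rintro ⟨⟩
        · exact fun h => hn (Sum.inr.inj (Sum.inr.inj h))

/-- A map that exchanges the two leaves of every bush sends every leaf to its partner. -/
theorem eq_mate {α : Type} (τ : α → α) (T : LowTree) : ∀ (η : Bool) (ι : ℤˣ) (e : T.Lf η ι → α)
    (_ : ∀ j a b, (T.toSC η ι).bush j = {a, b} →
      (T.toSC η ι).leafSign a = -(T.toSC η ι).leafSign b → τ (e a) = e b)
    (ℓ), τ (e ℓ) = T.mate η ι e (τ (e (T.spine η ι))) ℓ := by
  induction T with
  | leaf => intros; rfl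
  | node s ι' A₁ A₂ A₃ h₁ h₂ h₃ =>
    intro η ι e H
    have k₁ := h₁ η (s.fst ι ι' (-ι')) (fun ℓ => e (Sum.inl ℓ)) fun j a b hab hs =>
      H (Sum.inr (Sum.inl j)) (Sum.inl a) (Sum.inl b)
        ((congrArg (Set.image Sum.inl) hab).trans (Set.image_pair _ _ _)) hs
    have k₂ := h₂ (!η) (s.snd ι ι' (-ι')) (fun ℓ => e (Sum.inr (Sum.inl ℓ))) fun j a b hab hs =>
      H (Sum.inr (Sum.inr (Sum.inl j))) (Sum.inr (Sum.inl a)) (Sum.inr (Sum.inl b))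
        ((congrArg (Set.image (Sum.inr ∘ Sum.inl)) hab).trans (Set.image_pair _ _ _)) hs
    have k₃ := h₃ η (s.thd ι ι' (-ι')) (fun ℓ => e (Sum.inr (Sum.inr ℓ))) fun j a b hab hs =>
      H (Sum.inr (Sum.inr (Sum.inr j))) (Sum.inr (Sum.inr a)) (Sum.inr (Sum.inr b))
        ((congrArg (Set.image (Sum.inr ∘ Sum.inr)) hab).trans (Set.image_pair _ _ _)) hs
    have hb := bush_root s ι' A₁ A₂ A₃ η ι
    have sg {x y : ℤˣ} (A B : LowTree) (η₁ η₂ : Bool) (h : x = -y) :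
        (A.toSC η₁ x).leafSign (A.spine _ _) = -(B.toSC η₂ y).leafSign (B.spine _ _) := by
      rw [leafSign_spine, leafSign_spine, h]
    -- The induction hypothesis takes `τ` at the spine end of the subtree as outside label. For a
    -- marked subtree this is the spine end of the other marked subtree, by `H` at the root.
    have k {A : LowTree} {η : Bool} {ι : ℤˣ} {f : A.Lf η ι → α}
        (h : ∀ ℓ, τ (f ℓ) = A.mate η ι f (τ (f (A.spine η ι))) ℓ) {y : α}
        (hy : τ (f (A.spine η ι)) = y) (ℓ) : τ (f ℓ) = A.mate η ι f y ℓ := hy ▸ h ℓ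
    cases s
    · rintro (ℓ | ℓ | ℓ)
      · exact k₁ ℓ
      · exact k k₂ (H _ _ _ hb (sg A₂ A₃ _ _ (neg_neg _).symm)) ℓ
      · exact k k₃ (H _ _ _ (hb.trans (Set.pair_comm _ _)) (sg A₃ A₂ _ _ rfl)) ℓ
    · rintro (ℓ | ℓ | ℓ)
      · exact k k₁ (H _ _ _ hb (sg A₁ A₃ _ _ (neg_neg _).symm)) ℓ
      · exact k₂ ℓ
      · exact k k₃ (H _ _ _ (hb.trans (Set.pair_comm _ _)) (sg A₃ A₁ _ _ rfl)) ℓ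
    · rintro (ℓ | ℓ | ℓ)
      · exact k k₁ (H _ _ _ hb (sg A₁ A₂ _ _ (neg_neg _).symm)) ℓ
      · exact k k₂ (H _ _ _ (hb.trans (Set.pair_comm _ _)) (sg A₂ A₁ _ _ rfl)) ℓ
      · exact k₃ ℓ

end LowTree
end ResonantKG

/-! ### Enumeration of the trees and of the resonant couplings -/

namespace ResonantKG

instance : Fintype LowKind where
  elems := ⟨{.l, .m, .r}, by simp⟩
  complete s := by cases s <;> simp

namespace LowTree

theorem finite_card_eq (n : ℕ) : {T : LowTree | T.card = n}.Finite := by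
  refine ((finite_trees n false).preimage ((toSC_injective false 1).injOn)).subset fun T hT => ?_
  show Fintype.card (T.toSC false 1).Node ≤ n
  rw [card_node_toSC, hT]

/-- The trees with `n` nodes. -/
def ofCard (n : ℕ) : Finset LowTree := (finite_card_eq n).toFinset

@[simp] theorem mem_ofCard {n : ℕ} {T : LowTree} : T ∈ ofCard n ↔ T.card = n := by
  simp [ofCard]

@[simp] theorem ofCard_zero : ofCard 0 = {leaf} := by
  ext T
  cases T <;> simp [card]

/-- The tree of which the root has type `s`, unmarked child `U` and marked children `P`, `Q`. -/
def graft (s : LowKind) (ι : ℤˣ) (U P Q : LowTree) : LowTree :=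
  node s ι (s.fst U P Q) (s.snd U P Q) (s.thd U P Q)

theorem card_graft (s : LowKind) (ι : ℤˣ) (U P Q : LowTree) :
    (graft s ι U P Q).card = U.card + (P.card + Q.card) + 1 := by
  cases s <;> simp [graft, card, LowKind.fst, LowKind.snd, LowKind.thd] <;> omega

/-- Decomposition at the root, with the nodes split first between the unmarked subtree and the
marked pair, then within the pair. This nesting is what later produces a tree sum times a
correlation. -/
theorem sum_ofCard_succ {E : Type*} [AddCommMonoid E] (f : LowTree → E) (n : ℕ) :
    ∑ T ∈ ofCard (n + 1), f T = ∑ s : LowKind, ∑ ι : ℤˣ,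
      ∑ p ∈ Finset.HasAntidiagonal.antidiagonal n, ∑ U ∈ ofCard p.1,
        ∑ q ∈ Finset.HasAntidiagonal.antidiagonal p.2, ∑ P ∈ ofCard q.1, ∑ Q ∈ ofCard q.2,
          f (graft s ι U P Q) := by
  classical
  have h := Finset.sum_nbij (M := E)
    (s := (Finset.univ : Finset LowKind) ×ˢ (Finset.univ : Finset ℤˣ) ×ˢ
      (Finset.HasAntidiagonal.antidiagonal n).sigma fun p => ofCard p.1 ×ˢ
        (Finset.HasAntidiagonal.antidiagonal p.2).sigma fun q => ofCard q.1 ×ˢ ofCard q.2)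
    (t := ofCard (n + 1))
    (f := fun x => f (graft x.1 x.2.1 x.2.2.2.1 x.2.2.2.2.2.1 x.2.2.2.2.2.2)) (g := f)
    (fun x => graft x.1 x.2.1 x.2.2.2.1 x.2.2.2.2.2.1 x.2.2.2.2.2.2)
    ?_ ?_ ?_ (fun _ _ => rfl)
  · rw [← h]
    simp only [Finset.sum_product, Finset.sum_sigma]
  · rintro ⟨s, ι, ⟨p₁, p₂⟩, U, ⟨q₁, q₂⟩, P, Q⟩ hx
    simp only [Finset.mem_product, Finset.mem_univ, true_and, Finset.mem_sigma,
      Finset.HasAntidiagonal.mem_antidiagonal, mem_ofCard] at hx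
    simp only [mem_ofCard, card_graft]
    omega
  · rintro ⟨s, ι, ⟨p₁, p₂⟩, U, ⟨q₁, q₂⟩, P, Q⟩ hx ⟨s', ι', ⟨p₁', p₂'⟩, U', ⟨q₁', q₂'⟩, P', Q'⟩ hx' h
    simp only [Finset.mem_coe, Finset.mem_product, Finset.mem_univ, true_and,
      Finset.mem_sigma, Finset.HasAntidiagonal.mem_antidiagonal, mem_ofCard] at hx hx'
    simp only [graft, node.injEq] at h
    obtain ⟨rfl, rfl, e₁, e₂, e₃⟩ := h
    have : U = U' ∧ P = P' ∧ Q = Q' := by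
      cases s <;> simp_all [LowKind.fst, LowKind.snd, LowKind.thd]
    obtain ⟨rfl, rfl, rfl⟩ := this
    obtain ⟨h₁, h₂, h₃, h₄, h₅⟩ := hx
    obtain ⟨h₁', h₂', h₃', h₄', h₅'⟩ := hx'
    obtain rfl : p₁ = p₁' := by omega
    obtain rfl : p₂ = p₂' := by omega
    obtain rfl : q₁ = q₁' := by omega
    obtain rfl : q₂ = q₂' := by omega
    rfl
  · intro T hT
    simp only [Finset.mem_coe, mem_ofCard] at hT
    cases T with
    | leaf => simp [card] at hT
    | node s ι A₁ A₂ A₃ =>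
      have key : ∃ U P Q, node s ι A₁ A₂ A₃ = graft s ι U P Q := by
        cases s
        exacts [⟨A₁, A₂, A₃, rfl⟩, ⟨A₂, A₁, A₃, rfl⟩, ⟨A₃, A₁, A₂, rfl⟩]
      obtain ⟨U, P, Q, hg⟩ := key
      rw [hg, card_graft] at hT
      refine ⟨⟨s, ι, ⟨U.card, P.card + Q.card⟩, U, ⟨P.card, Q.card⟩, P, Q⟩, ?_, hg.symm⟩
      simp only [Finset.mem_coe, Finset.mem_product, Finset.mem_univ, true_and,
        Finset.mem_sigma, Finset.HasAntidiagonal.mem_antidiagonal, mem_ofCard, and_true]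
      omega

/-- The coupling of two trees for which all nodes are resonant. -/
def toCoupling (T T' : LowTree) (η η' : Bool) (ι : ℤˣ) : Coupling η η' where
  left := T.toSC η ι
  right := T'.toSC η' (-ι)
  σ := Sum.elim (T.mate η ι Sum.inl (Sum.inr (T'.spine η' (-ι))))
    (T'.mate η' (-ι) Sum.inr (Sum.inl (T.spine η ι)))
  invol := by
    rintro (ℓ | ℓ)
    · refine (map_mate (Sum.elim _ _) T _ _ _ _ ℓ).trans ?_
      rw [Sum.elim_inr, mate_spine]
      exact congrFun (T.mate_mate η ι Sum.inl (Sum.inr (T'.spine η' (-ι)))) ℓ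
    · refine (map_mate (Sum.elim _ _) T' _ _ _ _ ℓ).trans ?_
      rw [Sum.elim_inl, mate_spine]
      exact congrFun (T'.mate_mate η' (-ι) Sum.inr (Sum.inl (T.spine η ι))) ℓ
  sign_σ := by
    rintro (ℓ | ℓ)
    · refine (map_mate (Sum.elim _ _) T _ _ _ _ ℓ).trans ?_
      rw [Sum.elim_inr, leafSign_spine]
      have := T.balanced_leafSign η ι ℓ
      rwa [leafSign_spine] at this
    · refine (map_mate (Sum.elim _ _) T' _ _ _ _ ℓ).trans ?_
      rw [Sum.elim_inl, leafSign_spine]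
      have := T'.balanced_leafSign η' (-ι) ℓ
      rwa [leafSign_spine, neg_neg] at this

end LowTree

namespace Coupling

variable {η₁ η₂ : Bool} (C : Coupling η₁ η₂)

/-- One of the two leaves is positive and the other negative, so both sets in the definition are
singletons. -/
theorem selfCoupled_pair_iff {a b : C.Leaf} (h : C.sign a = -C.sign b) :
    C.SelfCoupled {a, b} ↔ C.σ a = b := by
  have ne : (1 : ℤˣ) ≠ -1 := by decide
  -- Exchanging the two leaves changes neither the pair nor, `σ` being an involution, the right-hand
  -- side.
  wlog ha : C.sign a = 1 generalizing a b
  · have ha' : C.sign a = -1 := (Int.units_eq_one_or _).resolve_left ha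
    have hb : C.sign b = 1 := by rw [← neg_neg (C.sign b), ← h, ha', neg_neg]
    have hi : C.SelfCoupled {b, a} ↔ C.σ b = a := this (by rw [ha', hb]; decide) hb
    rw [Set.pair_comm, hi]
    exact ⟨fun h => by rw [← h, C.invol], fun h => by rw [← h, C.invol]⟩
  have hb : C.sign b = -1 := by rw [← ha, h, neg_neg]
  have e₁ : {ℓ ∈ ({a, b} : Set C.Leaf) | C.sign ℓ = 1} = {a} := by
    ext ℓ
    refine ⟨?_, ?_⟩
    · rintro ⟨rfl | rfl, hℓ⟩
      · rfl
      · exact absurd (hℓ.symm.trans hb) ne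
    · rintro rfl
      exact ⟨Or.inl rfl, ha⟩
  have e₂ : {ℓ ∈ ({a, b} : Set C.Leaf) | C.sign ℓ = -1} = {b} := by
    ext ℓ
    refine ⟨?_, ?_⟩
    · rintro ⟨rfl | rfl, hℓ⟩
      · exact absurd (ha.symm.trans hℓ) ne
      · rfl
    · rintro rfl
      exact ⟨Or.inr rfl, hb⟩
  rw [SelfCoupled, e₁, e₂, Set.image_singleton, Set.singleton_eq_singleton_iff]

end Coupling

namespace LowTree

theorem toCoupling_mem_Res (T T' : LowTree) (η η' : Bool) (ι : ℤˣ) :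
    T.toCoupling T' η η' ι ∈ Res (T.card + T'.card) ι (-ι) η η' := by
  refine ⟨?_, ?_, T.rootSign_toSC _ _, T'.rootSign_toSC _ _⟩
  · have : Fintype.card ((T.toSC η ι).Node ⊕ (T'.toSC η' (-ι)).Node) = T.card + T'.card := by
      rw [Fintype.card_sum, card_node_toSC, card_node_toSC]
    exact this
  · rintro (j | j)
    · refine ⟨T.isLow_toSC _ _ j, ?_, T.signRule_toSC _ _ j⟩
      obtain ⟨a, b, hb, hs, hm⟩ := T.exists_bush_eq_pair η ι j
      have : (T.toCoupling T' η η' ι).bush (Sum.inl j) = {Sum.inl a, Sum.inl b} :=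
        (congrArg (Set.image Sum.inl) hb).trans (Set.image_pair _ _ _)
      rw [this]
      exact (Coupling.selfCoupled_pair_iff (T.toCoupling T' η η' ι) (a := Sum.inl a) (b := Sum.inl b)
        hs).2 (hm _ _).1
    · refine ⟨T'.isLow_toSC _ _ j, ?_, T'.signRule_toSC _ _ j⟩
      obtain ⟨a, b, hb, hs, hm⟩ := T'.exists_bush_eq_pair η' (-ι) j
      have : (T.toCoupling T' η η' ι).bush (Sum.inr j) = {Sum.inr a, Sum.inr b} :=
        (congrArg (Set.image Sum.inr) hb).trans (Set.image_pair _ _ _)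
      rw [this]
      exact (Coupling.selfCoupled_pair_iff (T.toCoupling T' η η' ι) (a := Sum.inr a) (b := Sum.inr b)
        hs).2 (hm _ _).1

/-- Resonance determines `σ` on every leaf other than the two root spine ends, and these have no
possible partner but each other. -/
theorem exists_toCoupling_eq {n : ℕ} {η η' : Bool} {ι : ℤˣ} {C : Coupling η η'}
    (hC : C ∈ Res n ι (-ι) η η') :
    ∃ T T' : LowTree, T.card + T'.card = n ∧ T.toCoupling T' η η' ι = C := by
  obtain ⟨hn, hr, hl, hl'⟩ := hC
  obtain ⟨A, A', σ, invol, sign_σ⟩ := C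
  obtain ⟨T, hT⟩ := exists_toSC_eq A (fun j => (hr (Sum.inl j)).1) (fun j => (hr (Sum.inl j)).2.2)
  obtain ⟨T', hT'⟩ := exists_toSC_eq A' (fun j => (hr (Sum.inr j)).1)
    (fun j => (hr (Sum.inr j)).2.2)
  dsimp only at hl hl'
  rw [hl] at hT
  rw [hl'] at hT'
  subst hT hT'
  refine ⟨T, T', ?_, ?_⟩
  · rw [← hn, Fintype.card_sum, card_node_toSC, card_node_toSC]
  have H : ∀ j a b, (T.toSC η ι).bush j = {a, b} →
      (T.toSC η ι).leafSign a = -(T.toSC η ι).leafSign b → σ (Sum.inl a) = Sum.inl b := by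
    intro j a b hb hs
    have hc := (hr (Sum.inl j)).2.1
    have : Coupling.bush ⟨T.toSC η ι, T'.toSC η' (-ι), σ, invol, sign_σ⟩ (Sum.inl j)
        = {Sum.inl a, Sum.inl b} :=
      (congrArg (Set.image Sum.inl) hb).trans (Set.image_pair _ _ _)
    rw [this] at hc
    exact (Coupling.selfCoupled_pair_iff ⟨T.toSC η ι, T'.toSC η' (-ι), σ, invol, sign_σ⟩
      (a := Sum.inl a) (b := Sum.inl b) hs).1 hc
  have H' : ∀ j a b, (T'.toSC η' (-ι)).bush j = {a, b} →
      (T'.toSC η' (-ι)).leafSign a = -(T'.toSC η' (-ι)).leafSign b →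
      σ (Sum.inr a) = Sum.inr b := by
    intro j a b hb hs
    have hc := (hr (Sum.inr j)).2.1
    have : Coupling.bush ⟨T.toSC η ι, T'.toSC η' (-ι), σ, invol, sign_σ⟩ (Sum.inr j)
        = {Sum.inr a, Sum.inr b} :=
      (congrArg (Set.image Sum.inr) hb).trans (Set.image_pair _ _ _)
    rw [this] at hc
    exact (Coupling.selfCoupled_pair_iff ⟨T.toSC η ι, T'.toSC η' (-ι), σ, invol, sign_σ⟩
      (a := Sum.inr a) (b := Sum.inr b) hs).1 hc
  have m := eq_mate σ T η ι Sum.inl H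
  have m' := eq_mate σ T' η' (-ι) Sum.inr H'
  -- The partner cannot be the leaf itself, as `σ` reverses signs, nor any leaf that is not a root
  -- spine end, since such a leaf already has its partner inside its own tree.
  have hσ : σ (Sum.inl (T.spine η ι)) = Sum.inr (T'.spine η' (-ι)) := by
    rcases hy : σ (Sum.inl (T.spine η ι)) with y | y
    · exfalso
      by_cases h : y = T.spine η ι
      · have := sign_σ (Sum.inl (T.spine η ι))
        rw [hy, h, Sum.elim_inl, leafSign_spine] at this
        rcases Int.units_eq_one_or ι with rfl | rfl <;> exact absurd this (by decide)
      · obtain ⟨z, hz, hm⟩ := T.exists_mate_eq η ι y h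
        have h₁ := m y
        rw [hm, ← hy, invol] at h₁
        exact hz (Sum.inl.inj h₁).symm
    · by_cases h : y = T'.spine η' (-ι)
      · rw [h]
      · obtain ⟨z, hz, hm⟩ := T'.exists_mate_eq η' (-ι) y h
        have h₁ := m' y
        rw [hm, ← hy, invol] at h₁
        cases h₁
  have hσ' : σ (Sum.inr (T'.spine η' (-ι))) = Sum.inl (T.spine η ι) := by rw [← hσ, invol]
  have : σ = (T.toCoupling T' η η' ι).σ := by
    funext ℓ
    rcases ℓ with ℓ | ℓ
    · exact (m ℓ).trans (by rw [hσ]; rfl)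
    · exact (m' ℓ).trans (by rw [hσ']; rfl)
  subst this
  rfl

theorem toCoupling_inj {T₁ T₁' T₂ T₂' : LowTree} {η η' : Bool} {ι : ℤˣ}
    (h : T₁.toCoupling T₁' η η' ι = T₂.toCoupling T₂' η η' ι) : T₁ = T₂ ∧ T₁' = T₂' :=
  ⟨toSC_injective η ι (congrArg Coupling.left h),
    toSC_injective η' (-ι) (congrArg Coupling.right h)⟩

theorem sum_Res {E : Type*} [AddCommMonoid E] {η η' : Bool} (f : Coupling η η' → E) (n : ℕ)
    (ι : ℤˣ) :
    ∑ C ∈ (finite_Res n ι (-ι) η η').toFinset, f C = ∑ p ∈ Finset.HasAntidiagonal.antidiagonal n,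
      ∑ T ∈ ofCard p.1, ∑ T' ∈ ofCard p.2, f (T.toCoupling T' η η' ι) := by
  have h := Finset.sum_nbij (M := E)
    (s := (Finset.HasAntidiagonal.antidiagonal n).sigma fun p => ofCard p.1 ×ˢ ofCard p.2)
    (t := (finite_Res n ι (-ι) η η').toFinset)
    (f := fun x => f (toCoupling x.2.1 x.2.2 η η' ι)) (g := f)
    (fun x => toCoupling x.2.1 x.2.2 η η' ι) ?_ ?_ ?_ (fun _ _ => rfl)
  · rw [← h]
    simp only [Finset.sum_product, Finset.sum_sigma]
  · rintro ⟨⟨p, q⟩, T, T'⟩ hx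
    simp only [Finset.mem_product, Finset.mem_sigma, Finset.HasAntidiagonal.mem_antidiagonal, mem_ofCard] at hx
    obtain ⟨rfl, rfl, rfl⟩ := hx
    simpa using toCoupling_mem_Res T T' η η' ι
  · rintro ⟨⟨p, q⟩, T, T'⟩ hx ⟨⟨p', q'⟩, S, S'⟩ hx' h
    simp only [Finset.mem_coe, Finset.mem_product, Finset.mem_sigma, Finset.HasAntidiagonal.mem_antidiagonal,
      mem_ofCard] at hx hx'
    obtain ⟨rfl, rfl⟩ := toCoupling_inj h
    obtain ⟨rfl, rfl, rfl⟩ := hx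
    obtain ⟨_, rfl, rfl⟩ := hx'
    rfl
  · intro C hC
    obtain ⟨T, T', hn, rfl⟩ := exists_toCoupling_eq (by simpa using hC)
    refine ⟨⟨⟨T.card, T'.card⟩, T, T'⟩, ?_, rfl⟩
    simp [hn]

end LowTree
end ResonantKG

/-! ### Decorations, and the weight of a decorated tree -/

namespace ResonantKG

namespace SCTree

theorem prod_node_tern {E : Type*} [CommMonoid E] {η : Bool} (s : TernKind) (ι : ℤˣ)
    (A₁ : SCTree η) (A₂ : SCTree (!η)) (A₃ : SCTree η) (f : (tern s ι A₁ A₂ A₃).Node → E) :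
    ∏ j, f j = f (Sum.inl ()) * ((∏ j, f (Sum.inr (Sum.inl j))) *
      ((∏ j, f (Sum.inr (Sum.inr (Sum.inl j)))) * ∏ j, f (Sum.inr (Sum.inr (Sum.inr j))))) := by
  have h : ∀ f : Unit ⊕ (A₁.Node ⊕ (A₂.Node ⊕ A₃.Node)) → E,
      ∏ j, f j = f (Sum.inl ()) * ((∏ j, f (Sum.inr (Sum.inl j))) *
      ((∏ j, f (Sum.inr (Sum.inr (Sum.inl j)))) * ∏ j, f (Sum.inr (Sum.inr (Sum.inr j))))) := by
    intro f
    simp only [Fintype.prod_sum_type, Finset.univ_unique, Finset.prod_singleton]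
  exact h f

theorem prod_leaf_tern {E : Type*} [CommMonoid E] {η : Bool} (s : TernKind) (ι : ℤˣ)
    (A₁ : SCTree η) (A₂ : SCTree (!η)) (A₃ : SCTree η) (f : (tern s ι A₁ A₂ A₃).Leaf → E) :
    ∏ ℓ, f ℓ = (∏ ℓ, f (Sum.inl ℓ)) *
      ((∏ ℓ, f (Sum.inr (Sum.inl ℓ))) * ∏ ℓ, f (Sum.inr (Sum.inr ℓ))) := by
  have h : ∀ f : A₁.Leaf ⊕ (A₂.Leaf ⊕ A₃.Leaf) → E,
      ∏ ℓ, f ℓ = (∏ ℓ, f (Sum.inl ℓ)) *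
      ((∏ ℓ, f (Sum.inr (Sum.inl ℓ))) * ∏ ℓ, f (Sum.inr (Sum.inr ℓ))) := by
    intro f
    simp only [Fintype.prod_sum_type]
  exact h f

end SCTree

namespace LowTree

/-- The free momenta of the decorations of a tree: those of the left marked children. -/
def Par (G : Type) : LowTree → Type
  | .leaf => Unit
  | .node _ _ A₁ A₂ A₃ => G × Par G A₁ × Par G A₂ × Par G A₃

variable {G : Type} [AddCommGroup G]

/-- The values on the leaves of the decoration with value `k` at the root. -/
def kap : (T : LowTree) → (η : Bool) → (ι : ℤˣ) → G → Par G T → T.Lf η ι → G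
  | .leaf, _, _ => fun k _ _ => k
  | .node s ι' A₁ A₂ A₃, η, ι => fun k p =>
    Sum.elim (A₁.kap η (s.fst ι ι' (-ι')) (s.fst k p.1 (-p.1)) p.2.1)
      (Sum.elim (A₂.kap (!η) (s.snd ι ι' (-ι')) (s.snd k p.1 (-p.1)) p.2.2.1)
        (A₃.kap η (s.thd ι ι' (-ι')) (s.thd k p.1 (-p.1)) p.2.2.2))

theorem kap_spine (T : LowTree) : ∀ (η : Bool) (ι : ℤˣ) (k : G) (p : Par G T),
    T.kap η ι k p (T.spine η ι) = k := by
  induction T with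
  | leaf => intros; rfl
  | node s ι' A₁ A₂ A₃ h₁ h₂ h₃ =>
    intro η ι k p
    cases s
    · exact h₁ _ _ _ _
    · exact h₂ _ _ _ _
    · exact h₃ _ _ _ _

theorem balanced_kap (T : LowTree) : ∀ (η : Bool) (ι : ℤˣ) (k : G) (p : Par G T),
    T.Balanced η ι (T.kap η ι k p) := by
  induction T with
  | leaf => intro η ι k p ℓ; rfl
  | node s ι' A₁ A₂ A₃ h₁ h₂ h₃ =>
    intro η ι k p
    exact balanced_node s ι' A₁ A₂ A₃ η ι _ (h₁ _ _ _ _) (h₂ _ _ _ _) (h₃ _ _ _ _) k p.1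
      (A₁.kap_spine _ _ _ _) (A₂.kap_spine _ _ _ _) (A₃.kap_spine _ _ _ _)

theorem rootMom_kap (T : LowTree) : ∀ (η : Bool) (ι : ℤˣ) (k : G) (p : Par G T),
    (T.toSC η ι).rootMom (T.kap η ι k p) = k := by
  induction T with
  | leaf => intros; rfl
  | node s ι' A₁ A₂ A₃ h₁ h₂ h₃ =>
    intro η ι k p
    have : s.fst k p.1 (-p.1) + s.snd k p.1 (-p.1) + s.thd k p.1 (-p.1) = k := by
      cases s <;> simp [LowKind.fst, LowKind.snd, LowKind.thd]
    refine Eq.trans ?_ this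
    exact congr_arg₂ _ (congr_arg₂ _ (h₁ _ _ _ _) (h₂ _ _ _ _)) (h₃ _ _ _ _)

theorem kap_injective (T : LowTree) : ∀ (η : Bool) (ι : ℤˣ) (k : G),
    Function.Injective (T.kap η ι k) := by
  induction T with
  | leaf => intro η ι k p q _; rfl
  | node s ι' A₁ A₂ A₃ h₁ h₂ h₃ =>
    rintro η ι k ⟨k₁, p₁, p₂, p₃⟩ ⟨k₁', p₁', p₂', p₃'⟩ h
    have e₁ : A₁.kap η (s.fst ι ι' (-ι')) (s.fst k k₁ (-k₁)) p₁
      = A₁.kap η (s.fst ι ι' (-ι')) (s.fst k k₁' (-k₁')) p₁' :=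
      funext fun ℓ => congrFun h (Sum.inl ℓ)
    have e₂ : A₂.kap (!η) (s.snd ι ι' (-ι')) (s.snd k k₁ (-k₁)) p₂
      = A₂.kap (!η) (s.snd ι ι' (-ι')) (s.snd k k₁' (-k₁')) p₂' :=
      funext fun ℓ => congrFun h (Sum.inr (Sum.inl ℓ))
    have e₃ : A₃.kap η (s.thd ι ι' (-ι')) (s.thd k k₁ (-k₁)) p₃
      = A₃.kap η (s.thd ι ι' (-ι')) (s.thd k k₁' (-k₁')) p₃' :=
      funext fun ℓ => congrFun h (Sum.inr (Sum.inr ℓ))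
    -- The free momentum is the value at the spine end of the left marked child.
    have hk : k₁ = k₁' := by
      have f₁ := congrFun e₁ (A₁.spine _ _)
      have f₂ := congrFun e₂ (A₂.spine _ _)
      rw [kap_spine, kap_spine] at f₁ f₂
      cases s
      · exact f₂
      · exact f₁
      · exact f₁
    subst hk
    rw [h₁ _ _ _ e₁, h₂ _ _ _ e₂, h₃ _ _ _ e₃]

theorem Balanced.exists_kap (T : LowTree) : ∀ {η : Bool} {ι : ℤˣ} {e : T.Lf η ι → G},
    T.Balanced η ι e → ∃ p, T.kap η ι (e (T.spine η ι)) p = e := by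
  induction T with
  | leaf => intro η ι e _; exact ⟨(), rfl⟩
  | node s ι' A₁ A₂ A₃ h₁ h₂ h₃ =>
    intro η ι e h
    obtain ⟨b₁, b₂, b₃, k₁, e₁, e₂, e₃⟩ := h.exists_labels
    obtain ⟨p₁, hp₁⟩ := h₁ b₁
    obtain ⟨p₂, hp₂⟩ := h₂ b₂
    obtain ⟨p₃, hp₃⟩ := h₃ b₃
    rw [e₁] at hp₁
    rw [e₂] at hp₂
    rw [e₃] at hp₃
    refine ⟨(k₁, p₁, p₂, p₃), funext ?_⟩
    rintro (ℓ | ℓ | ℓ)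
    · exact congrFun hp₁ ℓ
    · exact congrFun hp₂ ℓ
    · exact congrFun hp₃ ℓ

end LowTree

namespace KGData

variable {d : ℕ} (D : KGData d)

open LowTree

theorem decoration_kap (T T' : LowTree) (η η' : Bool) (ι : ℤˣ) (k : D.Mom)
    (p : Par D.Mom T × Par D.Mom T') :
    (∀ ℓ, Sum.elim (T.kap η ι k p.1) (T'.kap η' (-ι) (-k) p.2) ℓ
      + Sum.elim (T.kap η ι k p.1) (T'.kap η' (-ι) (-k) p.2)
        ((T.toCoupling T' η η' ι).σ ℓ) = 0) ∧
      (T.toSC η ι).rootMom (T.kap η ι k p.1) = k := by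
  refine ⟨?_, rootMom_kap _ _ _ _ _⟩
  rintro (ℓ | ℓ)
  · have h := T.balanced_kap η ι k p.1 ℓ
    rw [kap_spine] at h
    have h' := map_mate (Sum.elim (T.kap η ι k p.1) (T'.kap η' (-ι) (-k) p.2)) T η ι Sum.inl
      (Sum.inr (T'.spine η' (-ι))) ℓ
    rw [Sum.elim_inr, kap_spine] at h'
    exact add_eq_zero_iff_eq_neg'.2 (h'.trans h)
  · have h := T'.balanced_kap η' (-ι) (-k) p.2 ℓ
    rw [kap_spine, neg_neg] at h
    have h' := map_mate (Sum.elim (T.kap η ι k p.1) (T'.kap η' (-ι) (-k) p.2)) T' η' (-ι) Sum.inr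
      (Sum.inl (T.spine η ι)) ℓ
    rw [Sum.elim_inl, kap_spine] at h'
    exact add_eq_zero_iff_eq_neg'.2 (h'.trans h)

/-- The decorations of a coupling all of whose nodes are resonant. -/
def decorationEquiv (T T' : LowTree) (η η' : Bool) (ι : ℤˣ) (k : D.Mom) :
    Par D.Mom T × Par D.Mom T' ≃ D.Decoration (T.toCoupling T' η η' ι) k :=
  Equiv.ofBijective (fun p => ⟨Sum.elim (T.kap η ι k p.1) (T'.kap η' (-ι) (-k) p.2),
    D.decoration_kap T T' η η' ι k p⟩) <| by
    refine ⟨fun p q h => ?_, ?_⟩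
    · have h' := congrArg Subtype.val h
      exact Prod.ext (T.kap_injective η ι k (funext fun ℓ => congrFun h' (Sum.inl ℓ)))
        (T'.kap_injective η' (-ι) (-k) (funext fun ℓ => congrFun h' (Sum.inr ℓ)))
    · rintro ⟨κ, hκ, hk⟩
      have b : T.Balanced η ι fun ℓ => κ (Sum.inl ℓ) := .of_mate fun ℓ =>
        (map_mate κ T η ι Sum.inl (Sum.inr (T'.spine η' (-ι))) ℓ).symm.trans
          (eq_neg_of_add_eq_zero_right (hκ (Sum.inl ℓ)))
      have b' : T'.Balanced η' (-ι) fun ℓ => κ (Sum.inr ℓ) := .of_mate fun ℓ =>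
        (map_mate κ T' η' (-ι) Sum.inr (Sum.inl (T.spine η ι)) ℓ).symm.trans
          (eq_neg_of_add_eq_zero_right (hκ (Sum.inr ℓ)))
      obtain ⟨p, hp⟩ := b.exists_kap
      obtain ⟨p', hp'⟩ := b'.exists_kap
      have hs : κ (Sum.inl (T.spine η ι)) = k := by
        rw [← hk]
        have := T.rootMom_kap η ι (κ (Sum.inl (T.spine η ι))) p
        rw [hp] at this
        exact this.symm
      have hs' : κ (Sum.inr (T'.spine η' (-ι))) = -k := by
        have h₀ : κ (Sum.inl (T.spine η ι)) + κ (T.mate η ι Sum.inl (Sum.inr (T'.spine η' (-ι)))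
          (T.spine η ι)) = 0 := hκ (Sum.inl (T.spine η ι))
        rw [hs] at h₀
        exact (congrArg κ (T.mate_spine η ι _ _)).symm.trans (eq_neg_of_add_eq_zero_right h₀)
      rw [hs] at hp
      rw [hs'] at hp'
      refine ⟨(p, p'), Subtype.ext (funext ?_)⟩
      rintro (ℓ | ℓ)
      · exact congrFun hp ℓ
      · exact congrFun hp' ℓ

/-- The covariance of the initial data, with the signs of the leaves taken into account. -/
def cov (ι : ℤˣ) (c c' : Bool) (k : Freq d) : ℂ :=
  if ι = 1 then D.M c c' k else D.M c' c (-k)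

/-- The contribution of a leaf. -/
def leafFactor (ι : ℤˣ) (c c' : Bool) (k : D.Mom) : ℂ :=
  if ι = -1 then conjSign ι (D.M c c' (((ι : ℤ) • k : D.Mom) : Freq d)) else 1

variable {D} in
-- Exactly one leaf of a pair is negative and contributes; the Hermitian symmetry of `M` removes the
-- conjugation.
theorem Standing.leafFactor_mul (hD : D.Standing) (ι : ℤˣ) (c c' : Bool) (k : D.Mom) :
    D.leafFactor ι c c' k * D.leafFactor (-ι) c' c (-k) = D.cov ι c c' k := by
  have ne : (-1 : ℤˣ) ≠ 1 := by decide
  rcases Int.units_eq_one_or ι with rfl | rfl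
  · simp [leafFactor, cov, conjSign, ne, ne.symm, hD.M_conj c c']
  · simp [leafFactor, cov, conjSign, ne, ne.symm, hD.M_conj c' c]

/-- The covariance of the marked leaves, the children of the node having the colours `c₁`, `c₂`,
`c₃` at the end of their spines. -/
def pairCov : LowKind → ℤˣ → Bool → Bool → Bool → Freq d → ℂ
  | .l, ι, _, c₂, c₃ => D.cov ι c₂ c₃
  | .m, ι, c₁, _, c₃ => D.cov ι c₁ c₃
  | .r, ι, c₁, c₂, _ => D.cov ι c₁ c₂

/-- The contribution of a resonant node with momentum `k`, sign `ι` and colour `η`, the left marked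
child of which has momentum `k₁` and sign `ι'`. -/
def nodeFactor (s : LowKind) (η : Bool) (ι ι' : ℤˣ) (k k₁ : Freq d) : ℂ :=
  ((ι : ℤ) : ℂ) * (D.χTern s.tern (s.fst k k₁ (-k₁)) (s.snd k k₁ (-k₁)) (s.thd k k₁ (-k₁)) : ℂ) *
    D.q₃ η (ι * s.snd ι ι' (-ι')) (s.fst k k₁ (-k₁)) (s.snd k k₁ (-k₁)) (s.thd k k₁ (-k₁))

/-- The colour of the leaf at the end of the spine. -/
def _root_.ResonantKG.LowTree.endColour (T : LowTree) (η : Bool) (ι : ℤˣ) : Bool :=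
  (T.toSC η ι).leafColour (T.spine η ι)

/-- The contribution of a decorated tree, without the leaf at the end of the spine of the root. -/
def weight : (T : LowTree) → (η : Bool) → (ι : ℤˣ) → (k : D.Mom) → Par D.Mom T → ℂ
  | .leaf, _, _ => fun _ _ => 1
  | .node s ι' A₁ A₂ A₃, η, ι => fun k p =>
    ((D.L ^ d : ℝ) : ℂ)⁻¹ * (-Complex.I) * D.nodeFactor s η ι ι' k p.1 *
      D.pairCov s ι' (A₁.endColour η (s.fst ι ι' (-ι'))) (A₂.endColour (!η) (s.snd ι ι' (-ι')))
        (A₃.endColour η (s.thd ι ι' (-ι'))) p.1 *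
      (weight A₁ η (s.fst ι ι' (-ι')) (s.fst k p.1 (-p.1)) p.2.1 *
      (weight A₂ (!η) (s.snd ι ι' (-ι')) (s.snd k p.1 (-p.1)) p.2.2.1 *
      weight A₃ η (s.thd ι ι' (-ι')) (s.thd k p.1 (-p.1)) p.2.2.2))

/-- The product of the contributions of the leaves of a tree, the partner of the end of the spine
having colour `x`. -/
def leafProd (T : LowTree) (η : Bool) (ι : ℤˣ) (x : Bool) (κ : T.Lf η ι → D.Mom) : ℂ :=
  ∏ ℓ, D.leafFactor ((T.toSC η ι).leafSign ℓ) ((T.toSC η ι).leafColour ℓ)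
    (T.mate η ι (T.toSC η ι).leafColour x ℓ) (κ ℓ)

theorem mul_prod_eq {z N q₁ q₂ q₃ l₁ l₂ l₃ f₁ f₂ f₃ w₁ w₂ w₃ F C : ℂ} {a b c : ℕ}
    (h₁ : z ^ a * q₁ * l₁ = f₁ * w₁) (h₂ : z ^ b * q₂ * l₂ = f₂ * w₂)
    (h₃ : z ^ c * q₃ * l₃ = f₃ * w₃) (h : f₁ * (f₂ * f₃) = F * C) :
    z ^ (a + b + c + 1) * (N * (q₁ * (q₂ * q₃))) * (l₁ * (l₂ * l₃)) =
      F * (z * N * C * (w₁ * (w₂ * w₃))) := by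
  calc _ = z * N * ((z ^ a * q₁ * l₁) * (z ^ b * q₂ * l₂) * (z ^ c * q₃ * l₃)) := by ring
    _ = _ := by
      rw [h₁, h₂, h₃]
      linear_combination z * N * (w₁ * (w₂ * w₃)) * h

variable {D} in
-- Regrouping of the product over nodes and leaves: at each node the factors of the two marked spine
-- ends merge into a covariance, and only the factor of the root spine end survives, to be paired
-- with the other tree.
theorem Standing.prod_eq_weight (hD : D.Standing) (T : LowTree) : ∀ (η : Bool) (ι : ℤˣ) (x : Bool)
    (k : D.Mom) (p : Par D.Mom T),
    (((D.L ^ d : ℝ) : ℂ)⁻¹ * (-Complex.I)) ^ T.card * (∏ j, D.qNode (T.toSC η ι) (T.kap η ι k p) j)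
      * D.leafProd T η ι x (T.kap η ι k p) =
    D.leafFactor ι (T.endColour η ι) x k * D.weight T η ι k p := by
  induction T with
  | leaf =>
    intro η ι x k p
    have h₁ : (∏ j, D.qNode (leaf.toSC η ι) (leaf.kap η ι k p) j) = 1 :=
      Finset.prod_empty
    have h₂ : D.leafProd leaf η ι x (leaf.kap η ι k p) = D.leafFactor ι (leaf.endColour η ι) x k :=
      Finset.prod_singleton _ _
    rw [h₁, h₂]
    simp [card, weight]
  | node s ι' A₁ A₂ A₃ h₁ h₂ h₃ =>
    intro η ι x k p
    have hq : (∏ j, D.qNode ((node s ι' A₁ A₂ A₃).toSC η ι) ((node s ι' A₁ A₂ A₃).kap η ι k p) j)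
      = D.nodeFactor s η ι ι' k p.1 *
        ((∏ j, D.qNode (A₁.toSC η (s.fst ι ι' (-ι'))) (A₁.kap η _ (s.fst k p.1 (-p.1)) p.2.1) j) *
        ((∏ j, D.qNode (A₂.toSC (!η) (s.snd ι ι' (-ι')))
          (A₂.kap (!η) _ (s.snd k p.1 (-p.1)) p.2.2.1) j) *
        ∏ j, D.qNode (A₃.toSC η (s.thd ι ι' (-ι'))) (A₃.kap η _ (s.thd k p.1 (-p.1)) p.2.2.2) j))
        := by
      refine (SCTree.prod_node_tern _ _ _ _ _ _).trans (congr_arg₂ _ ?_ rfl)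
      -- The momenta and the middle sign are made variables, because `qNode` expresses them through
      -- leaf sums and root signs, which still have to be identified with the labels of the
      -- children.
      have key : ∀ (a b c : Freq d) (ι₂ : ℤˣ), a = s.fst (k : Freq d) p.1 (-p.1) →
          b = s.snd (k : Freq d) p.1 (-p.1) → c = s.thd (k : Freq d) p.1 (-p.1) →
          ι₂ = s.snd ι ι' (-ι') →
          ((ι : ℤ) : ℂ) * (D.χTern s.tern a b c : ℂ) * D.q₃ η (ι * ι₂) a b c
            = D.nodeFactor s η ι ι' k p.1 := by
        rintro _ _ _ _ rfl rfl rfl rfl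
        rfl
      refine key _ _ _ _ ?_ ?_ ?_ (rootSign_toSC _ _ _)
      · refine (congrArg Subtype.val (A₁.rootMom_kap _ _ _ p.2.1)).trans ?_
        cases s <;> rfl
      · refine (congrArg Subtype.val (A₂.rootMom_kap _ _ _ p.2.2.1)).trans ?_
        cases s <;> rfl
      · refine (congrArg Subtype.val (A₃.rootMom_kap _ _ _ p.2.2.2)).trans ?_
        cases s <;> rfl
    have hl : D.leafProd (node s ι' A₁ A₂ A₃) η ι x ((node s ι' A₁ A₂ A₃).kap η ι k p)
      = D.leafProd A₁ η (s.fst ι ι' (-ι')) (s.mateFst x (A₁.endColour η (s.fst ι ι' (-ι')))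
          (A₂.endColour (!η) (s.snd ι ι' (-ι'))) (A₃.endColour η (s.thd ι ι' (-ι'))))
          (A₁.kap η _ (s.fst k p.1 (-p.1)) p.2.1) *
        (D.leafProd A₂ (!η) (s.snd ι ι' (-ι')) (s.mateSnd x (A₁.endColour η (s.fst ι ι' (-ι')))
          (A₂.endColour (!η) (s.snd ι ι' (-ι'))) (A₃.endColour η (s.thd ι ι' (-ι'))))
          (A₂.kap (!η) _ (s.snd k p.1 (-p.1)) p.2.2.1) *
        D.leafProd A₃ η (s.thd ι ι' (-ι')) (s.mateThd x (A₁.endColour η (s.fst ι ι' (-ι')))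
          (A₂.endColour (!η) (s.snd ι ι' (-ι'))) (A₃.endColour η (s.thd ι ι' (-ι'))))
          (A₃.kap η _ (s.thd k p.1 (-p.1)) p.2.2.2)) :=
      SCTree.prod_leaf_tern _ _ _ _ _ _
    rw [hq, hl]
    have k₁ := h₁ η (s.fst ι ι' (-ι')) (s.mateFst x (A₁.endColour η (s.fst ι ι' (-ι')))
          (A₂.endColour (!η) (s.snd ι ι' (-ι'))) (A₃.endColour η (s.thd ι ι' (-ι'))))
          (s.fst k p.1 (-p.1)) p.2.1
    have k₂ := h₂ (!η) (s.snd ι ι' (-ι')) (s.mateSnd x (A₁.endColour η (s.fst ι ι' (-ι')))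
          (A₂.endColour (!η) (s.snd ι ι' (-ι'))) (A₃.endColour η (s.thd ι ι' (-ι'))))
          (s.snd k p.1 (-p.1)) p.2.2.1
    have k₃ := h₃ η (s.thd ι ι' (-ι')) (s.mateThd x (A₁.endColour η (s.fst ι ι' (-ι')))
          (A₂.endColour (!η) (s.snd ι ι' (-ι'))) (A₃.endColour η (s.thd ι ι' (-ι'))))
          (s.thd k p.1 (-p.1)) p.2.2.2
    -- Among the three spine ends below the node, that of the unmarked child is the spine end of the
    -- whole tree; the other two are partners.
    have hm : D.leafFactor (s.fst ι ι' (-ι')) (A₁.endColour η (s.fst ι ι' (-ι')))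
          (s.mateFst x (A₁.endColour η (s.fst ι ι' (-ι')))
          (A₂.endColour (!η) (s.snd ι ι' (-ι'))) (A₃.endColour η (s.thd ι ι' (-ι'))))
          (s.fst k p.1 (-p.1)) *
        (D.leafFactor (s.snd ι ι' (-ι')) (A₂.endColour (!η) (s.snd ι ι' (-ι')))
          (s.mateSnd x (A₁.endColour η (s.fst ι ι' (-ι')))
          (A₂.endColour (!η) (s.snd ι ι' (-ι'))) (A₃.endColour η (s.thd ι ι' (-ι'))))
          (s.snd k p.1 (-p.1)) *
        D.leafFactor (s.thd ι ι' (-ι')) (A₃.endColour η (s.thd ι ι' (-ι')))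
          (s.mateThd x (A₁.endColour η (s.fst ι ι' (-ι')))
          (A₂.endColour (!η) (s.snd ι ι' (-ι'))) (A₃.endColour η (s.thd ι ι' (-ι'))))
          (s.thd k p.1 (-p.1))) =
        D.leafFactor ι ((node s ι' A₁ A₂ A₃).endColour η ι) x k * D.pairCov s ι'
          (A₁.endColour η (s.fst ι ι' (-ι'))) (A₂.endColour (!η) (s.snd ι ι' (-ι')))
          (A₃.endColour η (s.thd ι ι' (-ι'))) p.1 := by
      cases s
      · simp only [LowKind.fst, LowKind.snd, LowKind.thd, LowKind.mateFst, LowKind.mateSnd,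
          LowKind.mateThd, pairCov, hD.leafFactor_mul]
        rfl
      · simp only [LowKind.fst, LowKind.snd, LowKind.thd, LowKind.mateFst, LowKind.mateSnd,
          LowKind.mateThd, pairCov, ← hD.leafFactor_mul]
        rw [mul_left_comm]
        rfl
      · simp only [LowKind.fst, LowKind.snd, LowKind.thd, LowKind.mateFst, LowKind.mateSnd,
          LowKind.mateThd, pairCov, ← hD.leafFactor_mul]
        rw [← mul_assoc, mul_comm]
        rfl
    exact mul_prod_eq k₁ k₂ k₃ hm

end KGData
end ResonantKG

/-! ### Volumes of the time domains -/

namespace ResonantKG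

open MeasureTheory

theorem volume_sum_pi {α β : Type} [Fintype α] [Fintype β] (a : Set (α → ℝ)) (b : Set (β → ℝ)) :
    volume {f : α ⊕ β → ℝ | (fun i => f (Sum.inl i)) ∈ a ∧ (fun i => f (Sum.inr i)) ∈ b} =
      volume a * volume b := by
  have h := (volume_measurePreserving_sumPiEquivProdPi fun _ : α ⊕ β => ℝ).measure_preimage_equiv
    (a ×ˢ b)
  rw [Measure.volume_eq_prod, Measure.prod_prod] at h
  exact h

theorem volume_unit_sum_pi {β : Type} [Fintype β] (S : Set (ℝ × (β → ℝ))) (hS : MeasurableSet S) :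
    volume {f : Unit ⊕ β → ℝ | (f (Sum.inl ()), fun i => f (Sum.inr i)) ∈ S} =
      ∫⁻ x, volume (Prod.mk x ⁻¹' S) := by
  have h := (volume_measurePreserving_sumPiEquivProdPi fun _ : Unit ⊕ β => ℝ).measure_preimage_equiv
    (Prod.map (MeasurableEquiv.funUnique Unit ℝ) id ⁻¹' S)
  have h' := ((volume_preserving_funUnique Unit ℝ).prod
    (MeasurePreserving.id (volume : Measure (β → ℝ)))).measure_preimage hS.nullMeasurableSet
  rw [Measure.prod_apply hS] at h'
  exact h.trans h'

namespace SCTree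

theorem isClosed_timeDomain {η : Bool} (A : SCTree η) :
    IsClosed {p : ℝ × (A.TNode → ℝ) | p.2 ∈ A.timeDomain p.1} := by
  have h₁ : IsClosed {p : ℝ × (A.TNode → ℝ) | ∀ j, p.2 j ∈ Set.Icc 0 p.1} := by
    simp only [Set.ofPred_forall, Set.mem_Icc, Set.ofPred_and]
    exact isClosed_iInter fun j => (isClosed_le (by fun_prop) (by fun_prop)).inter
      (isClosed_le (by fun_prop) (by fun_prop))
  have h₂ : IsClosed {p : ℝ × (A.TNode → ℝ) | ∀ j j', A.nodeLE j j' → p.2 j ≤ p.2 j'} := by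
    simp only [Set.ofPred_forall]
    exact isClosed_iInter fun j => isClosed_iInter fun j' => isClosed_iInter fun _ =>
      isClosed_le (by fun_prop) (by fun_prop)
  exact h₁.inter h₂

/-- The time of the root bounds all the others, and once it is fixed the three subtrees do not
constrain each other. -/
theorem mem_timeDomain_tern {η : Bool} (s : TernKind) (ι : ℤˣ) (A₁ : SCTree η) (A₂ : SCTree (!η))
    (A₃ : SCTree η) (t : ℝ) (f : (tern s ι A₁ A₂ A₃).TNode → ℝ) :
    f ∈ (tern s ι A₁ A₂ A₃).timeDomain t ↔ f (Sum.inl ()) ∈ Set.Icc 0 t ∧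
      (fun j => f (Sum.inr (Sum.inl j))) ∈ A₁.timeDomain (f (Sum.inl ())) ∧
      (fun j => f (Sum.inr (Sum.inr (Sum.inl j)))) ∈ A₂.timeDomain (f (Sum.inl ())) ∧
      (fun j => f (Sum.inr (Sum.inr (Sum.inr j)))) ∈ A₃.timeDomain (f (Sum.inl ())) := by
  constructor
  · rintro ⟨hI, hle⟩
    refine ⟨hI _, ⟨fun j => ⟨(hI _).1, hle _ (Sum.inl ()) trivial⟩, fun j j' h => ?_⟩,
      ⟨fun j => ⟨(hI _).1, hle _ (Sum.inl ()) trivial⟩, fun j j' h => ?_⟩,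
      ⟨fun j => ⟨(hI _).1, hle _ (Sum.inl ()) trivial⟩, fun j j' h => ?_⟩⟩
    · exact hle (Sum.inr (Sum.inl j)) (Sum.inr (Sum.inl j')) h
    · exact hle (Sum.inr (Sum.inr (Sum.inl j))) (Sum.inr (Sum.inr (Sum.inl j'))) h
    · exact hle (Sum.inr (Sum.inr (Sum.inr j))) (Sum.inr (Sum.inr (Sum.inr j'))) h
  · rintro ⟨h₀, ⟨h₁, l₁⟩, ⟨h₂, l₂⟩, ⟨h₃, l₃⟩⟩
    refine ⟨?_, ?_⟩
    · rintro (j | j | j | j)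
      · exact h₀
      · exact ⟨(h₁ j).1, (h₁ j).2.trans h₀.2⟩
      · exact ⟨(h₂ j).1, (h₂ j).2.trans h₀.2⟩
      · exact ⟨(h₃ j).1, (h₃ j).2.trans h₀.2⟩
    · rintro (j | j | j | j) (j' | j' | j' | j') h
      · exact le_rfl
      · exact h.elim
      · exact h.elim
      · exact h.elim
      · exact (h₁ j).2
      · exact l₁ j j' h
      · exact h.elim
      · exact h.elim
      · exact (h₂ j).2
      · exact h.elim
      · exact l₂ j j' h
      · exact h.elim
      · exact (h₃ j).2
      · exact h.elim
      · exact h.elim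
      · exact l₃ j j' h

/-- Tonelli with the root time as outer variable; closedness of the time domains, jointly in the
final time, provides measurability. -/
theorem volume_timeDomain_tern {η : Bool} (s : TernKind) (ι : ℤˣ) (A₁ : SCTree η)
    (A₂ : SCTree (!η)) (A₃ : SCTree η) (t : ℝ) :
    volume ((tern s ι A₁ A₂ A₃).timeDomain t) = ∫⁻ x in Set.Icc 0 t,
      volume (A₁.timeDomain x) * (volume (A₂.timeDomain x) * volume (A₃.timeDomain x)) := by
  let S : Set (ℝ × (A₁.TNode ⊕ (A₂.TNode ⊕ A₃.TNode) → ℝ)) :=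
    {p | p.1 ∈ Set.Icc 0 t ∧ (fun j => p.2 (Sum.inl j)) ∈ A₁.timeDomain p.1 ∧
      (fun j => p.2 (Sum.inr (Sum.inl j))) ∈ A₂.timeDomain p.1 ∧
      (fun j => p.2 (Sum.inr (Sum.inr j))) ∈ A₃.timeDomain p.1}
  have hS : MeasurableSet S := by
    refine IsClosed.measurableSet ?_
    refine (isClosed_Icc.preimage continuous_fst).inter ?_
    refine (A₁.isClosed_timeDomain.preimage (f := fun p : ℝ × (A₁.TNode ⊕ (A₂.TNode ⊕ A₃.TNode) → ℝ)
      => (p.1, fun j => p.2 (Sum.inl j))) (by fun_prop)).inter ?_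
    exact (A₂.isClosed_timeDomain.preimage (f := fun p : ℝ × (A₁.TNode ⊕ (A₂.TNode ⊕ A₃.TNode) → ℝ)
      => (p.1, fun j => p.2 (Sum.inr (Sum.inl j)))) (by fun_prop)).inter
      (A₃.isClosed_timeDomain.preimage (f := fun p : ℝ × (A₁.TNode ⊕ (A₂.TNode ⊕ A₃.TNode) → ℝ)
      => (p.1, fun j => p.2 (Sum.inr (Sum.inr j)))) (by fun_prop))
  have h := volume_unit_sum_pi S hS
  have e : (tern s ι A₁ A₂ A₃).timeDomain t = 
    {f : Unit ⊕ (A₁.TNode ⊕ (A₂.TNode ⊕ A₃.TNode)) → ℝ |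
      (f (Sum.inl ()), fun i => f (Sum.inr i)) ∈ S} :=
    Set.ext fun f => mem_timeDomain_tern s ι A₁ A₂ A₃ t f
  refine (congrArg (volume : Measure (Unit ⊕ (A₁.TNode ⊕ (A₂.TNode ⊕ A₃.TNode)) → ℝ)) e).trans
    (h.trans ?_)
  rw [← lintegral_indicator measurableSet_Icc]
  refine lintegral_congr fun x => ?_
  by_cases hx : x ∈ Set.Icc 0 t
  · rw [Set.indicator_of_mem hx, ← volume_sum_pi, ← volume_sum_pi]
    congr 1
    ext f
    exact ⟨fun h => h.2, fun h => ⟨hx, h⟩⟩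
  · rw [Set.indicator_of_notMem hx]
    convert measure_empty (μ := volume) using 2
    ext f
    exact ⟨fun h => hx h.1, fun h => h.elim⟩

end SCTree

namespace LowTree

/-- The volume of the time domain. -/
def vol : LowTree → ℝ → ℝ
  | .leaf, _ => 1
  | .node _ _ A₁ A₂ A₃, t => ∫ τ in (0 : ℝ)..t, A₁.vol τ * (A₂.vol τ * A₃.vol τ)

theorem continuous_vol (T : LowTree) : Continuous T.vol := by
  induction T with
  | leaf => exact continuous_const
  | node s ι A₁ A₂ A₃ h₁ h₂ h₃ =>
    exact intervalIntegral.continuous_primitive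
      (fun a b => (h₁.mul (h₂.mul h₃)).intervalIntegrable a b) 0

theorem hasDerivAt_vol (s : LowKind) (ι : ℤˣ) (A₁ A₂ A₃ : LowTree) (t : ℝ) :
    HasDerivAt (node s ι A₁ A₂ A₃).vol (A₁.vol t * (A₂.vol t * A₃.vol t)) t :=
  (A₁.continuous_vol.mul (A₂.continuous_vol.mul A₃.continuous_vol)).integral_hasStrictDerivAt 0 t
    |>.hasDerivAt

theorem vol_nonneg (T : LowTree) : ∀ {t : ℝ}, 0 ≤ t → 0 ≤ T.vol t := by
  induction T with
  | leaf => exact fun _ => zero_le_one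
  | node s ι A₁ A₂ A₃ h₁ h₂ h₃ =>
    exact fun ht => intervalIntegral.integral_nonneg ht fun u hu =>
      mul_nonneg (h₁ hu.1) (mul_nonneg (h₂ hu.1) (h₃ hu.1))

/-- Only for t ≥ 0 is `vol` the volume. Being an iterated primitive it is nevertheless
differentiable on all of ℝ, so that no one-sided derivatives at 0 are needed later. -/
theorem volume_timeDomain (T : LowTree) : ∀ (η : Bool) (ι : ℤˣ) {t : ℝ}, 0 ≤ t →
    volume ((T.toSC η ι).timeDomain t) = ENNReal.ofReal (T.vol t) := by
  induction T with
  | leaf =>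
    intro η ι t _
    have h : (leaf.toSC η ι).timeDomain t = Set.univ :=
      Set.eq_univ_of_forall fun f => ⟨fun j => j.elim, fun j => j.elim⟩
    have h' : volume (Set.univ : Set (Empty → ℝ)) = 1 := by simp [volume_pi]
    rw [h]
    exact h'.trans ENNReal.ofReal_one.symm
  | node s ι' A₁ A₂ A₃ h₁ h₂ h₃ =>
    intro η ι t ht
    refine (SCTree.volume_timeDomain_tern _ _ _ _ _ _).trans ?_
    have hc := A₁.continuous_vol.mul (A₂.continuous_vol.mul A₃.continuous_vol)
    rw [vol, intervalIntegral.integral_of_le ht, ← integral_Icc_eq_integral_Ioc,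
      ofReal_integral_eq_lintegral_ofReal]
    · refine setLIntegral_congr_fun measurableSet_Icc fun x hx => ?_
      rw [h₁ _ _ hx.1, h₂ _ _ hx.1, h₃ _ _ hx.1, ENNReal.ofReal_mul (A₁.vol_nonneg hx.1),
        ENNReal.ofReal_mul (A₂.vol_nonneg hx.1)]
    · exact hc.continuousOn.integrableOn_compact isCompact_Icc
    · exact (ae_restrict_iff' measurableSet_Icc).2 <| .of_forall fun x hx =>
        mul_nonneg (A₁.vol_nonneg hx.1) (mul_nonneg (A₂.vol_nonneg hx.1) (A₃.vol_nonneg hx.1))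

end LowTree
end ResonantKG

/-! ### Finiteness of the sums, and factorisation of the contribution of a coupling -/

namespace ResonantKG

open MeasureTheory LowTree

theorem finite_lattice_norm_le {d : ℕ} {L : ℝ} (hL : 0 < L) (R : ℝ) :
    {k : lattice L d | ‖(k : Freq d)‖ ≤ R}.Finite := by
  refine Set.Finite.of_finite_image (f := Subtype.val) ?_ Subtype.val_injective.injOn
  refine ((Set.finite_Icc (fun _ : Fin d => -⌈R * L⌉) (fun _ => ⌈R * L⌉)).image
    fun z => (WithLp.toLp 2 fun i => (z i : ℝ) / L : Freq d)).subset ?_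
  rintro _ ⟨⟨k, hk⟩, hR, rfl⟩
  choose z hz using show ∀ i, ∃ z : ℤ, k i = (z : ℝ) / L from hk
  refine ⟨z, ?_, ?_⟩
  · have hb : ∀ i, |(z i : ℝ)| ≤ ⌈R * L⌉ := by
      intro i
      have h := (PiLp.norm_apply_le k i).trans hR
      rw [hz, Real.norm_eq_abs, abs_div, abs_of_pos hL, div_le_iff₀ hL] at h
      exact h.trans (Int.le_ceil _)
    exact ⟨fun i => by exact_mod_cast (abs_le.1 (hb i)).1,
      fun i => by exact_mod_cast (abs_le.1 (hb i)).2⟩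
  · ext i
    exact (hz i).symm

theorem SCTree.map_rootMom {G H : Type} [AddCommGroup G] [AddCommGroup H] (f : G →+ H) {η : Bool}
    (A : SCTree η) : ∀ κ : A.Leaf → G, f (A.rootMom κ) = A.rootMom fun ℓ => f (κ ℓ) := by
  induction A with
  | leaf => intro κ; rfl
  | binIn => intro κ; exact map_add f _ _
  | binSt ι A₁ A₂ h₁ h₂ =>
    intro κ
    exact (map_add f _ _).trans (congr_arg₂ _ (h₁ _) (h₂ _))
  | tern s ι A₁ A₂ A₃ h₁ h₂ h₃ =>
    intro κ
    exact (map_add f _ _).trans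
      (congr_arg₂ _ ((map_add f _ _).trans (congr_arg₂ _ (h₁ _) (h₂ _))) (h₃ _))

namespace KGData

variable {d : ℕ} {D : KGData d}

/-- The lattice points of a ball outside which all covariances vanish. Symmetry under k ↦ -k is
needed because negative leaves evaluate `M` at the opposite momentum. -/
theorem Standing.exists_finset (hD : D.Standing) : ∃ S : Finset D.Mom, (∀ k ∈ S, -k ∈ S) ∧
    ∀ k : D.Mom, k ∉ S → ∀ c c', D.M c c' k = 0 := by
  obtain ⟨R, _, hM⟩ := hD.M_supp
  refine ⟨(finite_lattice_norm_le hD.L_pos R).toFinset, fun k hk => ?_, fun k hk c c' => ?_⟩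
  · simpa using hk
  · exact hM _ _ _ (by simpa using hk)

/-- The covariances confine the momenta of the negative leaves; a positive leaf carries the opposite
of the momentum of a negative one. -/
theorem mem_of_summand_ne_zero {η₁ η₂ : Bool} {C : Coupling η₁ η₂} {t : ℝ}
    {S : Finset D.Mom} (hS : ∀ k ∈ S, -k ∈ S) (hM : ∀ k : D.Mom, k ∉ S → ∀ c c', D.M c c' k = 0)
    {κ : C.Leaf → D.Mom} (hκ : ∀ ℓ, κ ℓ + κ (C.σ ℓ) = 0) (h : D.summand C t κ ≠ 0) (ℓ : C.Leaf) :
    κ ℓ ∈ S := by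
  have neg : ∀ ℓ, C.sign ℓ = -1 → κ ℓ ∈ S := by
    intro ℓ hℓ
    have h' := (Finset.prod_ne_zero_iff.1 (right_ne_zero_of_mul h)) ℓ (by simp [hℓ])
    by_contra hn
    refine h' ?_
    have : -κ ℓ ∉ S := fun h => hn (by simpa using hS _ h)
    simpa [hℓ, conjSign] using hM _ this (C.colour ℓ) (C.colour (C.σ ℓ))
  rcases Int.units_eq_one_or (C.sign ℓ) with hℓ | hℓ
  · have := hS _ (neg (C.σ ℓ) ((C.sign_σ ℓ).trans (congrArg Neg.neg hℓ)))
    rwa [← eq_neg_of_add_eq_zero_left (hκ ℓ)] at this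
  · exact neg ℓ hℓ

theorem Standing.finite_support_summand (hD : D.Standing) {η₁ η₂ : Bool} (C : Coupling η₁ η₂)
    (t : ℝ) (k : D.Mom) :
    (Function.support fun κ : D.Decoration C k => D.summand C t κ.1).Finite := by
  obtain ⟨S, hS, hM⟩ := hD.exists_finset
  refine ((Set.Finite.pi' fun _ : C.Leaf => S.finite_toSet).preimage
    (f := (Subtype.val : D.Decoration C k → _)) Subtype.val_injective.injOn).subset ?_
  exact fun κ h ℓ => mem_of_summand_ne_zero hS hM κ.2.1 h ℓ

theorem Standing.finite_support_F (hD : D.Standing) {η₁ η₂ : Bool} (C : Coupling η₁ η₂) (t : ℝ) :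
    (Function.support (D.F C t)).Finite := by
  obtain ⟨S, hS, hM⟩ := hD.exists_finset
  refine ((Set.Finite.pi' fun _ : C.Leaf => S.finite_toSet).image
    fun κ => C.left.rootMom fun ℓ => κ (Sum.inl ℓ)).subset fun k hk => ?_
  obtain ⟨κ, hκ⟩ : ∃ κ : D.Decoration C k, D.summand C t κ.1 ≠ 0 := by
    by_contra! h
    exact hk (by simp [F, h])
  exact ⟨κ.1, fun ℓ => mem_of_summand_ne_zero hS hM κ.2.1 hκ ℓ, κ.2.2⟩

theorem Standing.finite_support_Xres (hD : D.Standing) (n : ℕ) (ι : ℤˣ) (η η' : Bool) (t : ℝ) :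
    (Function.support (D.Xres n ι η η' t)).Finite := by
  refine ((finite_Res n ι (-ι) η η').toFinset.finite_toSet.biUnion
    fun C _ => hD.finite_support_F C t).subset fun k hk => ?_
  obtain ⟨C, hC, h⟩ := Finset.exists_ne_zero_of_sum_ne_zero hk
  exact Set.mem_biUnion hC h

theorem pairCov_eq_zero {S : Finset D.Mom} (hS : ∀ k ∈ S, -k ∈ S)
    (hM : ∀ k : D.Mom, k ∉ S → ∀ c c', D.M c c' k = 0) (s : LowKind) (ι : ℤˣ) (c₁ c₂ c₃ : Bool)
    {k : D.Mom} (hk : k ∉ S) : D.pairCov s ι c₁ c₂ c₃ k = 0 := by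
  have h : ∀ c c', D.cov ι c c' k = 0 := by
    intro c c'
    have : -k ∉ S := fun h => hk (by simpa using hS _ h)
    unfold cov
    split_ifs
    exacts [hM _ hk _ _, hM _ this _ _]
  cases s <;> exact h _ _

/-- The covariance attached to each node confines its free momentum to `S`. -/
theorem finite_support_weight {S : Finset D.Mom} (hS : ∀ k ∈ S, -k ∈ S)
    (hM : ∀ k : D.Mom, k ∉ S → ∀ c c', D.M c c' k = 0) (T : LowTree) :
    ∀ (η : Bool) (ι : ℤˣ) (k : D.Mom), (Function.support (D.weight T η ι k)).Finite := by
  induction T with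
  | leaf => exact fun _ _ _ => (Set.finite_univ (α := Unit)).subset (Set.subset_univ _)
  | node s ι' A₁ A₂ A₃ h₁ h₂ h₃ =>
    intro η ι k
    refine (S.finite_toSet.biUnion fun k₁ _ =>
      ((h₁ η (s.fst ι ι' (-ι')) (s.fst k k₁ (-k₁))).prod
      ((h₂ (!η) (s.snd ι ι' (-ι')) (s.snd k k₁ (-k₁))).prod
      (h₃ η (s.thd ι ι' (-ι')) (s.thd k k₁ (-k₁))))).image (Prod.mk k₁)).subset ?_
    rintro ⟨k₁, p₁, p₂, p₃⟩ hp
    have hp' := mul_ne_zero_iff.1 hp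
    have hp'' := mul_ne_zero_iff.1 hp'.2
    have hp₃ := mul_ne_zero_iff.1 hp''.2
    refine Set.mem_biUnion (x := k₁) ?_ ⟨(p₁, p₂, p₃), ⟨hp''.1, hp₃.1, hp₃.2⟩, rfl⟩
    by_contra hk₁
    exact right_ne_zero_of_mul hp'.1 (pairCov_eq_zero hS hM _ _ _ _ _ hk₁)

variable (D) in
/-- The contribution of a tree, summed over its decorations with value `k` at the root, without
the leaf at the end of the spine of the root and without the time integral. -/
def amp (T : LowTree) (η : Bool) (ι : ℤˣ) (k : D.Mom) : ℂ := ∑' p, D.weight T η ι k p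

theorem amp_leaf (η : Bool) (ι : ℤˣ) (k : D.Mom) : D.amp .leaf η ι k = 1 := by
  show ∑' _ : Unit, (1 : ℂ) = 1
  simp

theorem tsum_mul_tsum_of_finite_support {α β : Type} {f : α → ℂ} {g : β → ℂ}
    (hf : (Function.support f).Finite) (hg : (Function.support g).Finite) :
    ∑' z : α × β, f z.1 * g z.2 = (∑' x, f x) * ∑' y, g y := by
  refine (tsum_mul_tsum_of_summable_norm ?_ ?_).symm
  · exact (summable_of_hasFiniteSupport hf).norm
  · exact (summable_of_hasFiniteSupport hg).norm

theorem amp_node {S : Finset D.Mom} (hS : ∀ k ∈ S, -k ∈ S)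
    (hM : ∀ k : D.Mom, k ∉ S → ∀ c c', D.M c c' k = 0) (s : LowKind) (ι' : ℤˣ)
    (A₁ A₂ A₃ : LowTree) (η : Bool) (ι : ℤˣ) (k : D.Mom) :
    D.amp (.node s ι' A₁ A₂ A₃) η ι k = ∑ k₁ ∈ S,
      ((D.L ^ d : ℝ) : ℂ)⁻¹ * (-Complex.I) * D.nodeFactor s η ι ι' k k₁ *
      D.pairCov s ι' (A₁.endColour η (s.fst ι ι' (-ι'))) (A₂.endColour (!η) (s.snd ι ι' (-ι')))
        (A₃.endColour η (s.thd ι ι' (-ι'))) k₁ *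
      (D.amp A₁ η (s.fst ι ι' (-ι')) (s.fst k k₁ (-k₁)) *
      (D.amp A₂ (!η) (s.snd ι ι' (-ι')) (s.snd k k₁ (-k₁)) *
      D.amp A₃ η (s.thd ι ι' (-ι')) (s.thd k k₁ (-k₁)))) := by
  have hs : Summable (D.weight (.node s ι' A₁ A₂ A₃) η ι k) :=
    summable_of_hasFiniteSupport (finite_support_weight hS hM _ _ _ _)
  have h : D.amp (.node s ι' A₁ A₂ A₃) η ι k =
      ∑' (k₁ : D.Mom) (q : Par D.Mom A₁ × Par D.Mom A₂ × Par D.Mom A₃),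
        D.weight (.node s ι' A₁ A₂ A₃) η ι k (k₁, q) :=
    Summable.tsum_prod (β := D.Mom) (γ := Par D.Mom A₁ × Par D.Mom A₂ × Par D.Mom A₃) hs
  have w := fun A => finite_support_weight hS hM A
  rw [h]
  refine Eq.trans (tsum_congr fun k₁ => ?_) (tsum_eq_sum (s := S) fun k₁ hk₁ => ?_)
  · show ∑' q : Par D.Mom A₁ × Par D.Mom A₂ × Par D.Mom A₃,
      ((D.L ^ d : ℝ) : ℂ)⁻¹ * (-Complex.I) * D.nodeFactor s η ι ι' k k₁ *
      D.pairCov s ι' (A₁.endColour η (s.fst ι ι' (-ι'))) (A₂.endColour (!η) (s.snd ι ι' (-ι')))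
        (A₃.endColour η (s.thd ι ι' (-ι'))) k₁ *
      (D.weight A₁ η (s.fst ι ι' (-ι')) (s.fst k k₁ (-k₁)) q.1 *
      (D.weight A₂ (!η) (s.snd ι ι' (-ι')) (s.snd k k₁ (-k₁)) q.2.1 *
      D.weight A₃ η (s.thd ι ι' (-ι')) (s.thd k k₁ (-k₁)) q.2.2)) = _
    rw [tsum_mul_left]
    refine congrArg _ ?_
    refine (tsum_mul_tsum_of_finite_support (w A₁ _ _ _)
      (g := fun q : Par D.Mom A₂ × Par D.Mom A₃ =>
        D.weight A₂ (!η) (s.snd ι ι' (-ι')) (s.snd k k₁ (-k₁)) q.1 *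
          D.weight A₃ η (s.thd ι ι' (-ι')) (s.thd k k₁ (-k₁)) q.2) ?_).trans
      (congrArg _ (tsum_mul_tsum_of_finite_support (w A₂ _ _ _) (w A₃ _ _ _)))
    exact ((w A₂ _ _ _).prod (w A₃ _ _ _)).subset fun q hq => mul_ne_zero_iff.1 hq
  · simp [pairCov_eq_zero hS hM _ _ _ _ _ hk₁]

theorem ΩMinusOne_toSC (T : LowTree) (η : Bool) (ι : ℤˣ) (κ : T.Lf η ι → D.Mom) :
    D.ΩMinusOne (T.toSC η ι) κ = 0 := by
  cases T <;> rfl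

/-- The marked children have opposite momenta and opposite signs, hence their brackets cancel; the
unmarked child cancels the node. There are no binary corrections. -/
theorem Ω_kap (T : LowTree) : ∀ (η : Bool) (ι : ℤˣ) (k : D.Mom) (p : Par D.Mom T) (j),
    D.Ω (T.toSC η ι) (T.kap η ι k p) j = 0 := by
  induction T with
  | leaf => intros; rfl
  | node s ι' A₁ A₂ A₃ h₁ h₂ h₃ =>
    rintro η ι k p (j | j | j | j)
    · have key : ∀ (a b c : Freq d) (ι₁ ι₂ ι₃ : ℤˣ), a = s.fst (k : Freq d) p.1 (-p.1) →
          b = s.snd (k : Freq d) p.1 (-p.1) → c = s.thd (k : Freq d) p.1 (-p.1) →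
          ι₁ = s.fst ι ι' (-ι') → ι₂ = s.snd ι ι' (-ι') → ι₃ = s.thd ι ι' (-ι') →
          ∀ x y z : ℝ, x = 0 → y = 0 → z = 0 → D.Δ₃ ι ι₁ ι₂ ι₃ a b c + x + y + z = 0 := by
        rintro _ _ _ _ _ _ rfl rfl rfl rfl rfl rfl _ _ _ rfl rfl rfl
        cases s <;>
          simp [LowKind.fst, LowKind.snd, LowKind.thd, Δ₃, bracket]
      refine key _ _ _ _ _ _ ?_ ?_ ?_ (rootSign_toSC _ _ _) (rootSign_toSC _ _ _)
        (rootSign_toSC _ _ _) _ _ _ (ΩMinusOne_toSC _ _ _ _) (ΩMinusOne_toSC _ _ _ _)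
        (ΩMinusOne_toSC _ _ _ _)
      · refine (SCTree.map_rootMom (lattice D.L d).subtype _ _).symm.trans
          ((congrArg Subtype.val (A₁.rootMom_kap _ _ _ p.2.1)).trans ?_)
        cases s <;> rfl
      · refine (SCTree.map_rootMom (lattice D.L d).subtype _ _).symm.trans
          ((congrArg Subtype.val (A₂.rootMom_kap _ _ _ p.2.2.1)).trans ?_)
        cases s <;> rfl
      · refine (SCTree.map_rootMom (lattice D.L d).subtype _ _).symm.trans
          ((congrArg Subtype.val (A₃.rootMom_kap _ _ _ p.2.2.2)).trans ?_)
        cases s <;> rfl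
    · exact h₁ _ _ _ _ j
    · exact h₂ _ _ _ _ j
    · exact h₃ _ _ _ _ j

theorem volume_timeDomain_toCoupling (T T' : LowTree) (η η' : Bool) (ι : ℤˣ) {t : ℝ} (ht : 0 ≤ t) :
    (volume ((T.toCoupling T' η η' ι).timeDomain t)).toReal = T.vol t * T'.vol t := by
  have h : volume ((T.toCoupling T' η η' ι).timeDomain t) =
      volume ((T.toSC η ι).timeDomain t) * volume ((T'.toSC η' (-ι)).timeDomain t) :=
    volume_sum_pi _ _
  rw [h, T.volume_timeDomain η ι ht, T'.volume_timeDomain η' (-ι) ht, ENNReal.toReal_mul,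
    ENNReal.toReal_ofReal (T.vol_nonneg ht), ENNReal.toReal_ofReal (T'.vol_nonneg ht)]

theorem summand_toCoupling (T T' : LowTree) (η η' : Bool) (ι : ℤˣ) {t : ℝ} (ht : 0 ≤ t) (k : D.Mom)
    (p : Par D.Mom T × Par D.Mom T') :
    D.summand (T.toCoupling T' η η' ι) t (D.decorationEquiv T T' η η' ι k p).1 =
      (T.vol t * T'.vol t : ℝ) *
      (((∏ j, D.qNode (T.toSC η ι) (T.kap η ι k p.1) j)
        * D.leafProd T η ι (T'.endColour η' (-ι)) (T.kap η ι k p.1)) *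
      ((∏ j, D.qNode (T'.toSC η' (-ι)) (T'.kap η' (-ι) (-k) p.2) j)
        * D.leafProd T' η' (-ι) (T.endColour η ι) (T'.kap η' (-ι) (-k) p.2))) := by
  set C := T.toCoupling T' η η' ι
  set κ : C.Leaf → D.Mom := (D.decorationEquiv T T' η η' ι k p).1
  have h₁ : D.ΩMinusOneC C κ = 0 :=
    congr_arg₂ (· + ·) (ΩMinusOne_toSC _ _ _ _) (ΩMinusOne_toSC _ _ _ _) |>.trans (add_zero 0)
  have h₂ : ∀ j, D.ΩC C κ j = 0 := by
    rintro (j | j)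
    · exact Ω_kap T η ι k p.1 j
    · exact Ω_kap T' η' (-ι) (-k) p.2 j
  have h₃ : (∏ j, D.qC C κ j) = (∏ j, D.qNode (T.toSC η ι) (T.kap η ι k p.1) j) *
      ∏ j, D.qNode (T'.toSC η' (-ι)) (T'.kap η' (-ι) (-k) p.2) j :=
    Fintype.prod_sum_type _
  have h₄ : (∏ ℓ with C.sign ℓ = -1, conjSign (C.sign ℓ)
        (D.M (C.colour ℓ) (C.colour (C.σ ℓ)) ((((C.sign ℓ : ℤˣ) : ℤ) • κ ℓ : D.Mom) : Freq d))) =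
      D.leafProd T η ι (T'.endColour η' (-ι)) (T.kap η ι k p.1) *
        D.leafProd T' η' (-ι) (T.endColour η ι) (T'.kap η' (-ι) (-k) p.2) := by
    rw [Finset.prod_filter]
    refine (Fintype.prod_sum_type _).trans (congr_arg₂ _ ?_ ?_)
    · refine Finset.prod_congr rfl fun ℓ _ => ?_
      have hc : C.colour (C.σ (Sum.inl ℓ)) =
          T.mate η ι (T.toSC η ι).leafColour (T'.endColour η' (-ι)) ℓ :=
        map_mate C.colour T η ι Sum.inl (Sum.inr (T'.spine η' (-ι))) ℓ
      rw [hc]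
      rfl
    · refine Finset.prod_congr rfl fun ℓ _ => ?_
      have hc : C.colour (C.σ (Sum.inr ℓ)) =
          T'.mate η' (-ι) (T'.toSC η' (-ι)).leafColour (T.endColour η ι) ℓ :=
        map_mate C.colour T' η' (-ι) Sum.inr (Sum.inl (T.spine η ι)) ℓ
      rw [hc]
      rfl
  have h₅ : (∫ s in C.timeDomain t,
        ∏ j, Complex.exp (Complex.I * ((D.ΩC C κ j * D.ε ^ (-2 : ℤ) * s j : ℝ) : ℂ))) =
      (T.vol t * T'.vol t : ℝ) := by
    simp only [h₂, zero_mul, Complex.ofReal_zero, mul_zero, Complex.exp_zero,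
      Finset.prod_const_one, integral_const, measureReal_restrict_apply_univ]
    rw [Measure.real, volume_timeDomain_toCoupling T T' η η' ι ht]
    simp
  rw [summand, h₁, h₃, h₄, h₅]
  simp only [mul_zero, zero_mul, Complex.ofReal_zero, Complex.exp_zero]
  ring

/-- Each ternary node counts 2 in the size, so the prefactor is exactly L^{-d}(-i) per node, as
included in `weight`; the two root spine ends supply the remaining covariance. -/
theorem Standing.F_toCoupling (hD : D.Standing) (T T' : LowTree) (η η' : Bool) (ι : ℤˣ) {t : ℝ}
    (ht : 0 ≤ t) (k : D.Mom) :
    D.F (T.toCoupling T' η η' ι) t k =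
      D.cov ι (T.endColour η ι) (T'.endColour η' (-ι)) k *
        ((T.vol t * D.amp T η ι k) * (T'.vol t * D.amp T' η' (-ι) (-k))) := by
  obtain ⟨S, hS, hM⟩ := hD.exists_finset
  have h₁ : Fintype.card (T.toCoupling T' η η' ι).TNode = T.card + T'.card := by
    have : Fintype.card ((T.toSC η ι).TNode ⊕ (T'.toSC η' (-ι)).TNode) = T.card + T'.card := by
      rw [Fintype.card_sum, card_tNode_toSC, card_tNode_toSC]
    exact this
  have h₂ : (T.toCoupling T' η η' ι).numBin = 0 :=
    congr_arg₂ (· + ·) (T.numBin_toSC _ _) (T'.numBin_toSC _ _)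
  have h₃ : (T.toCoupling T' η η' ι).size = 2 * (T.card + T'.card) :=
    (congr_arg₂ (· + ·) (T.size_toSC _ _) (T'.size_toSC _ _)).trans (mul_add _ _ _).symm
  have h₄ : D.L ^ (((2 * (T.card + T'.card) * d : ℕ) : ℝ) / 2) = (D.L ^ d) ^ (T.card + T'.card) := by
    rw [← pow_mul, ← Real.rpow_natCast]
    congr 1
    push_cast
    ring
  have h₅ : ∑' κ : D.Decoration (T.toCoupling T' η η' ι) k,
      D.summand (T.toCoupling T' η η' ι) t κ.1 = _ :=
    ((D.decorationEquiv T T' η η' ι k).tsum_eq _).symm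
  rw [F, h₁, h₂, h₃, h₄, h₅]
  simp only [summand_toCoupling T T' η η' ι ht]
  rw [← tsum_mul_left]
  have h₆ : D.cov ι (T.endColour η ι) (T'.endColour η' (-ι)) k *
        ((T.vol t * D.amp T η ι k) * (T'.vol t * D.amp T' η' (-ι) (-k))) =
      (D.cov ι (T.endColour η ι) (T'.endColour η' (-ι)) k * (T.vol t * T'.vol t)) *
        (D.amp T η ι k * D.amp T' η' (-ι) (-k)) := by ring
  rw [h₆, amp, amp, ← tsum_mul_tsum_of_finite_support (finite_support_weight hS hM T _ _ _)
    (finite_support_weight hS hM T' _ _ _), ← tsum_mul_left]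
  refine tsum_congr fun p => ?_
  have e := hD.prod_eq_weight T η ι (T'.endColour η' (-ι)) k p.1
  have e' := hD.prod_eq_weight T' η' (-ι) (T.endColour η ι) (-k) p.2
  have m := hD.leafFactor_mul ι (T.endColour η ι) (T'.endColour η' (-ι)) k
  push_cast at e e' ⊢
  rw [← m]
  have ee := congr_arg₂ (· * ·) e e'
  linear_combination (T.vol t * T'.vol t : ℂ) * ee

end KGData
end ResonantKG

/-! ### Symmetries of the node factors, and the hierarchy for the tree sums -/

namespace ResonantKG

open LowTree

namespace LowKind

/-- The colour of the left marked child of a node of colour `η`. -/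
def colourP : LowKind → Bool → Bool
  | .l, η => !η
  | .m, η => η
  | .r, η => η

/-- The colour of the right marked child of a node of colour `η`. -/
def colourQ : LowKind → Bool → Bool
  | .l, η => η
  | .m, η => η
  | .r, η => !η

theorem sum_eq {E : Type*} [AddCommMonoid E] (f : LowKind → E) :
    ∑ s, f s = f .l + (f .m + f .r) := by
  show Multiset.sum (Multiset.map f {LowKind.l, LowKind.m, LowKind.r}) = _
  simp

end LowKind

theorem sum_units_int {E : Type*} [AddCommMonoid E] (f : ℤˣ → E) : ∑ ι, f ι = f 1 + f (-1) := by
  have h : (Finset.univ : Finset ℤˣ) = {1, -1} := by decide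
  rw [h, Finset.sum_pair (by decide)]

namespace KGData

variable {d : ℕ} {D : KGData d}

theorem Standing.q₂_symm (hD : D.Standing) (η : Bool) (a b : Freq d) : D.q₂ η a b = D.q₂ η b a := by
  rw [q₂, q₂, hD.Q_symm, mul_right_comm]

theorem Standing.q₂_neg (hD : D.Standing) (η : Bool) (a b : Freq d) :
    D.q₂ η (-a) (-b) = starRingEnd ℂ (D.q₂ η a b) := by
  rw [q₂, q₂, hD.Q_conj, map_div₀, Complex.conj_ofReal]
  simp [bracket]

theorem Standing.q₂_neg_right (hD : D.Standing) (η : Bool) (a : Freq d) : D.q₂ η a (-a) = 0 := by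
  rw [q₂, hD.Q_zero, zero_div]

theorem Standing.q₃_symm (hD : D.Standing) (η : Bool) (ι : ℤˣ) (a b c : Freq d) :
    D.q₃ η ι a b c = D.q₃ η ι c b a := by
  rw [q₃, q₃, hD.q₂_symm (!η) a c, add_comm a c, add_right_comm a b c, add_right_comm c b a,
    add_comm a c]

theorem Standing.q₃_neg (hD : D.Standing) (η : Bool) (ι : ℤˣ) (a b c : Freq d) :
    D.q₃ η ι (-a) (-b) (-c) = starRingEnd ℂ (D.q₃ η ι a b c) := by
  simp only [q₃, map_mul, Complex.conj_ofReal, ← hD.q₂_neg, bracket, ← neg_add, norm_neg,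
    inner_neg_neg]

theorem cut_neg (k : Freq d) : D.cut (-k) = D.cut k := by
  rw [cut, cut, norm_neg]

theorem χLowR_neg (k k₁ : Freq d) : D.χLowR k₁ (-k₁) (-k) = D.χLowR k₁ (-k₁) k := by
  have h : k₁ + -k = -(-k₁ + k) := by abel
  have h' : -k₁ + -k = -(k₁ + k) := by abel
  rw [χLowR, χLowR, h, h', cut_neg, cut_neg]
  ring

theorem χLowR_swap (k k₁ : Freq d) : D.χLowR (-k₁) k₁ k = D.χLowR k₁ (-k₁) k := by
  rw [χLowR, χLowR, add_comm (-k₁) k₁]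
  ring

/-- The outer children carry k₁ and -k₁, and `q₃` contains the factor `q₂` at its outer arguments,
which vanishes on opposite momenta. -/
theorem Standing.nodeFactor_m (hD : D.Standing) (η : Bool) (ι ι' : ℤˣ) (k k₁ : Freq d) :
    D.nodeFactor .m η ι ι' k k₁ = 0 := by
  simp [nodeFactor, LowKind.fst, LowKind.snd, LowKind.thd, q₃, hD.q₂_neg_right]

theorem nodeFactor_r (η : Bool) (ι ι' : ℤˣ) (k k₁ : Freq d) :
    D.nodeFactor .r η ι ι' k k₁ =
      ((ι : ℤ) : ℂ) * (D.χLowR k₁ (-k₁) k : ℂ) * D.q₃ η (ι * -ι') k₁ (-k₁) k :=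
  rfl

/-- Reflecting a low-l node in its middle child gives a low-r node, with the two marked children in
reverse order; `q₃` is symmetric in its outer arguments. -/
theorem Standing.nodeFactor_l (hD : D.Standing) (η : Bool) (ι ι' : ℤˣ) (k k₁ : Freq d) :
    D.nodeFactor .l η ι (-ι') k (-k₁) = D.nodeFactor .r η ι ι' k k₁ := by
  rw [nodeFactor_r, nodeFactor]
  simp only [LowKind.fst, LowKind.snd, LowKind.thd, LowKind.tern, χTern, neg_neg]
  have h : D.χLowL k (-k₁) k₁ = D.χLowR k₁ (-k₁) k := by
    rw [χLowL, χLowR, add_comm (-k₁) k₁]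
    ring
  rw [h, hD.q₃_symm]

theorem cov_swap (ι : ℤˣ) (c c' : Bool) (k : Freq d) :
    D.cov (-ι) c' c (-k) = D.cov ι c c' k := by
  have ne : (-1 : ℤˣ) ≠ 1 := by decide
  rcases Int.units_eq_one_or ι with rfl | rfl <;> simp [cov, ne]

theorem cov_eq_zero {S : Finset D.Mom} (hS : ∀ k ∈ S, -k ∈ S)
    (hM : ∀ k : D.Mom, k ∉ S → ∀ c c', D.M c c' k = 0) (ι : ℤˣ) (c c' : Bool)
    {k : D.Mom} (hk : k ∉ S) : D.cov ι c c' k = 0 :=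
  pairCov_eq_zero hS hM .r ι c c' false hk

/-- The colour changes along a spine only through a middle child, that is at a low-m node, and such
a node annihilates the amplitude. -/
theorem Standing.amp_eq_zero_or (hD : D.Standing) (T : LowTree) : ∀ (η : Bool) (ι : ℤˣ),
    (∀ k, D.amp T η ι k = 0) ∨ T.endColour η ι = η := by
  obtain ⟨S, hS, hM⟩ := hD.exists_finset
  induction T with
  | leaf => exact fun _ _ => Or.inr rfl
  | node s ι' A₁ A₂ A₃ h₁ h₂ h₃ =>
    intro η ι
    cases s with
    | l =>
      refine (h₁ η ι).imp_left fun h k => ?_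
      rw [amp_node hS hM]
      exact Finset.sum_eq_zero fun k₁ _ => by simp [LowKind.fst, h]
    | m =>
      refine Or.inl fun k => ?_
      rw [amp_node hS hM]
      exact Finset.sum_eq_zero fun k₁ _ => by simp [hD.nodeFactor_m]
    | r =>
      refine (h₃ η ι).imp_left fun h k => ?_
      rw [amp_node hS hM]
      exact Finset.sum_eq_zero fun k₁ _ => by simp [LowKind.thd, h]

/-- By `Standing.amp_eq_zero_or`, spine-end colours may be replaced by root colours. The covariance
then no longer depends on the trees and can be taken out of the sums over them. -/
theorem Standing.cov_mul_amp (hD : D.Standing) (T T' : LowTree) (η η' : Bool) (ι ι₁ ι₂ : ℤˣ)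
    (k : Freq d) (k₁ k₂ : D.Mom) :
    D.cov ι (T.endColour η ι₁) (T'.endColour η' ι₂) k * (D.amp T η ι₁ k₁ * D.amp T' η' ι₂ k₂) =
      D.cov ι η η' k * (D.amp T η ι₁ k₁ * D.amp T' η' ι₂ k₂) := by
  rcases hD.amp_eq_zero_or T η ι₁ with h | h
  · simp [h]
  rcases hD.amp_eq_zero_or T' η' ι₂ with h' | h'
  · simp [h']
  rw [h, h']

theorem Standing.amp_graft (hD : D.Standing) {S : Finset D.Mom} (hS : ∀ k ∈ S, -k ∈ S)
    (hM : ∀ k : D.Mom, k ∉ S → ∀ c c', D.M c c' k = 0) (s : LowKind) (ι' : ℤˣ)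
    (U P Q : LowTree) (η : Bool) (ι : ℤˣ) (k : D.Mom) :
    D.amp (graft s ι' U P Q) η ι k = ∑ k₁ ∈ S,
      (((D.L ^ d : ℝ) : ℂ)⁻¹ * (-Complex.I) * D.nodeFactor s η ι ι' k k₁ *
        D.cov ι' (s.colourP η) (s.colourQ η) k₁) *
      (D.amp U η ι k * (D.amp P (s.colourP η) ι' k₁ * D.amp Q (s.colourQ η) (-ι') (-k₁))) := by
  rw [graft, amp_node hS hM]
  refine Finset.sum_congr rfl fun k₁ _ => ?_
  cases s with
  | l =>
    have h := hD.cov_mul_amp P Q (!η) η ι' ι' (-ι') k₁ k₁ (-k₁)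
    simp only [LowKind.fst, LowKind.snd, LowKind.thd, LowKind.colourP, LowKind.colourQ, pairCov]
    linear_combination ((D.L ^ d : ℝ) : ℂ)⁻¹ * (-Complex.I) * D.nodeFactor .l η ι ι' k k₁ *
      D.amp U η ι k * h
  | m => simp [hD.nodeFactor_m]
  | r =>
    have h := hD.cov_mul_amp P Q η (!η) ι' ι' (-ι') k₁ k₁ (-k₁)
    simp only [LowKind.fst, LowKind.snd, LowKind.thd, LowKind.colourP, LowKind.colourQ, pairCov]
    linear_combination ((D.L ^ d : ℝ) : ℂ)⁻¹ * (-Complex.I) * D.nodeFactor .r η ι ι' k k₁ *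
      D.amp U η ι k * h

theorem _root_.ResonantKG.LowTree.hasDerivAt_vol_graft (s : LowKind) (ι : ℤˣ) (U P Q : LowTree)
    (t : ℝ) : HasDerivAt (graft s ι U P Q).vol (U.vol t * (P.vol t * Q.vol t)) t := by
  have h := hasDerivAt_vol s ι (s.fst U P Q) (s.snd U P Q) (s.thd U P Q) t
  have e : (s.fst U P Q).vol t * ((s.snd U P Q).vol t * (s.thd U P Q).vol t) =
      U.vol t * (P.vol t * Q.vol t) := by
    cases s
    · rfl
    · exact mul_left_comm _ _ _
    · exact (mul_assoc _ _ _).symm.trans (mul_comm _ _)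
  exact e ▸ h

variable (D) in
/-- The sum of the contributions of the trees with `n` nodes, without the leaf at the end of the
spine of the root. -/
def treeSum (n : ℕ) (η : Bool) (ι : ℤˣ) (t : ℝ) (k : D.Mom) : ℂ :=
  ∑ T ∈ ofCard n, (T.vol t : ℂ) * D.amp T η ι k

variable (D) in
/-- The sum of the contributions of the pairs of trees with `n` nodes. -/
def corr (n : ℕ) (ι : ℤˣ) (c c' : Bool) (t : ℝ) (k : D.Mom) : ℂ :=
  D.cov ι c c' k * ∑ p ∈ Finset.HasAntidiagonal.antidiagonal n,
    D.treeSum p.1 c ι t k * D.treeSum p.2 c' (-ι) t (-k)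

theorem Standing.Xres_eq_corr (hD : D.Standing) (n : ℕ) (ι : ℤˣ) (c c' : Bool) {t : ℝ}
    (ht : 0 ≤ t) (k : D.Mom) : D.Xres n ι c c' t k = D.corr n ι c c' t k := by
  rw [Xres, sum_Res, corr, Finset.mul_sum]
  refine Finset.sum_congr rfl fun p _ => ?_
  rw [treeSum, treeSum, Finset.sum_mul_sum, Finset.mul_sum]
  refine Finset.sum_congr rfl fun T _ => ?_
  rw [Finset.mul_sum]
  refine Finset.sum_congr rfl fun T' _ => ?_
  rw [hD.F_toCoupling T T' c c' ι ht k]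
  linear_combination (T.vol t : ℂ) * (T'.vol t : ℂ) *
    hD.cov_mul_amp T T' c c' ι ι (-ι) k k (-k)

/-- Exchanging the two trees, together with their signs, colours and momenta, changes nothing. -/
theorem corr_swap (n : ℕ) (ι : ℤˣ) (c c' : Bool) (t : ℝ) (k : D.Mom) :
    D.corr n (-ι) c' c t (-k) = D.corr n ι c c' t k := by
  have h : D.cov (-ι) c' c ((-k : D.Mom) : Freq d) = D.cov ι c c' k :=
    cov_swap ι c c' (k : Freq d)
  rw [corr, corr, h, neg_neg, neg_neg]
  refine congrArg _ ((Finset.Nat.sum_antidiagonal_swap ..).symm.trans ?_)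
  exact Finset.sum_congr rfl fun p _ => mul_comm _ _

theorem corr_eq_zero {S : Finset D.Mom} (hS : ∀ k ∈ S, -k ∈ S)
    (hM : ∀ k : D.Mom, k ∉ S → ∀ c c', D.M c c' k = 0) (n : ℕ) (ι : ℤˣ) (c c' : Bool) (t : ℝ)
    {k : D.Mom} (hk : k ∉ S) : D.corr n ι c c' t k = 0 := by
  rw [corr, cov_eq_zero hS hM ι c c' hk, zero_mul]

variable (D) in
/-- The logarithmic derivative of the sum over trees, at order `n`. -/
def rate (S : Finset D.Mom) (n : ℕ) (η : Bool) (ι : ℤˣ) (t : ℝ) (k : D.Mom) : ℂ :=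
  ∑ s : LowKind, ∑ ι' : ℤˣ, ∑ k₁ ∈ S, ((D.L ^ d : ℝ) : ℂ)⁻¹ * (-Complex.I) *
    D.nodeFactor s η ι ι' k k₁ * D.corr n ι' (s.colourP η) (s.colourQ η) t k₁

theorem sum_mul_rearrange {K α β : Type} (S : Finset K) (c : K → ℂ) (su : Finset α)
    (N : Finset β) (sp sq : β → Finset α) (v a : α → ℂ) (aP aQ : K → α → ℂ) :
    ∑ U ∈ su, ∑ q ∈ N, ∑ P ∈ sp q, ∑ Q ∈ sq q,
      (v U * (v P * v Q)) * ∑ k ∈ S, c k * (a U * (aP k P * aQ k Q)) =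
    (∑ U ∈ su, v U * a U) * ∑ k ∈ S, c k * ∑ q ∈ N,
      (∑ P ∈ sp q, v P * aP k P) * ∑ Q ∈ sq q, v Q * aQ k Q := by
  rw [Finset.sum_mul]
  refine Finset.sum_congr rfl fun U _ => ?_
  simp only [Finset.sum_mul_sum]
  simp only [Finset.mul_sum]
  refine Eq.trans ?_ Finset.sum_comm
  refine Finset.sum_congr rfl fun q _ => ?_
  refine Eq.trans ?_ Finset.sum_comm
  refine Finset.sum_congr rfl fun P _ => ?_
  refine Eq.trans ?_ Finset.sum_comm
  refine Finset.sum_congr rfl fun Q _ => ?_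
  refine Finset.sum_congr rfl fun k _ => ?_
  ring

theorem treeSum_zero (η : Bool) (ι : ℤˣ) (t : ℝ) (k : D.Mom) : D.treeSum 0 η ι t k = 1 := by
  simp [treeSum, amp_leaf, vol]

theorem treeSum_succ_zero (n : ℕ) (η : Bool) (ι : ℤˣ) (k : D.Mom) :
    D.treeSum (n + 1) η ι 0 k = 0 := by
  refine Finset.sum_eq_zero fun T hT => ?_
  cases T with
  | leaf => simp [LowTree.card] at hT
  | node => simp [vol]

/-- Differentiating `vol` removes the root. Summation over the unmarked subtree reproduces
`treeSum`; summation over the two marked ones, with their covariance, gives `corr` inside `rate`. -/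
theorem Standing.hasDerivAt_treeSum_succ (hD : D.Standing) {S : Finset D.Mom}
    (hS : ∀ k ∈ S, -k ∈ S) (hM : ∀ k : D.Mom, k ∉ S → ∀ c c', D.M c c' k = 0) (n : ℕ) (η : Bool)
    (ι : ℤˣ) (t : ℝ) (k : D.Mom) :
    HasDerivAt (fun t => D.treeSum (n + 1) η ι t k)
      (∑ p ∈ Finset.HasAntidiagonal.antidiagonal n,
        D.treeSum p.1 η ι t k * D.rate S p.2 η ι t k) t := by
  have h : HasDerivAt (fun t => D.treeSum (n + 1) η ι t k)
      (∑ s : LowKind, ∑ ι' : ℤˣ,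
      ∑ p ∈ Finset.HasAntidiagonal.antidiagonal n, ∑ U ∈ ofCard p.1,
        ∑ q ∈ Finset.HasAntidiagonal.antidiagonal p.2, ∑ P ∈ ofCard q.1, ∑ Q ∈ ofCard q.2,
          ((U.vol t : ℂ) * ((P.vol t : ℂ) * (Q.vol t : ℂ))) * D.amp (graft s ι' U P Q) η ι k) t := by
    simp only [treeSum, sum_ofCard_succ]
    refine .fun_sum fun s _ => .fun_sum fun ι' _ => .fun_sum fun p _ => .fun_sum fun U _ =>
      .fun_sum fun q _ => .fun_sum fun P _ => .fun_sum fun Q _ => ?_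
    have := ((hasDerivAt_vol_graft s ι' U P Q t).ofReal_comp).mul_const
      (D.amp (graft s ι' U P Q) η ι k)
    push_cast at this
    exact this
  convert h using 1
  simp only [hD.amp_graft hS hM, rate, corr, Finset.mul_sum]
  rw [Finset.sum_comm]
  refine Finset.sum_congr rfl fun s _ => ?_
  rw [Finset.sum_comm]
  refine Finset.sum_congr rfl fun ι' _ => ?_
  refine Finset.sum_congr rfl fun p _ => ?_
  simp only [← Finset.mul_sum]
  rw [sum_mul_rearrange S _ _ _ _ _ (fun T => (T.vol t : ℂ)) (fun T => D.amp T η ι k)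
    (fun k₁ P => D.amp P (s.colourP η) ι' k₁) (fun k₁ Q => D.amp Q (s.colourQ η) (-ι') (-k₁))]
  simp only [treeSum, mul_assoc]

theorem continuous_treeSum (n : ℕ) (η : Bool) (ι : ℤˣ) (k : D.Mom) :
    Continuous fun t => D.treeSum n η ι t k :=
  continuous_finsetSum _ fun T _ => (Complex.continuous_ofReal.comp T.continuous_vol).mul
    continuous_const

theorem continuous_corr (n : ℕ) (ι : ℤˣ) (c c' : Bool) (k : D.Mom) :
    Continuous fun t => D.corr n ι c c' t k :=
  continuous_const.mul <| continuous_finsetSum _ fun _ _ =>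
    (continuous_treeSum _ _ _ _).mul (continuous_treeSum _ _ _ _)

theorem continuous_rate (S : Finset D.Mom) (n : ℕ) (η : Bool) (ι : ℤˣ) (k : D.Mom) :
    Continuous fun t => D.rate S n η ι t k :=
  continuous_finsetSum _ fun _ _ => continuous_finsetSum _ fun _ _ =>
    continuous_finsetSum _ fun _ _ => continuous_const.mul (continuous_corr _ _ _ _ _)

/-- The rate in terms of the correlations with positive left root. -/
theorem Standing.rate_eq (hD : D.Standing) {S : Finset D.Mom} (hS : ∀ k ∈ S, -k ∈ S)
    (n : ℕ) (η : Bool) (ι : ℤˣ) (t : ℝ) (k : D.Mom) :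
    D.rate S n η ι t k = -2 * Complex.I * ((ι : ℤ) : ℂ) * (((D.L ^ d : ℝ) : ℂ)⁻¹ * ∑ k₁ ∈ S,
      (D.χLowR k₁ (-k₁) k : ℂ) *
        (D.q₃ η (-ι) k (-k₁) k₁ * D.corr n 1 η (!η) t k₁ +
          D.q₃ η ι k k₁ (-k₁) * D.corr n 1 (!η) η t k₁)) := by
  -- Reflection k₁ ↦ -k₁ and `corr_swap` identify the low-l terms with the low-r terms of opposite
  -- marked sign (`hl`, whence the factor 2) and turn left root sign - into + (`hr`).
  have reflect : ∀ f : D.Mom → ℂ, ∑ k₁ ∈ S, f (-k₁) = ∑ k₁ ∈ S, f k₁ := fun f =>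
    Finset.sum_nbij' (fun k => -k) (fun k => -k) hS hS (fun _ _ => neg_neg _)
      (fun _ _ => neg_neg _) fun _ _ => rfl
  have hl : ∀ ι' : ℤˣ, ∑ k₁ ∈ S, D.nodeFactor .l η ι (-ι') k k₁ * D.corr n (-ι') (!η) η t k₁ =
      ∑ k₁ ∈ S, D.nodeFactor .r η ι ι' k k₁ * D.corr n ι' η (!η) t k₁ := by
    intro ι'
    rw [← reflect]
    refine Finset.sum_congr rfl fun k₁ _ => ?_
    rw [corr_swap, NegMemClass.coe_neg, hD.nodeFactor_l]
  have hr : ∑ k₁ ∈ S, D.nodeFactor .r η ι (-1) k k₁ * D.corr n (-1) η (!η) t k₁ =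
      ∑ k₁ ∈ S, ((ι : ℤ) : ℂ) * (D.χLowR k₁ (-k₁) k : ℂ) * D.q₃ η ι k k₁ (-k₁) *
        D.corr n 1 (!η) η t k₁ := by
    rw [← reflect]
    refine Finset.sum_congr rfl fun k₁ _ => ?_
    rw [corr_swap, NegMemClass.coe_neg, nodeFactor_r, neg_neg, neg_neg, mul_one, χLowR_swap,
      hD.q₃_symm]
  have h1 := hl 1
  have h2 := hl (-1)
  rw [neg_neg] at h2
  simp only [rate, LowKind.sum_eq, sum_units_int, hD.nodeFactor_m, LowKind.colourP,
    LowKind.colourQ, mul_zero, zero_mul, Finset.sum_const_zero, zero_add, mul_assoc]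
  simp only [← Finset.mul_sum]
  simp only [mul_assoc] at h1 h2 hr
  rw [h1, h2, hr]
  simp only [nodeFactor_r, Finset.mul_sum, ← Finset.sum_add_distrib]
  refine Finset.sum_congr rfl fun k₁ _ => ?_
  rw [hD.q₃_symm η _ (k₁ : Freq d), mul_neg_one]
  ring

end KGData
end ResonantKG

/-! ### Conjugation symmetry, and the hierarchy for the correlations -/

namespace ResonantKG

/-- The identity (a·r)·b = (a·b)·r between formal power series, read off at degree n. -/
theorem sum_antidiagonal_conv_comm (a b r : ℕ → ℂ) (n : ℕ) :
    ∑ p ∈ Finset.HasAntidiagonal.antidiagonal n,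
      (∑ q ∈ Finset.HasAntidiagonal.antidiagonal p.1, a q.1 * r q.2) * b p.2 =
    ∑ p ∈ Finset.HasAntidiagonal.antidiagonal n,
      (∑ q ∈ Finset.HasAntidiagonal.antidiagonal p.1, a q.1 * b q.2) * r p.2 := by
  have h := congrArg (PowerSeries.coeff n)
    (mul_right_comm (PowerSeries.mk a) (PowerSeries.mk r) (PowerSeries.mk b))
  simpa only [PowerSeries.coeff_mul, PowerSeries.coeff_mk] using h

/-- The product rule for Cauchy products of sequences that solve linear hierarchies. -/
theorem hasDerivAt_conv {a b : ℕ → ℝ → ℂ} {r s : ℕ → ℂ} {t : ℝ} (ha₀ : HasDerivAt (a 0) 0 t)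
    (ha : ∀ n, HasDerivAt (a (n + 1))
      (∑ p ∈ Finset.HasAntidiagonal.antidiagonal n, a p.1 t * r p.2) t)
    (hb₀ : HasDerivAt (b 0) 0 t)
    (hb : ∀ n, HasDerivAt (b (n + 1))
      (∑ p ∈ Finset.HasAntidiagonal.antidiagonal n, b p.1 t * s p.2) t) (n : ℕ) :
    HasDerivAt (fun t => ∑ p ∈ Finset.HasAntidiagonal.antidiagonal (n + 1), a p.1 t * b p.2 t)
      (∑ p ∈ Finset.HasAntidiagonal.antidiagonal n,
        (∑ q ∈ Finset.HasAntidiagonal.antidiagonal p.1, a q.1 t * b q.2 t) * (r p.2 + s p.2)) t := by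
  have ha' : ∀ n, HasDerivAt (a n) (deriv (a n) t) t := by
    rintro (_ | n)
    exacts [ha₀.differentiableAt.hasDerivAt, (ha n).differentiableAt.hasDerivAt]
  have hb' : ∀ n, HasDerivAt (b n) (deriv (b n) t) t := by
    rintro (_ | n)
    exacts [hb₀.differentiableAt.hasDerivAt, (hb n).differentiableAt.hasDerivAt]
  have h : HasDerivAt
      (fun t => ∑ p ∈ Finset.HasAntidiagonal.antidiagonal (n + 1), a p.1 t * b p.2 t)
      (∑ p ∈ Finset.HasAntidiagonal.antidiagonal (n + 1),
        (deriv (a p.1) t * b p.2 t + a p.1 t * deriv (b p.2) t)) t :=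
    .fun_sum fun p _ => (ha' p.1).mul (hb' p.2)
  convert h using 1
  simp only [mul_add, Finset.sum_add_distrib]
  rw [← sum_antidiagonal_conv_comm (fun n => a n t) (fun n => b n t)]
  refine congr_arg₂ _ ?_ ?_
  -- The constant zeroth coefficient drops out, which accounts for the shift from n + 1 to n.
  · rw [Finset.Nat.sum_antidiagonal_succ, ha₀.deriv, zero_mul, zero_add]
    exact Finset.sum_congr rfl fun p _ => by rw [(ha p.1).deriv]
  · rw [Finset.Nat.sum_antidiagonal_succ', hb₀.deriv, mul_zero, zero_add]
    have hc := sum_antidiagonal_conv_comm (fun n => b n t) (fun n => a n t) s n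
    refine Eq.trans ?_ (hc.symm.trans ?_)
    · refine Finset.sum_congr rfl fun p _ => congr_arg₂ _ ?_ rfl
      rw [← Finset.Nat.sum_antidiagonal_swap]
      exact Finset.sum_congr rfl fun q _ => mul_comm _ _
    · refine (Finset.Nat.sum_antidiagonal_swap ..).symm.trans (Finset.sum_congr rfl fun p _ => ?_)
      rw [Prod.fst_swap, Prod.snd_swap, (hb p.2).deriv, mul_comm]

namespace KGData

variable {d : ℕ} {D : KGData d}

theorem Standing.conj_cov (hD : D.Standing) (ι : ℤˣ) (c c' : Bool) (k : Freq d) :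
    starRingEnd ℂ (D.cov ι c c' k) = D.cov ι c' c k := by
  unfold cov
  split_ifs
  · exact (hD.M_conj c' c k).symm
  · exact (hD.M_conj c c' _).symm

theorem Standing.conj_corr_of (hD : D.Standing) {n : ℕ}
    (h : ∀ m ≤ n, ∀ (η : Bool) (ι : ℤˣ) (t : ℝ) (k : D.Mom),
      starRingEnd ℂ (D.treeSum m η ι t k) = D.treeSum m η (-ι) t (-k))
    (ι : ℤˣ) (c c' : Bool) (t : ℝ) (k : D.Mom) :
    starRingEnd ℂ (D.corr n ι c c' t k) = D.corr n ι c' c t k := by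
  rw [corr, corr, map_mul, hD.conj_cov, map_sum, ← Finset.Nat.sum_antidiagonal_swap]
  refine congrArg _ (Finset.sum_congr rfl fun p hp => ?_)
  rw [Finset.HasAntidiagonal.mem_antidiagonal] at hp
  rw [map_mul, Prod.fst_swap, Prod.snd_swap, h _ (by omega), h _ (by omega), neg_neg, neg_neg,
    mul_comm]

/-- Conjugating `q₃` reverses its momenta and conjugating a correlation exchanges its colours, so
the two terms of `rate_eq` trade places, while conjugating i reverses the sign. -/
theorem Standing.conj_rate_of (hD : D.Standing) {S : Finset D.Mom} (hS : ∀ k ∈ S, -k ∈ S) {n : ℕ}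
    (h : ∀ (c c' : Bool) (t : ℝ) (k : D.Mom),
      starRingEnd ℂ (D.corr n 1 c c' t k) = D.corr n 1 c' c t k)
    (η : Bool) (ι : ℤˣ) (t : ℝ) (k : D.Mom) :
    starRingEnd ℂ (D.rate S n η ι t k) = D.rate S n η (-ι) t (-k) := by
  rw [hD.rate_eq hS, hD.rate_eq hS]
  simp only [map_mul, map_neg, map_sum, map_add, map_inv₀, Complex.conj_ofReal, Complex.conj_I,
    ← hD.q₃_neg, h, NegMemClass.coe_neg, χLowR_neg, neg_neg, Units.val_neg, Int.cast_neg,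
    map_intCast, map_ofNat]
  have e : ∀ x y : ℂ, x = y → -2 * -Complex.I * ((ι : ℤ) : ℂ) * (((D.L ^ d : ℝ) : ℂ)⁻¹ * x) =
      -2 * Complex.I * -((ι : ℤ) : ℂ) * (((D.L ^ d : ℝ) : ℂ)⁻¹ * y) := by
    rintro x _ rfl
    ring
  exact e _ _ (Finset.sum_congr rfl fun k₁ _ => congrArg _ (add_comm _ _))

/-- At positive order both sides vanish at time 0 and have the same derivative. The rates in that
derivative involve correlations of strictly lower order only, hence the strong induction. -/
theorem Standing.conj_treeSum (hD : D.Standing) (n : ℕ) : ∀ (η : Bool) (ι : ℤˣ) (t : ℝ)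
    (k : D.Mom), starRingEnd ℂ (D.treeSum n η ι t k) = D.treeSum n η (-ι) t (-k) := by
  obtain ⟨S, hS, hM⟩ := hD.exists_finset
  induction n using Nat.strong_induction_on with
  | _ n ih =>
    intro η ι t k
    cases n with
    | zero => rw [treeSum_zero, treeSum_zero, map_one]
    | succ n =>
      have hd : ∀ t, HasDerivAt (fun t => starRingEnd ℂ (D.treeSum (n + 1) η ι t k) -
          D.treeSum (n + 1) η (-ι) t (-k)) 0 t := by
        intro t
        have h := ((hD.hasDerivAt_treeSum_succ hS hM n η ι t k).star).sub
          (hD.hasDerivAt_treeSum_succ hS hM n η (-ι) t (-k))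
        refine h.congr_deriv ?_
        rw [← starRingEnd_apply, map_sum, sub_eq_zero]
        refine Finset.sum_congr rfl fun p hp => ?_
        rw [Finset.HasAntidiagonal.mem_antidiagonal] at hp
        rw [map_mul, ih _ (by omega), hD.conj_rate_of hS fun c c' t k =>
          hD.conj_corr_of (fun m hm => ih m (by omega)) 1 c c' t k]
      have h := is_const_of_deriv_eq_zero (fun t => (hd t).differentiableAt)
        (fun t => (hd t).deriv) t 0
      simp only [treeSum_succ_zero, map_zero, sub_zero] at h
      exact sub_eq_zero.1 h

theorem Standing.conj_corr (hD : D.Standing) (n : ℕ) (ι : ℤˣ) (c c' : Bool) (t : ℝ) (k : D.Mom) :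
    starRingEnd ℂ (D.corr n ι c c' t k) = D.corr n ι c' c t k :=
  hD.conj_corr_of (fun m _ => hD.conj_treeSum m) ι c c' t k

/-- Product rule for the two tree sums; the rate of the right tree, of sign - and momentum -k, is
the conjugate of the one at + and k. -/
theorem Standing.hasDerivAt_corr_succ (hD : D.Standing) {S : Finset D.Mom}
    (hS : ∀ k ∈ S, -k ∈ S) (hM : ∀ k : D.Mom, k ∉ S → ∀ c c', D.M c c' k = 0) (n : ℕ)
    (c c' : Bool) (t : ℝ) (k : D.Mom) :
    HasDerivAt (fun t => D.corr (n + 1) 1 c c' t k)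
      (∑ p ∈ Finset.HasAntidiagonal.antidiagonal n, D.corr p.1 1 c c' t k *
        (D.rate S p.2 c 1 t k + starRingEnd ℂ (D.rate S p.2 c' 1 t k))) t := by
  have h₀ : ∀ (η : Bool) (ι : ℤˣ) (k : D.Mom), HasDerivAt (fun t => D.treeSum 0 η ι t k) 0 t := by
    intro η ι k
    simp only [treeSum_zero]
    exact hasDerivAt_const t 1
  have h := hasDerivAt_conv (a := fun n t => D.treeSum n c 1 t k)
    (b := fun n t => D.treeSum n c' (-1) t (-k)) (r := fun n => D.rate S n c 1 t k)
    (s := fun n => D.rate S n c' (-1) t (-k)) (h₀ _ _ _)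
    (fun n => hD.hasDerivAt_treeSum_succ hS hM n c 1 t k) (h₀ _ _ _)
    (fun n => hD.hasDerivAt_treeSum_succ hS hM n c' (-1) t (-k)) n
  refine (h.const_mul (D.cov 1 c c' k)).congr_deriv ?_
  rw [Finset.mul_sum]
  refine Finset.sum_congr rfl fun p _ => ?_
  rw [hD.conj_rate_of hS fun c c' t k => hD.conj_corr _ 1 c c' t k, corr]
  ring

theorem corr_succ_zero (n : ℕ) (ι : ℤˣ) (c c' : Bool) (k : D.Mom) :
    D.corr (n + 1) ι c c' 0 k = 0 := by
  rw [corr, Finset.sum_eq_zero, mul_zero]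
  rintro ⟨p, q⟩ hp
  rw [Finset.HasAntidiagonal.mem_antidiagonal] at hp
  rcases p with _ | p
  · obtain rfl : q = n + 1 := by simpa using hp
    rw [treeSum_succ_zero, mul_zero]
  · rw [treeSum_succ_zero, zero_mul]

theorem Standing.corr_succ (hD : D.Standing) {S : Finset D.Mom}
    (hS : ∀ k ∈ S, -k ∈ S) (hM : ∀ k : D.Mom, k ∉ S → ∀ c c', D.M c c' k = 0) (n : ℕ)
    (c c' : Bool) (t : ℝ) (k : D.Mom) :
    D.corr (n + 1) 1 c c' t k = ∑ p ∈ Finset.HasAntidiagonal.antidiagonal n, ∫ τ in (0 : ℝ)..t,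
      D.corr p.1 1 c c' τ k *
        (D.rate S p.2 c 1 τ k + starRingEnd ℂ (D.rate S p.2 c' 1 τ k)) := by
  have hc : ∀ p : ℕ × ℕ, Continuous fun τ => D.corr p.1 1 c c' τ k *
      (D.rate S p.2 c 1 τ k + starRingEnd ℂ (D.rate S p.2 c' 1 τ k)) := fun p =>
    (continuous_corr _ _ _ _ _).mul ((continuous_rate _ _ _ _ _).add
      (Complex.continuous_conj.comp (continuous_rate _ _ _ _ _)))
  rw [← intervalIntegral.integral_finsetSum fun p _ => (hc p).intervalIntegrable _ _,
    intervalIntegral.integral_eq_sub_of_hasDerivAt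
      (fun τ _ => hD.hasDerivAt_corr_succ hS hM n c c' τ k)
      ((continuous_finsetSum _ fun p _ => hc p).intervalIntegrable _ _), corr_succ_zero, sub_zero]

/-- The sum is twice the real part, and Re(-2iz) = 2 Im z gives the 4. The minus sign in `kerN`
comes from Im(q₋ρ) = -Im(conj q₋ · conj ρ), used to express both terms through conj ρ. -/
theorem Standing.rate_add_conj (hD : D.Standing) {S : Finset D.Mom} (hS : ∀ k ∈ S, -k ∈ S)
    (n : ℕ) (η : Bool) (t : ℝ) (k : D.Mom) :
    D.rate S n η 1 t k + starRingEnd ℂ (D.rate S n η 1 t k) =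
      4 * (((D.L ^ d)⁻¹ * ∑ k₂ ∈ S, D.χLowR k₂ (-k₂) k *
        (D.kerN η k k₂ * starRingEnd ℂ (D.corr n 1 η (!η) t k₂)).im : ℝ) : ℂ) := by
  have hre : (D.rate S n η 1 t k).re = 2 * ((D.L ^ d)⁻¹ * ∑ k₂ ∈ S, D.χLowR k₂ (-k₂) k *
        (D.kerN η k k₂ * starRingEnd ℂ (D.corr n 1 η (!η) t k₂)).im) := by
    have e : ∀ z : ℂ, (-2 * Complex.I * ((1 : ℤˣ) : ℤ) * z).re = 2 * z.im := by
      intro z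
      simp
    rw [hD.rate_eq hS, e, ← Complex.ofReal_inv, Complex.im_ofReal_mul, Complex.im_sum]
    refine congrArg _ (congrArg _ (Finset.sum_congr rfl fun k₁ _ => ?_))
    rw [Complex.im_ofReal_mul, ← hD.conj_corr n 1 η (!η), kerN]
    refine congrArg _ ?_
    simp only [Complex.add_im, Complex.mul_im, Complex.sub_re, Complex.sub_im, Complex.conj_re,
      Complex.conj_im]
    ring
  rw [Complex.add_conj, hre]
  push_cast
  ring

/-- The correlation of colours 1, 0 is the conjugate of that of colours 0, 1. Collecting the
coefficients of the latter and of its conjugate yields `kerPminus` and `kerPplus`. -/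
theorem Standing.rate_add_conj_cross (hD : D.Standing) {S : Finset D.Mom} (hS : ∀ k ∈ S, -k ∈ S)
    (n : ℕ) (t : ℝ) (k : D.Mom) :
    D.rate S n false 1 t k + starRingEnd ℂ (D.rate S n true 1 t k) =
      2 * Complex.I * (((D.L ^ d : ℝ) : ℂ)⁻¹ * ∑ k₂ ∈ S, (D.χLowR k₂ (-k₂) k : ℂ) *
        (D.kerPminus k k₂ * D.corr n 1 false true t k₂ +
          D.kerPplus k k₂ * starRingEnd ℂ (D.corr n 1 false true t k₂))) := by
  rw [hD.rate_eq hS, hD.rate_eq hS]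
  simp only [map_mul, map_neg, map_sum, map_add, map_inv₀, Complex.conj_ofReal, Complex.conj_I,
    map_ofNat, hD.conj_corr, Bool.not_false, Bool.not_true, Finset.mul_sum,
    ← Finset.sum_add_distrib, kerPminus, kerPplus, Units.val_one, Int.cast_one, map_one]
  refine Finset.sum_congr rfl fun k₁ _ => ?_
  ring

end KGData
end ResonantKG

end

/-! ### Conclusion: transfer from `corr` to the correlations of the statement -/

theorem proposition4p13 {d : ℕ} (D : ResonantKG.KGData d) (hD : D.Standing) :
    -- all sums over decorations and over momenta are finite, and all integrands are continuous
    (∀ (η η' : Bool) (C : ResonantKG.Coupling η η') (t : ℝ) (k : D.Mom),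
      (Function.support fun κ : D.Decoration C k => D.summand C t κ.1).Finite) ∧
    (∀ (n : ℕ) (t : ℝ), 0 ≤ t → (Function.support (D.ρcross n t)).Finite) ∧
    (∀ (η : Bool) (n : ℕ) (k : D.Mom), ContinuousOn (fun t => D.ρ η n t k) (Set.Ici 0)) ∧
    (∀ (n : ℕ) (k : D.Mom), ContinuousOn (fun t => D.ρcross n t k) (Set.Ici 0)) ∧
    -- real-valuedness
    (∀ (η : Bool) (n : ℕ) (t : ℝ) (k : D.Mom), 0 ≤ t → (D.ρ η n t k).im = 0) ∧
    -- initialization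
    (∀ (η : Bool) (t : ℝ) (k : D.Mom), 0 ≤ t → D.ρ η 0 t k = D.M η η k) ∧
    (∀ (t : ℝ) (k : D.Mom), 0 ≤ t → D.ρcross 0 t k = D.M false true k) ∧
    -- recursion
    (∀ (n : ℕ) (t : ℝ) (k : D.Mom), 0 ≤ t →
      D.ρ false (n + 1) t k =
        4 * ∑ p ∈ Finset.HasAntidiagonal.antidiagonal n, ∫ τ in (0 : ℝ)..t,
          D.ρ false p.1 τ k * (((D.L ^ d)⁻¹ * ∑' k₂ : D.Mom,
            D.χLowR k₂ (-k₂) k *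
              (D.kerN false k k₂ * starRingEnd ℂ (D.ρcross p.2 τ k₂)).im : ℝ) : ℂ)) ∧
    (∀ (n : ℕ) (t : ℝ) (k : D.Mom), 0 ≤ t →
      D.ρ true (n + 1) t k =
        4 * ∑ p ∈ Finset.HasAntidiagonal.antidiagonal n, ∫ τ in (0 : ℝ)..t,
          D.ρ true p.1 τ k * (((D.L ^ d)⁻¹ * ∑' k₂ : D.Mom,
            D.χLowR k₂ (-k₂) k *
              (D.kerN true k k₂ * D.ρcross p.2 τ k₂).im : ℝ) : ℂ)) ∧
    (∀ (n : ℕ) (t : ℝ) (k : D.Mom), 0 ≤ t →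
      D.ρcross (n + 1) t k =
        2 * Complex.I * ∑ p ∈ Finset.HasAntidiagonal.antidiagonal n, ∫ τ in (0 : ℝ)..t,
          D.ρcross p.1 τ k * ((D.L ^ d : ℝ) : ℂ)⁻¹ * ∑' k₂ : D.Mom,
            (D.χLowR k₂ (-k₂) k : ℂ) *
              (D.kerPminus k k₂ * D.ρcross p.2 τ k₂
                + D.kerPplus k k₂ * starRingEnd ℂ (D.ρcross p.2 τ k₂))) := by
  open ResonantKG ResonantKG.KGData in
  obtain ⟨S, hS, hM⟩ := hD.exists_finset
  have hX : ∀ (c c' : Bool) (n : ℕ) {t : ℝ} (_ : 0 ≤ t) (k : D.Mom),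
      D.Xres n 1 c c' t k = D.corr n 1 c c' t k := fun c c' n t ht k =>
    hD.Xres_eq_corr n 1 c c' ht k
  have hC : ∀ (c c' : Bool) (n : ℕ) (k : D.Mom),
      ContinuousOn (fun t => D.Xres n 1 c c' t k) (Set.Ici 0) := fun c c' n k =>
    (continuous_corr n 1 c c' k).continuousOn.congr fun t ht => hX c c' n ht k
  have h₀ : ∀ (c c' : Bool) {t : ℝ} (_ : 0 ≤ t) (k : D.Mom),
      D.Xres 0 1 c c' t k = D.M c c' k := fun c c' t ht k => by
    rw [hX c c' 0 ht, corr]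
    simp [treeSum_zero, cov]
  have hR : ∀ (c c' : Bool) (n : ℕ) {t : ℝ} (_ : 0 ≤ t) (k : D.Mom),
      D.Xres (n + 1) 1 c c' t k = ∑ p ∈ Finset.HasAntidiagonal.antidiagonal n,
        ∫ τ in (0 : ℝ)..t, D.Xres p.1 1 c c' τ k *
          (D.rate S p.2 c 1 τ k + starRingEnd ℂ (D.rate S p.2 c' 1 τ k)) := by
    intro c c' n t ht k
    rw [hX c c' _ ht, hD.corr_succ hS hM]
    refine Finset.sum_congr rfl fun p _ => intervalIntegral.integral_congr fun τ hτ => ?_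
    -- The integration variable stays in [0,t], where `Xres` and `corr` agree.
    rw [Set.uIcc_of_le ht] at hτ
    rw [hX c c' _ hτ.1]
  have hz : ∀ (n : ℕ) (c c' : Bool) (τ : ℝ) (k : D.Mom), k ∉ S → D.corr n 1 c c' τ k = 0 :=
    fun n c c' τ k hk => corr_eq_zero hS hM n 1 c c' τ hk
  refine ⟨fun η η' C t k => hD.finite_support_summand C t k,
    fun n t _ => hD.finite_support_Xres n 1 false true t, fun η => hC η η, hC false true,
    fun η n t k ht => ?_, fun η t k ht => h₀ η η ht k, fun t k ht => h₀ false true ht k,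
    fun n t k ht => ?_, fun n t k ht => ?_, fun n t k ht => ?_⟩
  · rw [ρ, hX η η n ht]
    exact Complex.conj_eq_iff_im.1 (hD.conj_corr n 1 η η t k)
  · rw [ρ, hR false false n ht, Finset.mul_sum]
    refine Finset.sum_congr rfl fun p _ => ?_
    rw [← intervalIntegral.integral_const_mul]
    refine intervalIntegral.integral_congr fun τ hτ => ?_
    rw [Set.uIcc_of_le ht] at hτ
    simp only [hD.rate_add_conj hS, ρ, ρcross, hX false true _ hτ.1, Bool.not_false]
    -- The correlations vanish outside `S`, so the lattice sum reduces to the finite sum in `rate`.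
    rw [tsum_eq_sum (s := S) fun k₂ hk₂ => by rw [hz _ _ _ _ _ hk₂]; simp]
    exact mul_left_comm _ _ _
  · rw [ρ, hR true true n ht, Finset.mul_sum]
    refine Finset.sum_congr rfl fun p _ => ?_
    rw [← intervalIntegral.integral_const_mul]
    refine intervalIntegral.integral_congr fun τ hτ => ?_
    rw [Set.uIcc_of_le ht] at hτ
    -- For colour 1 the correlation in the rate has colours 1, 0; its conjugate is the cross
    -- correlation itself, so no conjugation remains.
    simp only [hD.rate_add_conj hS, ρ, ρcross, hX false true _ hτ.1, Bool.not_true, hD.conj_corr]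
    rw [tsum_eq_sum (s := S) fun k₂ hk₂ => by rw [hz _ _ _ _ _ hk₂]; simp]
    exact mul_left_comm _ _ _
  · rw [ρcross, hR false true n ht, Finset.mul_sum]
    refine Finset.sum_congr rfl fun p _ => ?_
    rw [← intervalIntegral.integral_const_mul]
    refine intervalIntegral.integral_congr fun τ hτ => ?_
    rw [Set.uIcc_of_le ht] at hτ
    simp only [hD.rate_add_conj_cross hS, ρcross, hX false true _ hτ.1]
    rw [tsum_eq_sum (s := S) fun k₂ hk₂ => by rw [hz _ _ _ _ _ hk₂]; simp]
    ring
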